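/- **Definitions.** Let $F$ be a real vector space with a symmetric bilinear form $I$ of signature $(l,2,0)$ ($l$ positive, $2$ zero, $0$ negative squares). For non-isotropic $\alpha\in F$ put $\alpha^\vee=2\alpha/I(\alpha,\alpha)$ and $w_\alpha(\lambda)=\lambda-I(\lambda,\alpha^\vee)\alpha$. An *elliptic root system* in $(F,I)$ is a non-empty discrete subset $R\subset F$ such that the root lattice $Q(R)=\mathbb Z R$ is a full lattice in $F$; $I(\alpha,\alpha)\ne 0$ and $w_\alpha(R)=R$ for all $\alpha\in R$; $I(\alpha^\vee,\beta)\in\mathbb Z$ for all $\alpha,\beta\in R$; and $R$ is not the union of two non-empty mutually orthogonal subsets. A *marking* is a line $G\subset\operatorname{rad}(I)$ such that $G\cap Q(R)$ is full in $G$; then $(R,G)$ is a *marked elliptic root system* in signature $(l,2,0)$, and $R/G$ denotes the image of $R$ in $F/G$. $R$ is *reduced* if $2\alpha,\tfrac12\alpha\notin R$ for all $\alpha\in R$. An isomorphism $(R,G)\cong(R',G')$ is a linear isomorphism $F\to F'$ carrying $R$ onto $R'$ and $G$ onto $G'$; an isomorphism of quotients $R/G$, or of a quotient with $R(X_l)$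 below, is a linear isomorphism of the ambient spaces carrying roots onto roots. **Standard models.** Let $\varepsilon_1,\dots,\varepsilon_l,a,b$ be the standard basis of $\mathbb R^{l+2}$, with $I(\varepsilon_i,\varepsilon_j)=\delta_{ij}$ and $a,b$ spanning the radical. Let $BC_l$ have short roots $\pm\varepsilon_i$, middle roots $\pm(\varepsilon_i\pm\varepsilon_j)$ $(i<j)$ and long roots $\pm2\varepsilon_i$; denote these sets by $\Delta_s,\Delta_m,\Delta_l$. The affine root systems $R(X_l)$ in $\mathbb R^l\oplus\mathbb Rb$ are $$R(X_l)=(\Delta_s+\mathbb Zb)\cup(\Delta_m+\mu\mathbb Zb)\cup(\Delta_l+\nu\mathbb Zb),$$ with $(\mu,\nu)=(1,1),(2,4),(1,2),(2,2)$ for $X_l=BCC_l,\ C^\vee BC_l,\ BB_l^\vee,\ C^\vee C_l$ respectively. For $S,M,E\subset\Lambda=\mathbb Za\oplus\mathbb Zb$ put $$R(S,M,E)=(\Delta_s+S)\cup(\Delta_m+M)\cup(\Delta_l+E),$$ always with marking $G=\mathbb Ra$. Write $[i,j]=i\mathbb Za+j\mathbb Zb$, $L_{i,j}^{s_1,s_2}=\{s_2ma+s_1nb\mid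 (m-i)(n-j)\text{ even}\}$ and $L_{i,j}=L_{i,j}^{1,1}$. The list consists of the following $35$ types, where $p\in\{0,1\}$ and $l\ge 1$ unless otherwise stated. *Classical types* ($16$), for each of the four $X_l$ (with $l\ge2$ whenever $X_l=BB_l^\vee$, and with $l\ge 2$ for $X_l^{(2)}(1)$): - $X_l^{(1)}$: $([1,1],[1,\mu],[1,\nu])$ - $X_l^{(2)}(1)$: $([1,1],[1,\mu],[2,\nu])$ - $X_l^{(2)}(2)$: $([1,1],[2,\mu],[2,\nu])$ - $X_l^{(4)}$: $([1,1],[2,\mu],[4,\nu])$ *Listed under $BCC_l$:* - $BCC_l^{(1)*_0}$: $(\Lambda,\Lambda,L_{0,0})$ - $BCC_l^{(1)*_{0'}}$: $(\Lambda,\Lambda,L_{0,1})$ - $BCC_l^{(2)*_p}$: $(\Lambda,[2,1],L_{p,p}^{1,2})$ *Listed under $C^\vee BC_l$:* - $C^\vee BC_l^{(2)*_p}$: $(L_{p,p},2\Lambda,[2,4])$ - $C^\vee BC_l^{(4)*_0}$: $(L_{0,0},2\Lambda,4\Lambda)$ - $C^\vee BC_l^{(4)*_{0'}}$: $(L_{0,1},2\Lambda,4\Lambda)$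 *Listed under $BB_l^\vee$, only for $l=2$:* - $BB_2^{\vee(2)*}$: $(\Lambda,L_{0,0},2\Lambda)$ *Listed under $C^\vee C_l$:* - $C^\vee C_l^{(1)*_p}$: $(\Lambda,[1,2],L_{p,p}^{2,1})$ - $C^\vee C_l^{(2)*_s}$: $(L_{0,0},2\Lambda,2\Lambda)$ - $C^\vee C_l^{(2)*_l}$: $(\Lambda,2\Lambda,L_{0,0}^{2,2})$ - $C^\vee C_l^{(2)*_0}$: $(L_{0,0},2\Lambda,L_{0,0}^{2,2})$ - $C^\vee C_l^{(2)*_1}$: $(L_{0,0},2\Lambda,L_{1,1}^{2,2})$ - $C^\vee C_l^{(2)*_{1'}}$: $(L_{0,0},2\Lambda,L_{1,0}^{2,2})$ - $C^\vee C_l^{(2)\diamond}$: $(\Lambda,[1,2],\{ma+2nb\mid m-n\text{ even}\})$ - $C^\vee C_l^{(4)*_p}$: $(L_{p,p},2\Lambda,[4,2])$ **Theorem.** For every $l$, each of the listed types occurring in rank $l$ is a non-reduced marked elliptic root system in signature $(l,2,0)$ whose quotient $R/G$ is isomorphic to the affine root system $R(X_l)$ under which it is listed. Conversely, every non-reduced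 marked elliptic root system $(R,G)$ in signature $(l,2,0)$ is isomorphic to exactly one of the listed types occurring in rank $l$, by an isomorphism that respects the forms up to a positive factor, and $R/G$ is isomorphic to the corresponding $R(X_l)$. Uniqueness holds even among arbitrary linear isomorphisms of pairs. -/

import Mathlib

namespace MERS

/-! ### Generalized root systems, markings, isomorphisms -/

section General

variable {F : Type*} [NormedAddCommGroup F] [NormedSpace ℝ F]
variable {F' : Type*} [NormedAddCommGroup F'] [NormedSpace ℝ F']

/-- The bilinear form `I` has signature `(p, z, n)`: in a suitable basis of `F` its Gram matrix is
diagonal with `p` entries `1`, `z` entries `0` and `n` entries `-1`. -/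
def HasSignature (I : LinearMap.BilinForm ℝ F) (p z n : ℕ) : Prop :=
  ∃ e : Module.Basis (Fin p ⊕ Fin z ⊕ Fin n) ℝ F,
    (∀ i j, i ≠ j → I (e i) (e j) = 0) ∧
    (∀ i, I (e (Sum.inl i)) (e (Sum.inl i)) = 1) ∧
    (∀ i, I (e (Sum.inr (Sum.inl i))) (e (Sum.inr (Sum.inl i))) = 0) ∧
    (∀ i, I (e (Sum.inr (Sum.inr i))) (e (Sum.inr (Sum.inr i))) = -1)

/-- `α^∨ = 2 α / I(α, α)`, used for non-isotropic `α` only. -/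
noncomputable def coroot (I : LinearMap.BilinForm ℝ F) (α : F) : F := (2 / I α α) • α

/-- `w_α(x) = x - I(x, α^∨) α`. -/
noncomputable def refl (I : LinearMap.BilinForm ℝ F) (α x : F) : F := x - I x (coroot I α) • α

/-- The root lattice `Q(R)`. -/
def rootLattice (R : Set F) : Submodule ℤ F := Submodule.span ℤ R

/-- Generalized root systems belonging to `(F, I)`. The space `F` is finite-dimensional in all uses,
so its topology does not depend on the norm. -/
structure IsGeneralizedRootSystem (I : LinearMap.BilinForm ℝ F) (R : Set F) : Prop where
  nonempty : R.Nonempty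
  discrete : DiscreteTopology R
  lattice_discrete : DiscreteTopology (rootLattice R)
  lattice_full : Submodule.span ℝ (rootLattice R : Set F) = ⊤
  nonisotropic : ∀ α ∈ R, I α α ≠ 0
  integral : ∀ α ∈ R, ∀ β ∈ R, ∃ k : ℤ, I (coroot I α) β = k
  refl_image : ∀ α ∈ R, refl I α '' R = R
  irreducible : ∀ R₁ R₂ : Set F, R₁ ∪ R₂ = R → (∀ α ∈ R₁, ∀ β ∈ R₂, I α β = 0) →
    R₁ = ∅ ∨ R₂ = ∅

/-- A (one-dimensional) marking of `R`: a line `G` in the radical of `I` in which `G ∩ Q(R)`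
is full. -/
structure IsMarking (I : LinearMap.BilinForm ℝ F) (R : Set F) (G : Submodule ℝ F) : Prop where
  le_rad : G ≤ LinearMap.ker I
  finrank_eq : Module.finrank ℝ G = 1
  full : Submodule.span ℝ ((G : Set F) ∩ (rootLattice R : Set F)) = G

/-- `(R, G)` is a marked elliptic root system belonging to `F` with the symmetric bilinear form `I`
of signature `(l, 2, 0)`. -/
structure IsMarkedElliptic (l : ℕ) (I : LinearMap.BilinForm ℝ F) (R : Set F)
    (G : Submodule ℝ F) : Prop where
  symm : ∀ x y, I x y = I y x
  signature : HasSignature I l 2 0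
  rootSystem : IsGeneralizedRootSystem I R
  marking : IsMarking I R G

/-- `R` is reduced: for `α ∈ R` neither `2α` nor `α/2` belongs to `R`. -/
def IsReduced (R : Set F) : Prop :=
  ∀ α ∈ R, (2 : ℝ) • α ∉ R ∧ (1 / 2 : ℝ) • α ∉ R

/-- Isomorphism of pairs `(R, G)`: a linear isomorphism of the ambient spaces that carries `R` onto
`R'` and `G` onto `G'`. -/
def MarkedIso (R : Set F) (G : Submodule ℝ F) (R' : Set F') (G' : Submodule ℝ F') : Prop :=
  ∃ e : F ≃ₗ[ℝ] F', e '' R = R' ∧ e '' (G : Set F) = (G' : Set F')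

/-- Isomorphism of pairs `(R, G)` that moreover respects the forms up to a positive factor. -/
def MarkedSimilar (I : LinearMap.BilinForm ℝ F) (R : Set F) (G : Submodule ℝ F)
    (I' : LinearMap.BilinForm ℝ F') (R' : Set F') (G' : Submodule ℝ F') : Prop :=
  ∃ e : F ≃ₗ[ℝ] F', e '' R = R' ∧ e '' (G : Set F) = (G' : Set F') ∧
    ∃ c : ℝ, 0 < c ∧ ∀ x y, I' (e x) (e y) = c * I x y

/-- The quotient root system `R/G`: the image of `R` in `F/G`. -/
def quotientRoots (R : Set F) (G : Submodule ℝ F) : Set (F ⧸ G) := G.mkQ '' R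

end General

/-! ### The finite root system `BC_l` -/

/-- The short roots `±ε_i` of `BC_l`. -/
def shortBC (l : ℕ) : Set (Fin l → ℝ) :=
  {v | ∃ i, v = Pi.single i 1 ∨ v = -Pi.single i 1}

/-- The middle length roots `±(ε_i ± ε_j)`, `i < j`, of `BC_l`. -/
def middleBC (l : ℕ) : Set (Fin l → ℝ) :=
  {v | ∃ i j, i < j ∧
    (v = Pi.single i 1 + Pi.single j 1 ∨ v = -(Pi.single i 1 + Pi.single j 1) ∨
     v = Pi.single i 1 - Pi.single j 1 ∨ v = -(Pi.single i 1 - Pi.single j 1))}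

/-- The long roots `±2ε_i` of `BC_l`. -/
def longBC (l : ℕ) : Set (Fin l → ℝ) :=
  {v | ∃ i, v = (2 : ℝ) • Pi.single i 1 ∨ v = -((2 : ℝ) • Pi.single i 1)}

/-! ### The four non-reduced affine root systems -/

/-- The names `BCC_l`, `C^∨BC_l`, `BB_l^∨`, `C^∨C_l`. -/
inductive AffineType
  | BCC
  | CvBC
  | BBv
  | CvC

/-- The middle roots of `R(X_l)` are `R(BC_l)_m + (X.middle) ℤ b`. -/
def AffineType.middle : AffineType → ℤ
  | .BCC => 1
  | .CvBC => 2
  | .BBv => 1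
  | .CvC => 2

/-- The long roots of `R(X_l)` are `R(BC_l)_l + (X.long) ℤ b`. -/
def AffineType.long : AffineType → ℤ
  | .BCC => 1
  | .CvBC => 4
  | .BBv => 2
  | .CvC => 2

/-- `R(X_l)` in `ℝ^l ⊕ ℝ b`; the short roots are `R(BC_l)_s + ℤ b`. -/
def AffineType.roots (X : AffineType) (l : ℕ) : Set ((Fin l → ℝ) × ℝ) :=
  {v | v.1 ∈ shortBC l ∧ ∃ n : ℤ, v.2 = n} ∪
  {v | v.1 ∈ middleBC l ∧ ∃ n : ℤ, X.middle ∣ n ∧ v.2 = n} ∪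
  {v | v.1 ∈ longBC l ∧ ∃ n : ℤ, X.long ∣ n ∧ v.2 = n}

/-! ### The standard space `ℝ^l ⊕ ℝ a ⊕ ℝ b` -/

/-- `(x, (p, q))` stands for `∑ x_i ε_i + p a + q b`. -/
abbrev Space (l : ℕ) : Type := (Fin l → ℝ) × (ℝ × ℝ)

/-- The form with `I(ε_i, ε_j) = δ_{ij}` and radical `ℝ a ⊕ ℝ b`. -/
noncomputable def form (l : ℕ) : LinearMap.BilinForm ℝ (Space l) :=
  LinearMap.mk₂ ℝ (fun x y => ∑ i, x.1 i * y.1 i)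
    (fun x y z => by simp [add_mul, Finset.sum_add_distrib])
    (fun c x y => by simp [Finset.mul_sum, mul_assoc])
    (fun x y z => by simp [mul_add, Finset.sum_add_distrib])
    (fun c x y => by simp [Finset.mul_sum, mul_left_comm])

/-- The vector `a`. -/
def vecA (l : ℕ) : Space l := (0, (1, 0))

/-- The marking `G = ℝ a`. -/
def lineA (l : ℕ) : Submodule ℝ (Space l) := Submodule.span ℝ {vecA l}

/-- `(R(BC_l)_s + S) ∪ (R(BC_l)_m + M) ∪ (R(BC_l)_l + E)` for subsets `S, M, E` of
`ℤ a ⊕ ℤ b`; the pair `(m, n)` stands for `m a + n b`. -/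
def rootsOf (l : ℕ) (S M E : Set (ℤ × ℤ)) : Set (Space l) :=
  {v | v.1 ∈ shortBC l ∧ ∃ p ∈ S, v.2 = ((p.1 : ℝ), (p.2 : ℝ))} ∪
  {v | v.1 ∈ middleBC l ∧ ∃ p ∈ M, v.2 = ((p.1 : ℝ), (p.2 : ℝ))} ∪
  {v | v.1 ∈ longBC l ∧ ∃ p ∈ E, v.2 = ((p.1 : ℝ), (p.2 : ℝ))}

/-- The lattice `i ℤ a + j ℤ b`. -/
def lat (i j : ℤ) : Set (ℤ × ℤ) := {p | i ∣ p.1 ∧ j ∣ p.2}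

/-- `L_{i,j}^{s₁,s₂} = { s₂ m a + s₁ n b | (m - i)(n - j) even }`. -/
def starSet (i j s₁ s₂ : ℤ) : Set (ℤ × ℤ) :=
  {p | ∃ m n : ℤ, Even ((m - i) * (n - j)) ∧ p = (s₂ * m, s₁ * n)}

/-- `{ m a + 2 n b | m - n even }`. -/
def diamondSet : Set (ℤ × ℤ) := {p | ∃ m n : ℤ, Even (m - n) ∧ p = (m, 2 * n)}

/-! ### The list of types -/

/-- The superscripts `(1)`, `(2)(1)`, `(2)(2)`, `(4)` of the classical types. -/
inductive ClassicalKind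
  | one
  | twoOne
  | twoTwo
  | four

/-- The types of the list: the 16 classical types `X^{(1)}`, `X^{(2)}(1)`, `X^{(2)}(2)`, `X^{(4)}`
and 19 further ones; for example `CvC2star1'` stands for `C^∨C_l^{(2)∗_{1'}}`. -/
inductive EllipticType
  | classical (X : AffineType) (k : ClassicalKind)
  | BCC1star0
  | BCC1star0'
  | BCC2star0
  | BCC2star1
  | CvBC2star0
  | CvBC2star1
  | CvBC4star0
  | CvBC4star0'
  | BBv2star
  | CvC1star0
  | CvC1star1
  | CvC2starS
  | CvC2starL
  | CvC2star0
  | CvC2star1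
  | CvC2star1'
  | CvC2diamond
  | CvC4star0
  | CvC4star1

namespace EllipticType

/-- The affine type under which a type is listed. -/
def quotient : EllipticType → AffineType
  | classical X _ => X
  | BCC1star0 | BCC1star0' | BCC2star0 | BCC2star1 => .BCC
  | CvBC2star0 | CvBC2star1 | CvBC4star0 | CvBC4star0' => .CvBC
  | BBv2star => .BBv
  | CvC1star0 | CvC1star1 | CvC2starS | CvC2starL | CvC2star0 | CvC2star1 | CvC2star1'
  | CvC2diamond | CvC4star0 | CvC4star1 => .CvC

/-- The ranks `l` for which a type occurs in the list. -/
def Admissible : EllipticType → ℕ → Prop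
  | classical .BBv _, l => 2 ≤ l
  | classical _ .twoOne, l => 2 ≤ l
  | BBv2star, l => l = 2
  | _, l => 1 ≤ l

/-- The subset `S` of `ℤ a ⊕ ℤ b` with `R_s = R(BC_l)_s + S`. -/
def shortSet : EllipticType → Set (ℤ × ℤ)
  | classical _ _ => lat 1 1
  | BCC1star0 | BCC1star0' | BCC2star0 | BCC2star1 => lat 1 1
  | CvBC2star0 => starSet 0 0 1 1
  | CvBC2star1 => starSet 1 1 1 1
  | CvBC4star0 => starSet 0 0 1 1
  | CvBC4star0' => starSet 0 1 1 1
  | BBv2star => lat 1 1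
  | CvC1star0 | CvC1star1 => lat 1 1
  | CvC2starS => starSet 0 0 1 1
  | CvC2starL => lat 1 1
  | CvC2star0 | CvC2star1 | CvC2star1' => starSet 0 0 1 1
  | CvC2diamond => lat 1 1
  | CvC4star0 => starSet 0 0 1 1
  | CvC4star1 => starSet 1 1 1 1

/-- The subset `M` of `ℤ a ⊕ ℤ b` with `R_m = R(BC_l)_m + M`. -/
def middleSet : EllipticType → Set (ℤ × ℤ)
  | classical X .one => lat 1 X.middle
  | classical X .twoOne => lat 1 X.middle
  | classical X .twoTwo => lat 2 X.middle
  | classical X .four => lat 2 X.middle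
  | BCC1star0 | BCC1star0' => lat 1 1
  | BCC2star0 | BCC2star1 => lat 2 1
  | CvBC2star0 | CvBC2star1 | CvBC4star0 | CvBC4star0' => lat 2 2
  | BBv2star => starSet 0 0 1 1
  | CvC1star0 | CvC1star1 => lat 1 2
  | CvC2starS | CvC2starL | CvC2star0 | CvC2star1 | CvC2star1' => lat 2 2
  | CvC2diamond => lat 1 2
  | CvC4star0 | CvC4star1 => lat 2 2

/-- The subset `E` of `ℤ a ⊕ ℤ b` with `R_l = R(BC_l)_l + E`. -/
def longSet : EllipticType → Set (ℤ × ℤ)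
  | classical X .one => lat 1 X.long
  | classical X .twoOne => lat 2 X.long
  | classical X .twoTwo => lat 2 X.long
  | classical X .four => lat 4 X.long
  | BCC1star0 => starSet 0 0 1 1
  | BCC1star0' => starSet 0 1 1 1
  | BCC2star0 => starSet 0 0 1 2
  | BCC2star1 => starSet 1 1 1 2
  | CvBC2star0 | CvBC2star1 => lat 2 4
  | CvBC4star0 | CvBC4star0' => lat 4 4
  | BBv2star => lat 2 2
  | CvC1star0 => starSet 0 0 2 1
  | CvC1star1 => starSet 1 1 2 1
  | CvC2starS => lat 2 2
  | CvC2starL => starSet 0 0 2 2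
  | CvC2star0 => starSet 0 0 2 2
  | CvC2star1 => starSet 1 1 2 2
  | CvC2star1' => starSet 1 0 2 2
  | CvC2diamond => diamondSet
  | CvC4star0 | CvC4star1 => lat 4 2

/-- The standard root system of the given type in `ℝ^l ⊕ ℝ a ⊕ ℝ b`. -/
def roots (t : EllipticType) (l : ℕ) : Set (Space l) :=
  rootsOf l t.shortSet t.middleSet t.longSet

end EllipticType

end MERS

/-!
Existence of coordinates. Call a root `α` a half root if `2α` is a root. Since `(2α)^∨ = α^∨ / 2`,
the Cartan integers `I(α^∨, β)` are even, so modulo the radical two half roots of the same length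
are orthogonal, equal or opposite. The half roots linked to a fixed one by a root span the space
modulo the radical by irreducibility, hence are the vectors `±ε_i` of a system of type `BC_l`. Lifts
of the `ε_i` to the root lattice, together with a lattice basis of the radical whose first vector
spans the marking, identify the root lattice with `ℤ^l ⊕ Λ`.

Normal forms. In such coordinates `R = (Δ_s + S) ∪ (Δ_m + M) ∪ (Δ_l + E)`, and closure under
reflections is a condition on `S`, `M` and `E` alone. It makes `M` a lattice containing `2Λ`, except
in rank one, where there are no middle roots, and possibly in rank two, where `M` can be the union
of three cosets of `2Λ`. A shear `b ↦ b + k a` takes such a lattice to some `[i, j]` with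
`i, j ∈ {1, 2}`. Since `S + M = S` and `E + 2M = E`, only finitely many triples remain.

Distinctness. The roots are bounded modulo the radical, so an isomorphism of pairs preserves the
radical. It therefore acts on the translation sets by affine maps that preserve the direction of
`a`. All translation sets of the list are unions of cosets of `4Λ`, and the numbers of pairs in
`Λ / 4Λ` with the same coefficient of `b` tell the types apart.
-/

namespace MERS

/-! ### Translation sets modulo `4` -/

/-- Reduction `Λ → Λ / 4Λ` for `Λ = ℤ a ⊕ ℤ b`. -/
def residue : ℤ × ℤ →+ ZMod 4 × ZMod 4 :=
  (Int.castAddHom (ZMod 4)).prodMap (Int.castAddHom (ZMod 4))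

theorem residue_apply (p : ℤ × ℤ) : residue p = ((p.1 : ZMod 4), (p.2 : ZMod 4)) := rfl

/-- The representative of a class in `Λ / 4Λ` with coordinates in `{0, 1, 2, 3}`. -/
def rep (q : ZMod 4 × ZMod 4) : ℤ × ℤ := (q.1.val, q.2.val)

theorem residue_rep (q : ZMod 4 × ZMod 4) : residue (rep q) = q := by simp [residue_apply, rep]

theorem exists_eq_add_four_smul {p q : ℤ × ℤ} (h : residue p = residue q) :
    ∃ z : ℤ × ℤ, q = p + (4 : ℤ) • z := by
  rw [residue_apply, residue_apply, Prod.mk.injEq, ZMod.intCast_eq_intCast_iff_dvd_sub,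
    ZMod.intCast_eq_intCast_iff_dvd_sub] at h
  obtain ⟨⟨m, hm⟩, ⟨n, hn⟩⟩ := h
  refine ⟨(m, n), Prod.ext ?_ ?_⟩ <;>
    simp only [Prod.fst_add, Prod.snd_add, Prod.smul_fst, Prod.smul_snd, smul_eq_mul] <;> grind

/-- `X` is a union of cosets of `4Λ`. All translation sets of the list are, which turns statements
about the list into finite checks in `Λ / 4Λ`. -/
def IsFourPeriodic (X : Set (ℤ × ℤ)) : Prop := ∀ p ∈ X, ∀ z : ℤ × ℤ, p + (4 : ℤ) • z ∈ X

/-- The classes in `Λ / 4Λ` of a `4Λ`-periodic set. The set is tested on representatives, so that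
membership is decidable whenever it is in `X`. -/
def classes (X : Set (ℤ × ℤ)) : Set (ZMod 4 × ZMod 4) := {q | rep q ∈ X}

namespace IsFourPeriodic

variable {X Y : Set (ℤ × ℤ)}

theorem mem_iff (hX : IsFourPeriodic X) {p q : ℤ × ℤ} (h : residue p = residue q) :
    p ∈ X ↔ q ∈ X := by
  obtain ⟨z, hz⟩ := exists_eq_add_four_smul h
  obtain ⟨z', hz'⟩ := exists_eq_add_four_smul h.symm
  exact ⟨fun hp => hz ▸ hX p hp z, fun hq => hz' ▸ hX q hq z'⟩

theorem mem_iff_residue_mem (hX : IsFourPeriodic X) (p : ℤ × ℤ) :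
    p ∈ X ↔ residue p ∈ classes X :=
  hX.mem_iff (residue_rep _).symm

theorem eq_preimage_classes (hX : IsFourPeriodic X) : X = residue ⁻¹' classes X :=
  Set.ext hX.mem_iff_residue_mem

theorem ext (hX : IsFourPeriodic X) (hY : IsFourPeriodic Y)
    (h : ∀ q, rep q ∈ X ↔ rep q ∈ Y) : X = Y := by
  rw [hX.eq_preimage_classes, hY.eq_preimage_classes]
  exact congrArg _ (Set.ext h)

theorem preimage (hX : IsFourPeriodic X) (φ : ℤ × ℤ →+ ℤ × ℤ) (ξ : ℤ × ℤ) :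
    IsFourPeriodic {p | φ p + ξ ∈ X} := fun p hp z => by
  have h := hX _ hp (φ z)
  rwa [add_right_comm, ← map_zsmul, ← map_add] at h

end IsFourPeriodic

theorem isFourPeriodic_lat {i j : ℤ} (hi : i ∣ 4) (hj : j ∣ 4) : IsFourPeriodic (lat i j) :=
  fun _ hp _ => ⟨dvd_add hp.1 (hi.mul_right _), dvd_add hp.2 (hj.mul_right _)⟩

theorem isFourPeriodic_starSet (i j : ℤ) {s₁ s₂ : ℤ} (h₁ : s₁ ∣ 2) (h₂ : s₂ ∣ 2) :
    IsFourPeriodic (starSet i j s₁ s₂) := by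
  rintro _ ⟨m, n, h, rfl⟩ ⟨x, y⟩
  obtain ⟨e₁, he₁⟩ := h₁
  obtain ⟨e₂, he₂⟩ := h₂
  refine ⟨m + 2 * e₂ * x, n + 2 * e₁ * y, ?_, Prod.ext ?_ ?_⟩
  · rw [Int.even_mul] at h ⊢
    grind
  · change s₂ * m + 4 * x = _
    linear_combination 2 * x * he₂
  · change s₁ * n + 4 * y = _
    linear_combination 2 * y * he₁

theorem isFourPeriodic_diamondSet : IsFourPeriodic diamondSet := by
  rintro _ ⟨m, n, h, rfl⟩ ⟨x, y⟩
  refine ⟨m + 4 * x, n + 2 * y, by grind, Prod.ext rfl ?_⟩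
  change 2 * n + 4 * y = _
  ring

theorem mem_starSet_iff {i j s₁ s₂ : ℤ} (h₁ : s₁ ≠ 0) (h₂ : s₂ ≠ 0) (p : ℤ × ℤ) :
    p ∈ starSet i j s₁ s₂ ↔
      s₂ ∣ p.1 ∧ s₁ ∣ p.2 ∧ Even ((p.1 / s₂ - i) * (p.2 / s₁ - j)) := by
  constructor
  · rintro ⟨m, n, h, rfl⟩
    simpa [h₁, h₂] using h
  · rintro ⟨⟨m, hm⟩, ⟨n, hn⟩, h⟩
    exact ⟨m, n, by simpa [hm, hn, h₁, h₂] using h, Prod.ext hm hn⟩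

theorem mem_diamondSet_iff (p : ℤ × ℤ) : p ∈ diamondSet ↔ 2 ∣ p.2 ∧ Even (p.1 - p.2 / 2) := by
  constructor
  · rintro ⟨m, n, h, rfl⟩
    simpa using h
  · rintro ⟨⟨n, hn⟩, h⟩
    exact ⟨p.1, n, by simpa [hn] using h, Prod.ext rfl hn⟩

instance (i j : ℤ) : DecidablePred (· ∈ lat i j) := fun p =>
  inferInstanceAs (Decidable (i ∣ p.1 ∧ j ∣ p.2))

instance (i j s₁ s₂ : ℤ) [NeZero s₁] [NeZero s₂] : DecidablePred (· ∈ starSet i j s₁ s₂) :=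
  fun p => decidable_of_iff' _ (mem_starSet_iff (NeZero.ne s₁) (NeZero.ne s₂) p)

instance : DecidablePred (· ∈ diamondSet) := fun p => decidable_of_iff' _ (mem_diamondSet_iff p)

instance (X : Set (ℤ × ℤ)) [DecidablePred (· ∈ X)] : DecidablePred (· ∈ classes X) := fun q =>
  inferInstanceAs (Decidable (rep q ∈ X))

/-! ### The list of types -/

namespace EllipticType

instance (t : EllipticType) : DecidablePred (· ∈ t.shortSet) := fun p => by
  cases t <;> unfold shortSet <;> infer_instance

instance (t : EllipticType) : DecidablePred (· ∈ t.middleSet) := fun p => by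
  rcases t with ⟨X, k⟩ | _
  · cases k <;> unfold middleSet <;> infer_instance
  all_goals unfold middleSet; infer_instance

instance (t : EllipticType) : DecidablePred (· ∈ t.longSet) := fun p => by
  rcases t with ⟨X, k⟩ | _
  · cases k <;> unfold longSet <;> infer_instance
  all_goals unfold longSet; infer_instance

instance (t : EllipticType) (l : ℕ) : Decidable (t.Admissible l) := by
  rcases t with ⟨X, k⟩ | _
  · cases X <;> cases k <;> unfold Admissible <;> infer_instance
  all_goals unfold Admissible; infer_instance

/-- The types in the order of the list. -/
def list : List EllipticType :=
  [classical .BCC .one, classical .BCC .twoOne, classical .BCC .twoTwo, classical .BCC .four,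
    classical .CvBC .one, classical .CvBC .twoOne, classical .CvBC .twoTwo, classical .CvBC .four,
    classical .BBv .one, classical .BBv .twoOne, classical .BBv .twoTwo, classical .BBv .four,
    classical .CvC .one, classical .CvC .twoOne, classical .CvC .twoTwo, classical .CvC .four,
    BCC1star0, BCC1star0', BCC2star0, BCC2star1, CvBC2star0, CvBC2star1, CvBC4star0, CvBC4star0',
    BBv2star, CvC1star0, CvC1star1, CvC2starS, CvC2starL, CvC2star0, CvC2star1, CvC2star1',
    CvC2diamond, CvC4star0, CvC4star1]

theorem nodup_list : list.Nodup := by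
  simp [list]

theorem mem_list (t : EllipticType) : t ∈ list := by
  rcases t with ⟨X, k⟩ | _
  · cases X <;> cases k <;> simp [list]
  all_goals simp [list]

instance : Fintype EllipticType := ⟨⟨list, nodup_list⟩, mem_list⟩

theorem natCard_eq : Nat.card EllipticType = 35 := by
  rw [Nat.card_eq_fintype_card]
  rfl

theorem isFourPeriodic_shortSet (t : EllipticType) : IsFourPeriodic t.shortSet := by
  cases t
  all_goals first
    | exact isFourPeriodic_lat (by decide) (by decide)
    | exact isFourPeriodic_starSet _ _ (by decide) (by decide)

theorem isFourPeriodic_middleSet (t : EllipticType) : IsFourPeriodic t.middleSet := by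
  rcases t with ⟨X, k⟩ | _
  · cases X <;> cases k <;> exact isFourPeriodic_lat (by decide) (by decide)
  all_goals first
    | exact isFourPeriodic_lat (by decide) (by decide)
    | exact isFourPeriodic_starSet _ _ (by decide) (by decide)

theorem isFourPeriodic_longSet (t : EllipticType) : IsFourPeriodic t.longSet := by
  rcases t with ⟨X, k⟩ | _
  · cases X <;> cases k <;> exact isFourPeriodic_lat (by decide) (by decide)
  all_goals first
    | exact isFourPeriodic_lat (by decide) (by decide)
    | exact isFourPeriodic_starSet _ _ (by decide) (by decide)
    | exact isFourPeriodic_diamondSet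

theorem Admissible.one_le {t : EllipticType} {l : ℕ} (h : t.Admissible l) : 1 ≤ l := by
  rcases t with ⟨X, k⟩ | _
  · cases X <;> cases k <;> simp only [Admissible] at h <;> omega
  all_goals simp only [Admissible] at h; omega

theorem admissible_of_admissible_three {t : EllipticType} (ht : t.Admissible 3) {l : ℕ}
    (hl : 2 ≤ l) : t.Admissible l := by
  rcases t with ⟨X, k⟩ | _
  · cases X <;> cases k <;> simp only [Admissible] <;> omega
  all_goals simp only [Admissible] at ht ⊢; omega

theorem Admissible.three {t : EllipticType} {l : ℕ} (h : t.Admissible l) (hl : 3 ≤ l) :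
    t.Admissible 3 := by
  rcases t with ⟨X, k⟩ | _
  · cases X <;> cases k <;> simp only [Admissible] <;> omega
  all_goals simp only [Admissible] at h ⊢; omega

end EllipticType

/-! ### Translation sets closed under reflections -/

/-- The closure properties of translation sets `S`, `M`, `E` under which the set of roots
`(Δ_s + S) ∪ (Δ_m + M) ∪ (Δ_l + E)` is closed under its reflections; here `Δ` is of type `BC_l`. -/
structure ReflClosed {A : Type*} [AddCommGroup A] (l : ℕ) (S M E : Set A) : Prop where
  neg_short : ∀ x ∈ S, -x ∈ S
  neg_middle : ∀ x ∈ M, -x ∈ M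
  neg_long : ∀ x ∈ E, -x ∈ E
  short_short : ∀ x ∈ S, ∀ y ∈ S, y - (2 : ℤ) • x ∈ S
  short_middle : ∀ x ∈ S, ∀ y ∈ M, y - (2 : ℤ) • x ∈ M
  short_long : ∀ x ∈ S, ∀ y ∈ E, y - (4 : ℤ) • x ∈ E
  middle_short : ∀ x ∈ M, ∀ y ∈ S, y - x ∈ S
  middle_middle : ∀ x ∈ M, ∀ y ∈ M, y - (2 : ℤ) • x ∈ M
  middle_middle_sub : 3 ≤ l → ∀ x ∈ M, ∀ y ∈ M, y - x ∈ M
  middle_long : ∀ x ∈ M, ∀ y ∈ E, y - (2 : ℤ) • x ∈ E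
  long_short : ∀ x ∈ E, ∀ y ∈ S, y - x ∈ S
  long_middle : ∀ x ∈ E, ∀ y ∈ M, y - x ∈ M
  long_long : ∀ x ∈ E, ∀ y ∈ E, y - (2 : ℤ) • x ∈ E

namespace ReflClosed

variable {A B : Type*} [AddCommGroup A] [AddCommGroup B] {l : ℕ} {S M E : Set A}

theorem preimage (h : ReflClosed l S M E) (φ : B →+ A) :
    ReflClosed l (φ ⁻¹' S) (φ ⁻¹' M) (φ ⁻¹' E) := by
  constructor <;>
    simp only [Set.mem_preimage, map_neg, map_sub, map_zsmul]
  · exact fun x hx => h.neg_short _ hx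
  · exact fun x hx => h.neg_middle _ hx
  · exact fun x hx => h.neg_long _ hx
  · exact fun x hx y hy => h.short_short _ hx _ hy
  · exact fun x hx y hy => h.short_middle _ hx _ hy
  · exact fun x hx y hy => h.short_long _ hx _ hy
  · exact fun x hx y hy => h.middle_short _ hx _ hy
  · exact fun x hx y hy => h.middle_middle _ hx _ hy
  · exact fun hl x hx y hy => h.middle_middle_sub hl _ hx _ hy
  · exact fun x hx y hy => h.middle_long _ hx _ hy
  · exact fun x hx y hy => h.long_short _ hx _ hy
  · exact fun x hx y hy => h.long_middle _ hx _ hy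
  · exact fun x hx y hy => h.long_long _ hx _ hy

end ReflClosed

namespace EllipticType

theorem classes_shortSet_closed (t : EllipticType) {x : ZMod 4 × ZMod 4}
    (hx : x ∈ classes t.shortSet) (y : ZMod 4 × ZMod 4) :
    -x ∈ classes t.shortSet ∧
      (y ∈ classes t.shortSet → y - (2 : ℤ) • x ∈ classes t.shortSet) ∧
      (y ∈ classes t.middleSet → y - (2 : ℤ) • x ∈ classes t.middleSet) := by
  revert t x y
  decide +kernel

theorem classes_middleSet_closed (t : EllipticType) {x : ZMod 4 × ZMod 4}
    (hx : x ∈ classes t.middleSet) (y : ZMod 4 × ZMod 4) :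
    -x ∈ classes t.middleSet ∧
      (y ∈ classes t.shortSet → y - x ∈ classes t.shortSet) ∧
      (y ∈ classes t.middleSet → y - (2 : ℤ) • x ∈ classes t.middleSet ∧
        (t.Admissible 3 → y - x ∈ classes t.middleSet)) ∧
      (y ∈ classes t.longSet → y - (2 : ℤ) • x ∈ classes t.longSet) := by
  revert t x y
  decide +kernel

theorem classes_longSet_closed (t : EllipticType) {x : ZMod 4 × ZMod 4}
    (hx : x ∈ classes t.longSet) (y : ZMod 4 × ZMod 4) :
    -x ∈ classes t.longSet ∧
      (y ∈ classes t.shortSet → y - x ∈ classes t.shortSet) ∧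
      (y ∈ classes t.middleSet → y - x ∈ classes t.middleSet) ∧
      (y ∈ classes t.longSet → y - (2 : ℤ) • x ∈ classes t.longSet) := by
  revert t x y
  decide +kernel

theorem Admissible.reflClosed_classes {t : EllipticType} {l : ℕ} (h : t.Admissible l) :
    ReflClosed l (classes t.shortSet) (classes t.middleSet) (classes t.longSet) where
  neg_short _ hx := (t.classes_shortSet_closed hx 0).1
  neg_middle _ hx := (t.classes_middleSet_closed hx 0).1
  neg_long _ hx := (t.classes_longSet_closed hx 0).1
  short_short _ hx y := (t.classes_shortSet_closed hx y).2.1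
  short_middle _ hx y := (t.classes_shortSet_closed hx y).2.2
  short_long x _ y hy := by
    have four_smul : ∀ x : ZMod 4 × ZMod 4, (4 : ℤ) • x = 0 := by decide
    rwa [four_smul, sub_zero]
  middle_short _ hx y := (t.classes_middleSet_closed hx y).2.1
  middle_middle _ hx y hy := ((t.classes_middleSet_closed hx y).2.2.1 hy).1
  middle_middle_sub hl _ hx y hy := ((t.classes_middleSet_closed hx y).2.2.1 hy).2 (h.three hl)
  middle_long _ hx y := (t.classes_middleSet_closed hx y).2.2.2
  long_short _ hx y := (t.classes_longSet_closed hx y).2.1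
  long_middle _ hx y := (t.classes_longSet_closed hx y).2.2.1
  long_long _ hx y := (t.classes_longSet_closed hx y).2.2.2

theorem Admissible.reflClosed {t : EllipticType} {l : ℕ} (h : t.Admissible l) :
    ReflClosed l t.shortSet t.middleSet t.longSet := by
  rw [t.isFourPeriodic_shortSet.eq_preimage_classes,
    t.isFourPeriodic_middleSet.eq_preimage_classes, t.isFourPeriodic_longSet.eq_preimage_classes]
  exact h.reflClosed_classes.preimage residue

/-! ### Elements of the translation sets -/

theorem exists_short_add_a_and_add_b (t : EllipticType) :
    (∃ p ∈ t.shortSet, p + (1, 0) ∈ t.shortSet) ∧ ∃ p ∈ t.shortSet, p + (0, 1) ∈ t.shortSet := by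
  have key : ∀ t : EllipticType, (∃ q, rep q ∈ t.shortSet ∧ rep q + (1, 0) ∈ t.shortSet) ∧
      ∃ q, rep q ∈ t.shortSet ∧ rep q + (0, 1) ∈ t.shortSet := by decide +kernel
  exact ⟨(key t).1.imp' _ fun _ => id, (key t).2.imp' _ fun _ => id⟩

theorem middleSet_nonempty (t : EllipticType) : t.middleSet.Nonempty := by
  have key : ∀ t : EllipticType, ∃ q, rep q ∈ t.middleSet := by decide +kernel
  exact (key t).imp' _ fun _ => id

theorem exists_two_smul_mem_longSet (t : EllipticType) :
    ∃ p ∈ t.shortSet, (2 : ℤ) • p ∈ t.longSet := by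
  have key : ∀ t : EllipticType, ∃ q, rep q ∈ t.shortSet ∧ (2 : ℤ) • rep q ∈ t.longSet := by
    decide +kernel
  exact (key t).imp' _ fun _ => id

end EllipticType

theorem IsFourPeriodic.exists_fst_mem_iff {X : Set (ℤ × ℤ)} (hX : IsFourPeriodic X) (n : ℤ) :
    (∃ m, (m, n) ∈ X) ↔ ∃ m, (m, (n : ZMod 4)) ∈ classes X :=
  ⟨fun ⟨m, h⟩ => ⟨m, (hX.mem_iff_residue_mem _).1 h⟩, fun ⟨m, h⟩ =>
    ⟨m.val, (hX.mem_iff_residue_mem _).2 (by simpa [residue_apply] using h)⟩⟩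

namespace EllipticType

theorem exists_fst_mem_classes_iff (t : EllipticType) (n : ZMod 4) :
    (∃ m, (m, n) ∈ classes t.shortSet) ∧
      ((∃ m, (m, n) ∈ classes t.middleSet) ↔ t.quotient.middle ∣ n.val) ∧
      ((∃ m, (m, n) ∈ classes t.longSet) ↔ t.quotient.long ∣ n.val) := by
  revert t n
  decide +kernel

theorem dvd_val_intCast_iff {d : ℤ} (hd : d ∣ 4) (n : ℤ) : d ∣ (n : ZMod 4).val ↔ d ∣ n := by
  rw [ZMod.val_intCast]
  exact EuclideanDomain.dvd_mod_iff hd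

theorem exists_fst_mem_shortSet (t : EllipticType) (n : ℤ) : ∃ m, (m, n) ∈ t.shortSet :=
  (t.isFourPeriodic_shortSet.exists_fst_mem_iff n).2 (t.exists_fst_mem_classes_iff n).1

theorem exists_fst_mem_middleSet_iff (t : EllipticType) (n : ℤ) :
    (∃ m, (m, n) ∈ t.middleSet) ↔ t.quotient.middle ∣ n := by
  rw [t.isFourPeriodic_middleSet.exists_fst_mem_iff, (t.exists_fst_mem_classes_iff n).2.1,
    dvd_val_intCast_iff (by cases t.quotient <;> decide)]

theorem exists_fst_mem_longSet_iff (t : EllipticType) (n : ℤ) :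
    (∃ m, (m, n) ∈ t.longSet) ↔ t.quotient.long ∣ n := by
  rw [t.isFourPeriodic_longSet.exists_fst_mem_iff, (t.exists_fst_mem_classes_iff n).2.2,
    dvd_val_intCast_iff (by cases t.quotient <;> decide)]

end EllipticType

/-! ### Invariants of the list -/

section AffinePerm

variable {A B : Type*} [CommRing A] [CommRing B]

/-- The affine permutation `m a + n b ↦ (c m + k n) a + d n b + ξ`; these are the affine
permutations that respect the marking `a`. -/
def affinePerm (c d : Aˣ) (k : A) (ξ : A × A) : Equiv.Perm (A × A) where
  toFun p := (c * p.1 + k * p.2, d * p.2) + ξ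
  invFun p := (c⁻¹ * (p.1 - ξ.1 - k * (d⁻¹ * (p.2 - ξ.2))), d⁻¹ * (p.2 - ξ.2))
  left_inv p := by simp
  right_inv p := by ext <;> simp

theorem affinePerm_apply (c d : Aˣ) (k : A) (ξ p : A × A) :
    affinePerm c d k ξ p = (c * p.1 + k * p.2, d * p.2) + ξ := rfl

theorem affinePerm_add_self (c d : Aˣ) (k : A) (ξ p : A × A) :
    affinePerm c d k (ξ + ξ) (p + p) = affinePerm c d k ξ p + affinePerm c d k ξ p := by
  ext <;> simp only [affinePerm_apply, Prod.fst_add, Prod.snd_add] <;> ring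

theorem prodMap_affinePerm (f : A →+* B) (c d : Aˣ) (k : A) (ξ p : A × A) :
    Prod.map f f (affinePerm c d k ξ p) =
      affinePerm (Units.map f c) (Units.map f d) (f k) (Prod.map f f ξ) (Prod.map f f p) := by
  ext <;> simp [affinePerm_apply]

end AffinePerm

/-- The number of pairs in `X × Y` whose entries have the same coefficient of `b`. -/
def pairCount (X Y : Set (ZMod 4 × ZMod 4)) [DecidablePred (· ∈ X)] [DecidablePred (· ∈ Y)] : ℕ :=
  Finset.card {q : (ZMod 4 × ZMod 4) × (ZMod 4 × ZMod 4) | q.1.2 = q.2.2 ∧ q.1 ∈ X ∧ q.2 ∈ Y}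

/-- The elements of `X` whose double belongs to `Y`. -/
def halves {A : Type*} [Add A] (X Y : Set A) : Set A := {p | p ∈ X ∧ p + p ∈ Y}

/-- The elements of `Y` that are doubles of elements of `X`. -/
def doubles {A : Type*} [Add A] (X Y : Set A) : Set A := {p | p ∈ Y ∧ ∃ s, s ∈ X ∧ s + s = p}

section Decidable

variable (X Y : Set (ZMod 4 × ZMod 4)) [DecidablePred (· ∈ X)] [DecidablePred (· ∈ Y)]

instance : DecidablePred (· ∈ halves X Y) := fun p =>
  inferInstanceAs (Decidable (p ∈ X ∧ p + p ∈ Y))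

instance : DecidablePred (· ∈ doubles X Y) := fun p =>
  inferInstanceAs (Decidable (p ∈ Y ∧ ∃ s, s ∈ X ∧ s + s = p))

/-- The counts attached to the translation sets of short and long roots. -/
def shortLongCounts : ℕ × ℕ × ℕ × ℕ :=
  (pairCount X X, pairCount Y Y, pairCount X (halves X Y), pairCount Y (doubles X Y))

end Decidable

section Invariance

variable {X Y X' Y' : Set (ZMod 4 × ZMod 4)} [DecidablePred (· ∈ X)] [DecidablePred (· ∈ Y)]
  [DecidablePred (· ∈ X')] [DecidablePred (· ∈ Y')] (c d : (ZMod 4)ˣ) (k : ZMod 4)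
  (ξ : ZMod 4 × ZMod 4)

theorem pairCount_eq (hX : ∀ p, p ∈ X ↔ affinePerm c d k ξ p ∈ X')
    (hY : ∀ p, p ∈ Y ↔ affinePerm c d k ξ p ∈ Y') : pairCount X Y = pairCount X' Y' :=
  Finset.card_equiv ((affinePerm c d k ξ).prodCongr (affinePerm c d k ξ)) fun q => by
    simp [hX, hY, affinePerm_apply]

theorem shortLongCounts_eq (hX : ∀ p, p ∈ X ↔ affinePerm c d k ξ p ∈ X')
    (hY : ∀ p, p ∈ Y ↔ affinePerm c d k (ξ + ξ) p ∈ Y') :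
    shortLongCounts X Y = shortLongCounts X' Y' := by
  have hhalves (p) : p ∈ halves X Y ↔ affinePerm c d k ξ p ∈ halves X' Y' := by
    rw [halves, halves, Set.mem_ofPred, Set.mem_ofPred, hX, hY, affinePerm_add_self]
  have hdoubles (p) :
      p ∈ doubles X Y ↔ affinePerm c d k (ξ + ξ) p ∈ doubles X' Y' := by
    rw [doubles, doubles, Set.mem_ofPred, Set.mem_ofPred, hY,
      (affinePerm c d k ξ).exists_congr_left]
    simp only [hX, Equiv.apply_symm_apply]
    refine and_congr_right fun _ => exists_congr fun s => and_congr_right fun _ => ?_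
    rw [← (affinePerm c d k (ξ + ξ)).apply_eq_iff_eq, affinePerm_add_self, Equiv.apply_symm_apply]
  simp only [shortLongCounts, pairCount_eq c d k ξ hX hX, pairCount_eq c d k _ hY hY,
    pairCount_eq c d k ξ hX hhalves, pairCount_eq c d k _ hY hdoubles]

end Invariance

namespace EllipticType

theorem nodup_counts : (list.map fun t =>
    (shortLongCounts (classes t.shortSet) (classes t.longSet),
      pairCount (classes t.middleSet) (classes t.middleSet))).Nodup := by
  decide +kernel

theorem nodup_counts_rank_one : ((list.filter (Admissible · 1)).map fun t =>
    shortLongCounts (classes t.shortSet) (classes t.longSet)).Nodup := by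
  decide +kernel

theorem eq_of_affinePerm {t t' : EllipticType} {l : ℕ} (ht : t.Admissible l)
    (ht' : t'.Admissible l) (c d : ℤˣ) (k : ℤ) (ξ η : ℤ × ℤ)
    (hS : ∀ p, p ∈ t.shortSet ↔ affinePerm c d k ξ p ∈ t'.shortSet)
    (hM : 2 ≤ l → ∀ p, p ∈ t.middleSet ↔ affinePerm c d k η p ∈ t'.middleSet)
    (hE : ∀ p, p ∈ t.longSet ↔ affinePerm c d k (ξ + ξ) p ∈ t'.longSet) : t = t' := by
  let f := Int.castRingHom (ZMod 4)
  have mod_four {X X' : Set (ℤ × ℤ)} {θ : ℤ × ℤ} (hX : IsFourPeriodic X)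
      (hX' : IsFourPeriodic X') (h : ∀ p, p ∈ X ↔ affinePerm c d k θ p ∈ X')
      (q : ZMod 4 × ZMod 4) : q ∈ classes X ↔
        affinePerm (Units.map f c) (Units.map f d) (f k) (residue θ) q ∈ classes X' := by
    rw [← residue_rep q, ← hX.mem_iff_residue_mem, h, hX'.mem_iff_residue_mem]
    exact iff_of_eq (congrArg (· ∈ classes X') (prodMap_affinePerm f c d k θ (rep q)))
  have hcounts := shortLongCounts_eq _ _ _ (residue ξ)
    (mod_four t.isFourPeriodic_shortSet t'.isFourPeriodic_shortSet hS)
    (map_add residue ξ ξ ▸ mod_four t.isFourPeriodic_longSet t'.isFourPeriodic_longSet hE)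
  rcases ht.one_le.eq_or_lt with rfl | hl
  · exact List.inj_on_of_nodup_map nodup_counts_rank_one
      (List.mem_filter.2 ⟨mem_list t, by simpa using ht⟩)
      (List.mem_filter.2 ⟨mem_list t', by simpa using ht'⟩) hcounts
  · have hmiddle := mod_four t.isFourPeriodic_middleSet t'.isFourPeriodic_middleSet (hM hl)
    exact List.inj_on_of_nodup_map nodup_counts (mem_list t) (mem_list t')
      (Prod.ext hcounts (pairCount_eq _ _ _ _ hmiddle hmiddle))

end EllipticType

/-! ### Classification of translation sets -/

/-- The subset of `lat i j` of those `i m a + j n b` whose parities `(m, n)` are `(0, 0)` or one of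
`(1, 0)`, `(0, 1)`, `(1, 1)`, the latter being allowed as prescribed by `u`, `v`, `w`. -/
def paritySet (i j : ℤ) (u v w : Bool) : Set (ℤ × ℤ) :=
  {p | p ∈ lat i j ∧ (Odd (p.1 / i) → Even (p.2 / j) → u) ∧ (Even (p.1 / i) → Odd (p.2 / j) → v) ∧
    (Odd (p.1 / i) → Odd (p.2 / j) → w)}

instance (i j : ℤ) (u v w : Bool) : DecidablePred (· ∈ paritySet i j u v w) := fun p =>
  inferInstanceAs (Decidable (p ∈ lat i j ∧ (Odd (p.1 / i) → Even (p.2 / j) → u) ∧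
    (Even (p.1 / i) → Odd (p.2 / j) → v) ∧ (Odd (p.1 / i) → Odd (p.2 / j) → w)))

theorem mul_mem_paritySet_iff {i j : ℤ} (hi : i ≠ 0) (hj : j ≠ 0) (u v w : Bool) (m n : ℤ) :
    (i * m, j * n) ∈ paritySet i j u v w ↔
      (Odd m → Even n → u) ∧ (Even m → Odd n → v) ∧ (Odd m → Odd n → w) := by
  simp [paritySet, lat, hi, hj]

theorem exists_eq_paritySet {i j : ℤ} (hi : i ≠ 0) (hj : j ≠ 0) {X : Set (ℤ × ℤ)} (h0 : 0 ∈ X)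
    (hX : X ⊆ lat i j) (hadd : ∀ x ∈ X, ∀ z ∈ lat i j, x + (2 : ℤ) • z ∈ X) :
    ∃ u v w, X = paritySet i j u v w := by
  classical
  have hshift (m n m' n' : ℤ) :
      (i * (2 * m' + m), j * (2 * n' + n)) ∈ X ↔ (i * m, j * n) ∈ X := by
    have hmem (s : ℤ) : (i * (s * m'), j * (s * n')) ∈ lat i j := ⟨⟨_, rfl⟩, ⟨_, rfl⟩⟩
    constructor <;> intro h
    · convert hadd _ h _ (hmem (-1)) using 1
      ext <;> simp <;> ring
    · convert hadd _ h _ (hmem 1) using 1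
      ext <;> simp <;> ring
  refine ⟨decide ((i, 0) ∈ X), decide ((0, j) ∈ X), decide ((i, j) ∈ X), Set.ext fun p => ?_⟩
  suffices ∀ m n, (i * m, j * n) ∈ X ↔ (i * m, j * n) ∈ paritySet i j _ _ _ by
    constructor <;> intro h
    · obtain ⟨⟨m, hm⟩, ⟨n, hn⟩⟩ := hX h
      rw [← Prod.mk.eta (p := p), hm, hn] at h ⊢
      exact (this m n).1 h
    · obtain ⟨⟨m, hm⟩, ⟨n, hn⟩⟩ := h.1
      rw [← Prod.mk.eta (p := p), hm, hn] at h ⊢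
      exact (this m n).2 h
  intro m n
  rw [mul_mem_paritySet_iff hi hj]
  rcases Int.even_or_odd' m with ⟨m, rfl | rfl⟩ <;> rcases Int.even_or_odd' n with ⟨n, rfl | rfl⟩
  · simpa [show ((0, 0) : ℤ × ℤ) ∈ X from h0] using hshift 0 0 m n
  · simpa using hshift 0 1 m n
  · simpa using hshift 1 0 m n
  · simpa using hshift 1 1 m n

/-- The shear `m a + n b ↦ (m + k n) a + n b`. -/
def shear (k : ℤ) : ℤ × ℤ ≃+ ℤ × ℤ where
  toFun p := (p.1 + k * p.2, p.2)
  invFun p := (p.1 - k * p.2, p.2)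
  left_inv p := by simp
  right_inv p := by simp
  map_add' p q := by ext <;> simp only [Prod.fst_add, Prod.snd_add] ; ring

theorem shear_apply (k : ℤ) (p : ℤ × ℤ) : shear k p = (p.1 + k * p.2, p.2) := rfl

theorem shear_shear (k h : ℤ) (p : ℤ × ℤ) : shear k (shear h p) = shear (k + h) p := by
  ext <;> simp only [shear_apply]; ring

namespace EllipticType

set_option synthInstance.maxHeartbeats 400000 in
-- the decidability instance nests about twenty quantifiers and implications
set_option synthInstance.maxSize 2000 in
theorem exists_shear_rep_mem_iff : ∀ i ∈ ([1, 2] : List ℤ), ∀ j ∈ ([1, 2] : List ℤ),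
    ∀ u v w : Bool, (u || w) → (v || w) → (u || v) → (i = 1 ∨ j = 1 → u ∧ v ∧ w) →
    ∀ u' v' w' : Bool, ∃ t ∈ list, t.Admissible 3 ∧
      ((i = 1 → u' || w') → (j = 1 → v' || w') → (i = 1 → j = 1 → u' || v') → t.Admissible 1) ∧
      ∃ k ∈ ([0, 1, 2, 3] : List ℤ), (∀ q, rep q ∈ lat i j ↔ shear k (rep q) ∈ t.middleSet) ∧
        ∃ ξ ∈ ([(0, 0), (1, 0), (0, 1), (1, 1)] : List (ℤ × ℤ)),
          (∀ q, rep q ∈ paritySet 1 1 u v w ↔ shear k (rep q) + ξ ∈ t.shortSet) ∧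
          ∀ q, rep q ∈ paritySet i j u' v' w' ↔
            shear k (rep q) + (2 : ℤ) • ξ ∈ t.longSet := by
  decide +kernel

end EllipticType

/-- Translation sets `S`, `M`, `E` in which `M` is a lattice containing `2Λ`. That `S` generates
`Λ` is expressed by the functionals `Λ → ℤ / 2`. -/
structure IsLatticeTriple (S : Set (ℤ × ℤ)) (M : AddSubgroup (ℤ × ℤ)) (E : Set (ℤ × ℤ)) :
    Prop where
  zero_mem_short : 0 ∈ S
  eq_zero_of_short : ∀ f : ℤ × ℤ →+ ZMod 2, (∀ x ∈ S, f x = 0) → f = 0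
  two_smul_mem : ∀ z : ℤ × ℤ, (2 : ℤ) • z ∈ M
  short_add : ∀ x ∈ S, ∀ m ∈ M, x + m ∈ S
  zero_mem_long : 0 ∈ E
  long_subset : E ⊆ M
  long_add : ∀ x ∈ E, ∀ m ∈ M, x + (2 : ℤ) • m ∈ E

theorem IsLatticeTriple.comap {S E : Set (ℤ × ℤ)} {M : AddSubgroup (ℤ × ℤ)}
    (h : IsLatticeTriple S M E) (φ : ℤ × ℤ ≃+ ℤ × ℤ) :
    IsLatticeTriple (φ ⁻¹' S) (M.comap φ.toAddMonoidHom) (φ ⁻¹' E) where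
  zero_mem_short := by simpa using h.zero_mem_short
  eq_zero_of_short f hf := by
    have hsymm := h.eq_zero_of_short (f.comp φ.symm.toAddMonoidHom) fun x hx =>
      hf _ (by simpa using hx)
    exact DFunLike.ext _ _ fun x => by simpa using DFunLike.congr_fun hsymm (φ x)
  two_smul_mem z := by
    rw [AddSubgroup.mem_comap, map_zsmul]
    exact h.two_smul_mem _
  short_add x hx m hm := by simpa using h.short_add _ hx _ hm
  zero_mem_long := by simpa using h.zero_mem_long
  long_subset x hx := h.long_subset hx
  long_add x hx m hm := by
    rw [Set.mem_preimage, map_add, map_zsmul]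
    exact h.long_add _ hx _ hm

/-- The functional `m a + n b ↦ x m + y n` modulo `2`. -/
def parity (x y : ZMod 2) : ℤ × ℤ →+ ZMod 2 :=
  ((AddMonoidHom.mulLeft x).comp (Int.castAddHom _)).coprod
    ((AddMonoidHom.mulLeft y).comp (Int.castAddHom _))

theorem parity_apply (x y : ZMod 2) (p : ℤ × ℤ) : parity x y p = x * p.1 + y * p.2 := rfl

theorem or_of_forall_parity {i j : ℤ} {u v w : Bool}
    (h : ∀ f : ℤ × ℤ →+ ZMod 2, (∀ x ∈ paritySet i j u v w, f x = 0) → ∀ x ∈ lat i j, f x = 0) :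
    (i = 1 → u || w) ∧ (j = 1 → v || w) ∧ (i = 1 → j = 1 → u || v) := by
  have exists_ne (x y : ZMod 2) (hxy : ∃ p ∈ lat i j, parity x y p ≠ 0) :
      ∃ p ∈ paritySet i j u v w, parity x y p ≠ 0 := by
    by_contra! hcon
    obtain ⟨p, hp, hne⟩ := hxy
    exact hne (h _ hcon p hp)
  have h10 : i = 1 → ∃ p ∈ lat i j, parity 1 0 p ≠ 0 := fun hi =>
    ⟨(1, 0), ⟨hi.dvd, dvd_zero j⟩, by simp [parity_apply]⟩
  have h01 : j = 1 → ∃ p ∈ lat i j, parity 0 1 p ≠ 0 := fun hj =>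
    ⟨(0, 1), ⟨dvd_zero i, hj.dvd⟩, by simp [parity_apply]⟩
  have h11 : i = 1 → ∃ p ∈ lat i j, parity 1 1 p ≠ 0 := fun hi =>
    ⟨(1, 0), ⟨hi.dvd, dvd_zero j⟩, by simp [parity_apply]⟩
  have h := fun hi => exists_ne 1 0 (h10 hi)
  have h' := fun hj => exists_ne 0 1 (h01 hj)
  have h'' := fun hi => exists_ne 1 1 (h11 hi)
  simp only [parity_apply, one_mul, zero_mul, add_zero, zero_add, ← Int.cast_add, ne_eq,
    ZMod.intCast_zmod_eq_zero_iff_dvd, Nat.cast_ofNat, ← even_iff_two_dvd,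
    Int.not_even_iff_odd] at h h' h''
  refine ⟨?_, ?_, ?_⟩
  · rintro rfl
    obtain ⟨p, hp, hne⟩ := h rfl
    have := hp.2
    grind
  · rintro rfl
    obtain ⟨p, hp, hne⟩ := h' rfl
    have := hp.2
    grind
  · rintro rfl rfl
    obtain ⟨p, hp, hne⟩ := h'' rfl
    have := hp.2
    grind

theorem and_of_add_mem {i j : ℤ} {u v w : Bool} (huw : u || w) (hvw : v || w)
    (h : ∀ x ∈ paritySet 1 1 u v w, ∀ m ∈ lat i j, x + m ∈ paritySet 1 1 u v w)
    (hij : i = 1 ∨ j = 1) : u ∧ v ∧ w := by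
  have hmem (m n : ℤ) : (m, n) ∈ paritySet 1 1 u v w ↔
      (Odd m → Even n → u) ∧ (Even m → Odd n → v) ∧ (Odd m → Odd n → w) := by
    simpa using mul_mem_paritySet_iff one_ne_zero one_ne_zero u v w m n
  rcases hij with rfl | rfl
  · have hadd (m n : ℤ) (hm : (m, n) ∈ paritySet 1 1 u v w) :=
      h _ hm (1, 0) ⟨one_dvd _, dvd_zero _⟩
    simp only [Prod.mk_add_mk, hmem] at hadd
    have h00 := hadd 0 0
    have h01 := hadd 0 1
    have h11 := hadd 1 1
    norm_num at h00 h01 h11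
    grind
  · have hadd (m n : ℤ) (hm : (m, n) ∈ paritySet 1 1 u v w) :=
      h _ hm (0, 1) ⟨dvd_zero _, one_dvd _⟩
    simp only [Prod.mk_add_mk, hmem] at hadd
    have h00 := hadd 0 0
    have h10 := hadd 1 0
    have h11 := hadd 1 1
    norm_num at h00 h10 h11
    grind

namespace IsLatticeTriple

variable {S E : Set (ℤ × ℤ)} {M : AddSubgroup (ℤ × ℤ)}

theorem isFourPeriodic (h : IsLatticeTriple S M E) :
    IsFourPeriodic S ∧ IsFourPeriodic (M : Set (ℤ × ℤ)) ∧ IsFourPeriodic E := by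
  have four_smul (z : ℤ × ℤ) : (4 : ℤ) • z = (2 : ℤ) • (2 : ℤ) • z := by rw [smul_smul]; rfl
  refine ⟨fun x hx z => ?_, fun x hx z => ?_, fun x hx z => ?_⟩ <;> rw [four_smul]
  · exact h.short_add x hx _ (h.two_smul_mem _)
  · exact M.add_mem hx (h.two_smul_mem _)
  · exact h.long_add x hx _ (h.two_smul_mem z)

theorem exists_type_of_eq_lat (h : IsLatticeTriple S M E) {i j : ℤ}
    (hi : i ∈ ([1, 2] : List ℤ)) (hj : j ∈ ([1, 2] : List ℤ)) (hM : (M : Set (ℤ × ℤ)) = lat i j) :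
    ∃ (t : EllipticType) (k : ℤ) (ξ : ℤ × ℤ), t.Admissible 3 ∧
      ((∀ f : ℤ × ℤ →+ ZMod 2, (∀ x ∈ E, f x = 0) → ∀ x ∈ M, f x = 0) → t.Admissible 1) ∧
      ∀ p, (p ∈ S ↔ shear k p + ξ ∈ t.shortSet) ∧ (p ∈ M ↔ shear k p ∈ t.middleSet) ∧
        (p ∈ E ↔ shear k p + (2 : ℤ) • ξ ∈ t.longSet) := by
  have hi0 : i ≠ 0 := by rintro rfl; simp at hi
  have hj0 : j ≠ 0 := by rintro rfl; simp at hj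
  have hlat (p) : p ∈ M ↔ p ∈ lat i j := Set.ext_iff.1 hM p
  obtain ⟨u, v, w, rfl⟩ := exists_eq_paritySet one_ne_zero one_ne_zero h.zero_mem_short
    (fun p _ => ⟨one_dvd _, one_dvd _⟩) fun x hx z _ => h.short_add x hx _ (h.two_smul_mem z)
  obtain ⟨u', v', w', rfl⟩ := exists_eq_paritySet hi0 hj0 h.zero_mem_long
    (h.long_subset.trans hM.subset) fun x hx z hz => h.long_add x hx z ((hlat z).2 hz)
  obtain ⟨huw, hvw, huv⟩ := or_of_forall_parity fun f hf x _ =>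
    DFunLike.congr_fun (h.eq_zero_of_short f hf) x
  have hall := and_of_add_mem (huw rfl) (hvw rfl) fun x hx m hm =>
    h.short_add x hx m ((hlat m).2 hm)
  obtain ⟨t, -, ht, ht₁, k, -, hmiddle, ξ, -, hshort, hlong⟩ :=
    EllipticType.exists_shear_rep_mem_iff i hi j hj u v w (huw rfl) (hvw rfl) (huv rfl rfl) hall
      u' v' w'
  obtain ⟨hSper, hMper, hEper⟩ := h.isFourPeriodic
  refine ⟨t, k, ξ, ht, fun hEM => ?_, fun p => ⟨?_, ?_, ?_⟩⟩
  · have hor := or_of_forall_parity fun f hf x hx => hEM f hf x ((hlat x).2 hx)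
    exact ht₁ hor.1 hor.2.1 hor.2.2
  · exact Set.ext_iff.1 (hSper.ext
      (t.isFourPeriodic_shortSet.preimage (shear k).toAddMonoidHom ξ) hshort) p
  · simpa using Set.ext_iff.1 (hMper.ext
      (t.isFourPeriodic_middleSet.preimage (shear k).toAddMonoidHom 0)
        (by simpa [hlat] using hmiddle)) p
  · exact Set.ext_iff.1 (hEper.ext
      (t.isFourPeriodic_longSet.preimage (shear k).toAddMonoidHom _) hlong) p

end IsLatticeTriple

theorem exists_shear_comap_eq_lat (M : AddSubgroup (ℤ × ℤ)) (hM : ∀ z : ℤ × ℤ, (2 : ℤ) • z ∈ M) :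
    ∃ h : ℤ, ∃ i ∈ ([1, 2] : List ℤ), ∃ j ∈ ([1, 2] : List ℤ),
      (M.comap (shear h).toAddMonoidHom : Set (ℤ × ℤ)) = lat i j := by
  obtain ⟨u, v, w, huvw⟩ := exists_eq_paritySet one_ne_zero one_ne_zero M.zero_mem
    (fun p _ => ⟨one_dvd _, one_dvd _⟩) fun x hx z _ => M.add_mem hx (hM z)
  have hmem (m n : ℤ) : (m, n) ∈ M ↔
      (Odd m → Even n → u) ∧ (Even m → Odd n → v) ∧ (Odd m → Odd n → w) := by
    simpa using (Set.ext_iff.1 huvw (m, n)).trans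
      (by simpa using mul_mem_paritySet_iff one_ne_zero one_ne_zero u v w m n)
  have h10 : (1, 0) ∈ M ↔ u := by simp [hmem]
  have h01 : (0, 1) ∈ M ↔ v := by simp [hmem]
  have h11 : (1, 1) ∈ M ↔ w := by simp [hmem]
  have add : u → v → w := fun hu hv => h11.1 (by simpa using M.add_mem (h10.2 hu) (h01.2 hv))
  have sub : w → v → u := fun hw hv => h10.1 (by simpa using M.sub_mem (h11.2 hw) (h01.2 hv))
  have sub' : w → u → v := fun hw hu => h01.1 (by simpa using M.sub_mem (h11.2 hw) (h10.2 hu))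
  have eq_lat (h i j : ℤ) (hlat : ∀ m n, (m + h * n, n) ∈ M ↔ i ∣ m ∧ j ∣ n) :
      (M.comap (shear h).toAddMonoidHom : Set (ℤ × ℤ)) = lat i j := Set.ext fun p => hlat p.1 p.2
  rcases u <;> rcases v <;> rcases w <;> simp only [Bool.false_eq_true, forall_const,
    false_imp_iff, imp_false] at add sub sub'
  · exact ⟨0, 2, by simp, 2, by simp, eq_lat _ _ _ fun m n => by grind⟩
  · exact ⟨1, 2, by simp, 1, by simp, eq_lat _ _ _ fun m n => by grind⟩
  · exact ⟨0, 2, by simp, 1, by simp, eq_lat _ _ _ fun m n => by grind⟩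
  · exact ⟨0, 1, by simp, 2, by simp, eq_lat _ _ _ fun m n => by grind⟩
  · exact ⟨0, 1, by simp, 1, by simp, eq_lat _ _ _ fun m n => by grind⟩

theorem IsLatticeTriple.exists_type {S E : Set (ℤ × ℤ)} {M : AddSubgroup (ℤ × ℤ)}
    (h : IsLatticeTriple S M E) :
    ∃ (t : EllipticType) (k : ℤ) (ξ : ℤ × ℤ), t.Admissible 3 ∧
      ((∀ f : ℤ × ℤ →+ ZMod 2, (∀ x ∈ E, f x = 0) → ∀ x ∈ M, f x = 0) → t.Admissible 1) ∧
      ∀ p, (p ∈ S ↔ shear k p + ξ ∈ t.shortSet) ∧ (p ∈ M ↔ shear k p ∈ t.middleSet) ∧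
        (p ∈ E ↔ shear k p + (2 : ℤ) • ξ ∈ t.longSet) := by
  obtain ⟨s, i, hi, j, hj, hM⟩ := exists_shear_comap_eq_lat M h.two_smul_mem
  obtain ⟨t, k, ξ, ht, ht₁, H⟩ := (h.comap (shear s)).exists_type_of_eq_lat hi hj hM
  refine ⟨t, k - s, ξ, ht, fun hEM => ht₁ fun f hf x hx => ?_, fun p => ?_⟩
  · simpa using hEM (f.comp (shear s).symm.toAddMonoidHom) (fun y hy => hf _ (by simpa using hy))
      _ hx
  · have hp := H ((shear s).symm p)
    have hshear : shear k ((shear s).symm p) = shear (k - s) p := by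
      rw [← (shear s).apply_symm_apply p, shear_shear, sub_add_cancel, AddEquiv.symm_apply_apply]
    simpa [hshear] using hp

theorem add_smul_mem_of_mem_closure {A : Type*} [AddCommGroup A] {X T : Set A} {n : ℤ}
    (hT : ∀ t ∈ T, -t ∈ T) (h : ∀ t ∈ T, ∀ x ∈ X, x - n • t ∈ X) {z : A}
    (hz : z ∈ AddSubgroup.closure T) : ∀ x ∈ X, x + n • z ∈ X := by
  suffices ∀ x ∈ X, x + n • z ∈ X ∧ x - n • z ∈ X from fun x hx => (this x hx).1
  induction hz using AddSubgroup.closure_induction with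
  | mem t ht => exact fun x hx => ⟨by simpa using h _ (hT t ht) x hx, h t ht x hx⟩
  | zero => exact fun x hx => by simpa using hx
  | add y z _ _ hy hz =>
    intro x hx
    rw [smul_add, ← add_assoc, ← sub_sub]
    exact ⟨(hz _ (hy x hx).1).1, (hz _ (hy x hx).2).2⟩
  | neg y _ hy =>
    intro x hx
    rw [smul_neg, ← sub_eq_add_neg, sub_neg_eq_add]
    exact (hy x hx).symm

/-- A shear followed by the change of frame `ε_i ↦ ε_i + ξ_i` carries the translation sets
`S`, `M`, `E` to `S'`, `M'`, `E'`. -/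
structure FrameChange (l : ℕ) (k : ℤ) (ξ : Fin l → ℤ × ℤ) (S M E S' M' E' : Set (ℤ × ℤ)) :
    Prop where
  short : ∀ i p, p ∈ S ↔ shear k p + ξ i ∈ S'
  middle_add : ∀ i j, i ≠ j → ∀ p, p ∈ M ↔ shear k p + (ξ i + ξ j) ∈ M'
  middle_sub : ∀ i j, i ≠ j → ∀ p, p ∈ M ↔ shear k p + (ξ i - ξ j) ∈ M'
  long : ∀ i p, p ∈ E ↔ shear k p + (2 : ℤ) • ξ i ∈ E'

namespace ReflClosed

variable {l : ℕ} {S M E : Set (ℤ × ℤ)}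

section Generation

variable (h : ReflClosed l S M E) (hSgen : AddSubgroup.closure S = ⊤)
include h hSgen

theorem short_add_two_smul {x : ℤ × ℤ} (hx : x ∈ S) (z : ℤ × ℤ) : x + (2 : ℤ) • z ∈ S :=
  add_smul_mem_of_mem_closure h.neg_short h.short_short (hSgen ▸ trivial) x hx

theorem middle_add_two_smul {x : ℤ × ℤ} (hx : x ∈ M) (z : ℤ × ℤ) : x + (2 : ℤ) • z ∈ M :=
  add_smul_mem_of_mem_closure h.neg_short h.short_middle (hSgen ▸ trivial) x hx

theorem long_add_four_smul {x : ℤ × ℤ} (hx : x ∈ E) (z : ℤ × ℤ) : x + (4 : ℤ) • z ∈ E :=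
  add_smul_mem_of_mem_closure h.neg_short h.short_long (hSgen ▸ trivial) x hx

end Generation

theorem short_add (h : ReflClosed l S M E) {z : ℤ × ℤ} (hz : z ∈ AddSubgroup.closure M)
    {x : ℤ × ℤ} (hx : x ∈ S) : x + z ∈ S := by
  simpa using add_smul_mem_of_mem_closure (n := 1) h.neg_middle (by simpa using h.middle_short)
    hz x hx

theorem long_add (h : ReflClosed l S M E) {z : ℤ × ℤ} (hz : z ∈ AddSubgroup.closure M)
    {x : ℤ × ℤ} (hx : x ∈ E) : x + (2 : ℤ) • z ∈ E :=
  add_smul_mem_of_mem_closure h.neg_middle h.middle_long hz x hx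

end ReflClosed

theorem eq_zero_of_closure_eq_top {S : Set (ℤ × ℤ)} (hS : AddSubgroup.closure S = ⊤)
    (f : ℤ × ℤ →+ ZMod 2) (hf : ∀ x ∈ S, f x = 0) : f = 0 :=
  f.ker_eq_top_iff.1 (top_le_iff.1 (hS ▸ (AddSubgroup.closure_le f.ker).2 hf))

/-- Without middle roots, the lattice generated by `E` and `2Λ` takes the place of `M`. -/
theorem exists_frameChange_one {S M E : Set (ℤ × ℤ)} (h : ReflClosed 1 S M E)
    (hS0 : 0 ∈ S) (hE0 : 0 ∈ E) (hSgen : AddSubgroup.closure S = ⊤) :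
    ∃ (t : EllipticType) (k : ℤ) (ξ : Fin 1 → ℤ × ℤ), t.Admissible 1 ∧
      FrameChange 1 k ξ S M E t.shortSet t.middleSet t.longSet := by
  set T : Set (ℤ × ℤ) := E ∪ Set.range fun z : ℤ × ℤ => (2 : ℤ) • z
  have neg_mem : ∀ x ∈ T, -x ∈ T := by
    rintro x (hx | ⟨z, rfl⟩)
    · exact Or.inl (h.neg_long x hx)
    · exact Or.inr ⟨-z, by simp⟩
  have short_sub : ∀ t ∈ T, ∀ x ∈ S, x - (1 : ℤ) • t ∈ S := by
    rintro _ (ht | ⟨z, rfl⟩) x hx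
    · simpa using h.long_short _ ht x hx
    · simpa [sub_eq_add_neg] using h.short_add_two_smul hSgen hx (-z)
  have long_sub : ∀ t ∈ T, ∀ x ∈ E, x - (2 : ℤ) • t ∈ E := by
    rintro _ (ht | ⟨z, rfl⟩) x hx
    · exact h.long_long _ ht x hx
    · rw [smul_smul]
      simpa [sub_eq_add_neg] using h.long_add_four_smul hSgen hx (-z)
  have hT : IsLatticeTriple S (AddSubgroup.closure T) E :=
    { zero_mem_short := hS0
      eq_zero_of_short := eq_zero_of_closure_eq_top hSgen
      two_smul_mem := fun z => AddSubgroup.subset_closure (Or.inr ⟨z, rfl⟩)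
      short_add := fun x hx m hm => by
        simpa using add_smul_mem_of_mem_closure neg_mem short_sub hm x hx
      zero_mem_long := hE0
      long_subset := fun x hx => AddSubgroup.subset_closure (Or.inl hx)
      long_add := fun x hx m hm => add_smul_mem_of_mem_closure neg_mem long_sub hm x hx }
  obtain ⟨t, k, ξ, -, ht, H⟩ := hT.exists_type
  refine ⟨t, k, fun _ => ξ, ht fun f hf x hx => ?_, fun _ p => (H p).1,
    fun i j hij => absurd (Subsingleton.elim i j) hij,
    fun i j hij => absurd (Subsingleton.elim i j) hij, fun _ p => (H p).2.2⟩
  refine (AddSubgroup.closure_le f.ker).2 ?_ hx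
  rintro _ (hy | ⟨z, rfl⟩)
  · exact hf _ hy
  · exact (map_zsmul f 2 z).trans (by rw [two_smul]; exact CharTwo.add_self_eq_zero _)

theorem exists_frameChange_of_forall_sub_mem {l : ℕ} (hl : 2 ≤ l) {S M E : Set (ℤ × ℤ)}
    (h : ReflClosed l S M E) (hS0 : 0 ∈ S) (hM0 : 0 ∈ M) (hE0 : 0 ∈ E)
    (hSgen : AddSubgroup.closure S = ⊤) (hsub : ∀ x ∈ M, ∀ y ∈ M, y - x ∈ M) :
    ∃ (t : EllipticType) (k : ℤ) (ξ : Fin l → ℤ × ℤ), t.Admissible l ∧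
      FrameChange l k ξ S M E t.shortSet t.middleSet t.longSet := by
  obtain ⟨M, rfl⟩ : ∃ M' : AddSubgroup (ℤ × ℤ), (M' : Set (ℤ × ℤ)) = M :=
    ⟨AddSubgroup.ofSub M ⟨0, hM0⟩ fun x hx y hy => by
      simpa [sub_eq_add_neg] using hsub y hy x hx, rfl⟩
  have hlattice : IsLatticeTriple S M E :=
    { zero_mem_short := hS0
      eq_zero_of_short := eq_zero_of_closure_eq_top hSgen
      two_smul_mem := fun z => by simpa using h.middle_add_two_smul hSgen hM0 z
      short_add := fun x hx m hm => h.short_add (AddSubgroup.subset_closure hm) hx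
      zero_mem_long := hE0
      long_subset := fun x hx => by simpa using h.long_middle x hx 0 hM0
      long_add := fun x hx m hm => h.long_add (AddSubgroup.subset_closure hm) hx }
  obtain ⟨t, k, ξ, ht, -, H⟩ := hlattice.exists_type
  refine ⟨t, k, fun _ => ξ, EllipticType.admissible_of_admissible_three ht hl,
    fun _ p => (H p).1, fun i j _ p => ?_, fun i j _ p => ?_, fun _ p => (H p).2.2⟩
  · have hshift : p + (2 : ℤ) • (shear k).symm ξ ∈ M ↔ p ∈ M :=
      M.add_mem_cancel_right (hlattice.two_smul_mem _)
    rw [SetLike.mem_coe, ← hshift, (H _).2.1, map_add, map_zsmul, AddEquiv.apply_symm_apply,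
      two_smul]
  · rw [sub_self, add_zero]
    exact (H p).2.1

theorem mem_iff_add_sub_notMem_lat {M : Set (ℤ × ℤ)} (h0 : 0 ∈ M) (hneg : ∀ p ∈ M, -p ∈ M)
    (hadd : ∀ p ∈ M, ∀ z : ℤ × ℤ, p + (2 : ℤ) • z ∈ M) {x y : ℤ × ℤ} (hx : x ∈ M) (hy : y ∈ M)
    (hxy : y - x ∉ M) (p : ℤ × ℤ) : p ∈ M ↔ p + (y - x) ∉ lat 2 2 := by
  have mem_of_sub_mem {p q : ℤ × ℤ} (hp : p ∈ M) (hpq : q - p ∈ lat 2 2) : q ∈ M := by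
    obtain ⟨⟨m, hm⟩, n, hn⟩ := hpq
    convert hadd p hp (m, n)
    ext <;> simp only [Prod.fst_sub, Prod.snd_sub, Prod.fst_add, Prod.snd_add, Prod.smul_mk,
      smul_eq_mul] at hm hn ⊢ <;> omega
  have notMem {p : ℤ × ℤ} (hp : p ∈ M) : p + (y - x) ∉ lat 2 2 := fun hcon =>
    hxy (mem_of_sub_mem (hneg p hp) (by simpa [add_comm] using hcon))
  refine ⟨notMem, fun hp => ?_⟩
  have h0' := notMem h0
  have hx' := notMem hx
  have hy' := notMem hy
  have hclass : p - 0 ∈ lat 2 2 ∨ p - x ∈ lat 2 2 ∨ p - y ∈ lat 2 2 := by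
    simp only [lat, Set.mem_ofPred_eq, Prod.fst_add, Prod.fst_sub, Prod.snd_add, Prod.snd_sub,
      Prod.fst_zero, Prod.snd_zero] at h0' hx' hy' hp ⊢
    omega
  rcases hclass with h | h | h
  exacts [mem_of_sub_mem h0 h, mem_of_sub_mem hx h, mem_of_sub_mem hy h]

theorem starSet_eq_setOf_add_notMem_lat :
    starSet 0 0 1 1 = {p : ℤ × ℤ | p + (1, 1) ∉ lat 2 2} := by
  ext p
  rw [mem_starSet_iff one_ne_zero one_ne_zero, Int.even_mul, Int.even_iff, Int.even_iff]
  simp only [lat, Set.mem_ofPred_eq, Prod.fst_add, Prod.snd_add, one_dvd, true_and, Int.ediv_one,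
    sub_zero]
  omega

theorem closure_setOf_add_notMem_lat (w : ℤ × ℤ) :
    AddSubgroup.closure {p : ℤ × ℤ | p + w ∉ lat 2 2} = ⊤ := by
  set M := {p : ℤ × ℤ | p + w ∉ lat 2 2} with hM
  obtain ⟨x, hx, hmem⟩ : ∃ x ∈ M, ∀ z, z ∈ M ∨ z - x ∈ M := by
    simp only [hM, lat, Set.mem_ofPred_eq, Prod.fst_add, Prod.snd_add, Prod.fst_sub,
      Prod.snd_sub]
    by_cases h : (2 : ℤ) ∣ 1 + w.1 ∧ (2 : ℤ) ∣ 0 + w.2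
    · exact ⟨(0, 1), by dsimp only; omega, fun z => by dsimp only; omega⟩
    · exact ⟨(1, 0), h, fun z => by dsimp only; omega⟩
  refine top_unique fun z _ => ?_
  rcases hmem z with hz | hz
  · exact AddSubgroup.subset_closure hz
  · simpa using add_mem (AddSubgroup.subset_closure hz) (AddSubgroup.subset_closure hx)

theorem exists_frameChange_of_sub_notMem {S M E : Set (ℤ × ℤ)} (h : ReflClosed 2 S M E)
    (hS0 : 0 ∈ S) (hM0 : 0 ∈ M) (hE0 : 0 ∈ E) (hSgen : AddSubgroup.closure S = ⊤)
    {x y : ℤ × ℤ} (hx : x ∈ M) (hy : y ∈ M) (hxy : y - x ∉ M) :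
    ∃ (k : ℤ) (ξ : Fin 2 → ℤ × ℤ), FrameChange 2 k ξ S M E EllipticType.BBv2star.shortSet
      EllipticType.BBv2star.middleSet EllipticType.BBv2star.longSet := by
  have hM := mem_iff_add_sub_notMem_lat hM0 h.neg_middle
    (fun p hp => h.middle_add_two_smul hSgen hp) hx hy hxy
  have h0' := (hM _).1 hM0
  have hx' := (hM _).1 hx
  have hy' := (hM _).1 hy
  have hMtop (z : ℤ × ℤ) : z ∈ AddSubgroup.closure M := by
    rw [Set.ext hM]
    exact closure_setOf_add_notMem_lat (y - x) ▸ AddSubgroup.mem_top z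
  have hS (p) : p ∈ S := by simpa using h.short_add (hMtop p) hS0
  have hE (p) : p ∈ E ↔ p ∈ lat 2 2 := by
    constructor
    · intro hp
      have h₀ := (hM _).1 (h.long_middle p hp 0 hM0)
      have h₁ := (hM _).1 (h.long_middle p hp x hx)
      have h₂ := (hM _).1 (h.long_middle p hp y hy)
      simp only [lat, Set.mem_ofPred_eq, Prod.fst_add, Prod.fst_sub, Prod.snd_add, Prod.snd_sub,
        Prod.fst_zero, Prod.snd_zero] at h0' hx' hy' h₀ h₁ h₂ ⊢
      omega
    · rintro ⟨⟨m, hm⟩, n, hn⟩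
      rw [show p = 0 + (2 : ℤ) • (m, n) by ext <;> simp [hm, hn]]
      exact h.long_add (hMtop _) hE0
  refine ⟨0, ![(1, 1) - (y - x), 0], fun i p => iff_of_true (hS p) ⟨one_dvd _, one_dvd _⟩,
    ?_, ?_, ?_⟩
  · intro i j hij p
    rw [EllipticType.middleSet, starSet_eq_setOf_add_notMem_lat, Set.mem_ofPred_eq, hM]
    fin_cases i <;> fin_cases j <;> simp [shear_apply, lat] at hij ⊢ <;> omega
  · intro i j hij p
    rw [EllipticType.middleSet, starSet_eq_setOf_add_notMem_lat, Set.mem_ofPred_eq, hM]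
    fin_cases i <;> fin_cases j <;> simp [shear_apply, lat] at hij ⊢ <;> omega
  · intro i p
    rw [hE, EllipticType.longSet]
    fin_cases i <;> simp [shear_apply, lat]

theorem exists_frameChange {l : ℕ} (hl : 2 ≤ l) {S M E : Set (ℤ × ℤ)} (h : ReflClosed l S M E)
    (hS0 : 0 ∈ S) (hM0 : 0 ∈ M) (hE0 : 0 ∈ E) (hSgen : AddSubgroup.closure S = ⊤) :
    ∃ (t : EllipticType) (k : ℤ) (ξ : Fin l → ℤ × ℤ), t.Admissible l ∧
      FrameChange l k ξ S M E t.shortSet t.middleSet t.longSet := by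
  by_cases hsub : ∀ x ∈ M, ∀ y ∈ M, y - x ∈ M
  · exact exists_frameChange_of_forall_sub_mem hl h hS0 hM0 hE0 hSgen hsub
  push Not at hsub
  obtain ⟨x, hx, y, hy, hxy⟩ := hsub
  obtain rfl : l = 2 := by
    by_contra hne
    exact hxy (h.middle_middle_sub (by omega) x hx y hy)
  obtain ⟨k, ξ, H⟩ := exists_frameChange_of_sub_notMem h hS0 hM0 hE0 hSgen hx hy hxy
  exact ⟨.BBv2star, k, ξ, rfl, H⟩

/-! ### Roots in integer coordinates -/

section IntegerVectors

variable {l : ℕ}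

theorem dotProduct_self_sub_single (n : Fin l → ℤ) (i : Fin l) :
    (n - Pi.single i (n i)) ⬝ᵥ (n - Pi.single i (n i)) = n ⬝ᵥ n - n i * n i := by
  simp [sub_dotProduct, dotProduct_sub]

theorem exists_eq_single_of_dotProduct_self_eq_one {n : Fin l → ℤ} (h : n ⬝ᵥ n = 1) :
    ∃ i, n = Pi.single i 1 ∨ n = -Pi.single i 1 := by
  obtain ⟨i, hi⟩ : ∃ i, n i ≠ 0 := Function.ne_iff.1 fun hn : n = 0 => by simp [hn] at h
  have hrest := dotProduct_self_sub_single n i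
  have hnonneg : 0 ≤ (n - Pi.single i (n i)) ⬝ᵥ (n - Pi.single i (n i)) :=
    Finset.sum_nonneg fun _ _ => mul_self_nonneg _
  have hpos : 0 < n i * n i := mul_self_pos.2 hi
  have hn : n = Pi.single i (n i) := sub_eq_zero.1 (dotProduct_self_eq_zero.1 (by linarith))
  refine ⟨i, ?_⟩
  rcases mul_self_eq_one_iff.1 (by linarith : n i * n i = 1) with h1 | h1
  · exact Or.inl (h1 ▸ hn)
  · exact Or.inr (by rw [hn, h1, Pi.single_neg])

theorem exists_eq_add_single_of_dotProduct_self_eq_two {n : Fin l → ℤ} (h : n ⬝ᵥ n = 2) :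
    ∃ i j, i < j ∧ (n = Pi.single i 1 + Pi.single j 1 ∨ n = -(Pi.single i 1 + Pi.single j 1) ∨
      n = Pi.single i 1 - Pi.single j 1 ∨ n = -(Pi.single i 1 - Pi.single j 1)) := by
  obtain ⟨i, hi⟩ : ∃ i, n i ≠ 0 := Function.ne_iff.1 fun hn : n = 0 => by simp [hn] at h
  have hrest := dotProduct_self_sub_single n i
  have hnonneg : 0 ≤ (n - Pi.single i (n i)) ⬝ᵥ (n - Pi.single i (n i)) :=
    Finset.sum_nonneg fun _ _ => mul_self_nonneg _
  have hunit : n i = 1 ∨ n i = -1 := by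
    have : n i < 2 := by nlinarith
    have : -2 < n i := by nlinarith
    omega
  have hone : n i * n i = 1 := mul_self_eq_one_iff.2 hunit
  obtain ⟨j, hj⟩ := exists_eq_single_of_dotProduct_self_eq_one (hrest.trans (by omega))
  simp only [sub_eq_iff_eq_add] at hj
  have hji : j ≠ i := by
    rintro rfl
    rcases hj with hj | hj <;> simpa using congrFun hj j
  rcases lt_or_gt_of_ne hji with hlt | hlt
  · refine ⟨j, i, hlt, ?_⟩
    rcases hunit with hi | hi <;> rw [hi] at hj <;> rcases hj with rfl | rfl <;>
      simp [Pi.single_neg, sub_eq_add_neg, add_comm]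
  · refine ⟨i, j, hlt, ?_⟩
    rcases hunit with hi | hi <;> rw [hi] at hj <;> rcases hj with rfl | rfl <;>
      simp [Pi.single_neg, sub_eq_add_neg, add_comm]

theorem abs_dotProduct_le_one {n m : Fin l → ℤ} (h : (n ⬝ᵥ n) * (m ⬝ᵥ m) < 4) :
    |n ⬝ᵥ m| ≤ 1 := by
  have hsq : (n ⬝ᵥ m) ^ 2 ≤ (n ⬝ᵥ n) * (m ⬝ᵥ m) := by
    simpa [dotProduct, pow_two] using Finset.sum_mul_sq_le_sq_mul_sq Finset.univ n m
  exact Int.lt_add_one_iff.1 (abs_lt_of_sq_lt_sq (by linarith) two_pos.le)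

theorem even_dotProduct (hl : l ≤ 2) {n m : Fin l → ℤ} (hn : Even (n ⬝ᵥ n))
    (hm : Even (m ⬝ᵥ m)) : Even (n ⬝ᵥ m) := by
  interval_cases l
  · simp
  all_goals
    simp only [dotProduct, Fin.sum_univ_one, Fin.sum_univ_two, Int.even_add, Int.even_mul]
      at hn hm ⊢
    tauto

theorem dotProduct_self_sub_smul {n m : Fin l → ℤ} {k : ℤ} (h : 2 * (n ⬝ᵥ m) = k * (n ⬝ᵥ n)) :
    (m - k • n) ⬝ᵥ (m - k • n) = m ⬝ᵥ m := by
  simp only [sub_dotProduct, dotProduct_sub, smul_dotProduct, dotProduct_smul, smul_eq_mul,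
    dotProduct_comm m n]
  linear_combination (-k) * h

end IntegerVectors

section IntRoots

variable {A : Type*} {l : ℕ} {S M E : Set A}

/-- The set `(Δ_s + S) ∪ (Δ_m + M) ∪ (Δ_l + E)`, where the roots of `BC_l` are written in
coordinates: short and middle roots are the integer vectors of square length `1` and `2`, and long
roots are the doubles of short roots. The translations may lie in any group. -/
def intRoots (l : ℕ) (S M E : Set A) : Set ((Fin l → ℤ) × A) :=
  {x | (x.1 ⬝ᵥ x.1 = 1 ∧ x.2 ∈ S) ∨ (x.1 ⬝ᵥ x.1 = 2 ∧ x.2 ∈ M) ∨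
    ∃ m, x.1 = (2 : ℤ) • m ∧ m ⬝ᵥ m = 1 ∧ x.2 ∈ E}

theorem dotProduct_self_mem_of_mem_intRoots {x : (Fin l → ℤ) × A} (hx : x ∈ intRoots l S M E) :
    x.1 ⬝ᵥ x.1 ∈ ({1, 2, 4} : Set ℤ) := by
  rcases hx with ⟨h, -⟩ | ⟨h, -⟩ | ⟨m, h, hm, -⟩
  · simp [h]
  · simp [h]
  · simp [h, hm, -zsmul_eq_mul]

theorem dotProduct_self_pos_of_mem_intRoots {x : (Fin l → ℤ) × A} (hx : x ∈ intRoots l S M E) :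
    0 < x.1 ⬝ᵥ x.1 := by
  rcases dotProduct_self_mem_of_mem_intRoots hx with h | h | h <;> rw [h] <;> norm_num

variable [AddCommGroup A]

theorem sub_mul_smul_mem {X Y : Set A} {c d : ℤ} (hX : ∀ x ∈ X, -x ∈ X)
    (h : ∀ x ∈ X, ∀ y ∈ Y, y - c • x ∈ Y) (hd : |d| ≤ 1) {x y : A}
    (hx : x ∈ X) (hy : y ∈ Y) : y - (c * d) • x ∈ Y := by
  rcases Int.abs_le_one_iff.1 hd with rfl | rfl | rfl
  · simpa using hy
  · simpa using h x hx y hy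
  · simpa using h _ (hX x hx) y hy

namespace ReflClosed

theorem sub_smul_mem_intRoots_of_short (h : ReflClosed l S M E) {x y : (Fin l → ℤ) × A}
    (hx : x.1 ⬝ᵥ x.1 = 1) (hxS : x.2 ∈ S) (hy : y ∈ intRoots l S M E) :
    y - (2 * (x.1 ⬝ᵥ y.1)) • x ∈ intRoots l S M E := by
  rcases hy with ⟨hy, hyS⟩ | ⟨hy, hyM⟩ | ⟨m, hm, hm1, hyE⟩
  · exact Or.inl ⟨(dotProduct_self_sub_smul (by rw [hx, mul_one])).trans hy,
      sub_mul_smul_mem h.neg_short h.short_short (abs_dotProduct_le_one (by simp [hx, hy])) hxS hyS⟩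
  · exact Or.inr (Or.inl ⟨(dotProduct_self_sub_smul (by rw [hx, mul_one])).trans hy,
      sub_mul_smul_mem h.neg_short h.short_middle (abs_dotProduct_le_one (by simp [hx, hy]))
        hxS hyM⟩)
  · have hk : 2 * (x.1 ⬝ᵥ y.1) = 4 * (x.1 ⬝ᵥ m) := by
      rw [hm, dotProduct_smul, smul_eq_mul]; ring
    refine Or.inr (Or.inr ⟨m - (2 * (x.1 ⬝ᵥ m)) • x.1, ?_,
      (dotProduct_self_sub_smul (by rw [hx, mul_one])).trans hm1, ?_⟩) <;> rw [hk]
    · rw [Prod.fst_sub, Prod.smul_fst, hm, smul_sub, smul_smul, ← mul_assoc]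
      rfl
    · exact sub_mul_smul_mem h.neg_short h.short_long
        (abs_dotProduct_le_one (by simp [hx, hm1])) hxS hyE

theorem sub_smul_mem_of_middle (h : ReflClosed l S M E) {n m : Fin l → ℤ} (hn : n ⬝ᵥ n = 2)
    (hm : m ⬝ᵥ m = 2) {p q : A} (hp : p ∈ M) (hq : q ∈ M) : q - (n ⬝ᵥ m) • p ∈ M := by
  have hsq : (n ⬝ᵥ m) ^ 2 ≤ (n ⬝ᵥ n) * (m ⬝ᵥ m) := by
    simpa [dotProduct, pow_two] using Finset.sum_mul_sq_le_sq_mul_sq Finset.univ n m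
  rw [hn, hm] at hsq
  rcases Int.even_or_odd (n ⬝ᵥ m) with ⟨d, hd⟩ | hodd
  · rw [hd, ← two_mul] at hsq ⊢
    exact sub_mul_smul_mem h.neg_middle h.middle_middle
      (Int.lt_add_one_iff.1 (abs_lt_of_sq_lt_sq (by linarith) two_pos.le)) hp hq
  · have hl : 3 ≤ l := by
      by_contra! hl
      exact Int.not_even_iff_odd.2 hodd
        (even_dotProduct (by omega) (hn ▸ even_two) (hm ▸ even_two))
    have habs : |n ⬝ᵥ m| ≤ 1 := by
      have := abs_le_of_sq_le_sq (hsq.trans (by norm_num : (2 * 2 : ℤ) ≤ 2 ^ 2)) two_pos.le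
      grind
    simpa using sub_mul_smul_mem (c := 1) h.neg_middle
      (by simpa using h.middle_middle_sub hl) habs hp hq

theorem sub_smul_mem_intRoots_of_middle (h : ReflClosed l S M E) {x y : (Fin l → ℤ) × A}
    (hx : x.1 ⬝ᵥ x.1 = 2) (hxM : x.2 ∈ M) (hy : y ∈ intRoots l S M E) :
    y - (x.1 ⬝ᵥ y.1) • x ∈ intRoots l S M E := by
  rcases hy with ⟨hy, hyS⟩ | ⟨hy, hyM⟩ | ⟨m, hm, hm1, hyE⟩
  · refine Or.inl ⟨(dotProduct_self_sub_smul (by rw [hx, mul_comm])).trans hy, ?_⟩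
    simpa using sub_mul_smul_mem (c := 1) h.neg_middle (by simpa using h.middle_short)
      (abs_dotProduct_le_one (by simp [hx, hy])) hxM hyS
  · exact Or.inr (Or.inl ⟨(dotProduct_self_sub_smul (by rw [hx, mul_comm])).trans hy,
      h.sub_smul_mem_of_middle hx hy hxM hyM⟩)
  · have hk : x.1 ⬝ᵥ y.1 = 2 * (x.1 ⬝ᵥ m) := by rw [hm, dotProduct_smul, smul_eq_mul]
    refine Or.inr (Or.inr ⟨m - (x.1 ⬝ᵥ m) • x.1, ?_,
      (dotProduct_self_sub_smul (by rw [hx, mul_comm])).trans hm1, ?_⟩) <;> rw [hk]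
    · rw [Prod.fst_sub, Prod.smul_fst, hm, smul_sub, smul_smul]
    · exact sub_mul_smul_mem h.neg_middle h.middle_long
        (abs_dotProduct_le_one (by simp [hx, hm1])) hxM hyE

theorem sub_smul_mem_intRoots_of_long (h : ReflClosed l S M E) {x y : (Fin l → ℤ) × A}
    {n : Fin l → ℤ} (hx : x.1 = (2 : ℤ) • n) (hn : n ⬝ᵥ n = 1) (hxE : x.2 ∈ E)
    (hy : y ∈ intRoots l S M E) : y - (n ⬝ᵥ y.1) • x ∈ intRoots l S M E := by
  have norm_eq (m : Fin l → ℤ) : (m - (n ⬝ᵥ m) • x.1) ⬝ᵥ (m - (n ⬝ᵥ m) • x.1) = m ⬝ᵥ m := by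
    refine dotProduct_self_sub_smul ?_
    simp only [hx, smul_dotProduct, dotProduct_smul, smul_eq_mul, hn]
    ring
  rcases hy with ⟨hy, hyS⟩ | ⟨hy, hyM⟩ | ⟨m, hm, hm1, hyE⟩
  · refine Or.inl ⟨(norm_eq _).trans hy, ?_⟩
    simpa using sub_mul_smul_mem (c := 1) h.neg_long (by simpa using h.long_short)
      (abs_dotProduct_le_one (by simp [hn, hy])) hxE hyS
  · refine Or.inr (Or.inl ⟨(norm_eq _).trans hy, ?_⟩)
    simpa using sub_mul_smul_mem (c := 1) h.neg_long (by simpa using h.long_middle)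
      (abs_dotProduct_le_one (by simp [hn, hy])) hxE hyM
  · have hk : n ⬝ᵥ y.1 = 2 * (n ⬝ᵥ m) := by rw [hm, dotProduct_smul, smul_eq_mul]
    refine Or.inr (Or.inr ⟨m - (n ⬝ᵥ m) • x.1, ?_, (norm_eq m).trans hm1, ?_⟩) <;> rw [hk]
    · rw [Prod.fst_sub, Prod.smul_fst, hm, smul_sub, smul_smul]
    · exact sub_mul_smul_mem h.neg_long h.long_long
        (abs_dotProduct_le_one (by simp [hn, hm1])) hxE hyE

theorem exists_sub_smul_mem_intRoots (h : ReflClosed l S M E) {x y : (Fin l → ℤ) × A}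
    (hx : x ∈ intRoots l S M E) (hy : y ∈ intRoots l S M E) :
    ∃ k : ℤ, 2 * (x.1 ⬝ᵥ y.1) = k * (x.1 ⬝ᵥ x.1) ∧ y - k • x ∈ intRoots l S M E := by
  rcases hx with ⟨hx, hxS⟩ | ⟨hx, hxM⟩ | ⟨n, hx, hn, hxE⟩
  · exact ⟨_, by rw [hx, mul_one], h.sub_smul_mem_intRoots_of_short hx hxS hy⟩
  · exact ⟨_, by rw [hx, mul_comm], h.sub_smul_mem_intRoots_of_middle hx hxM hy⟩
  · refine ⟨_, ?_, h.sub_smul_mem_intRoots_of_long hx hn hxE hy⟩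
    simp only [hx, smul_dotProduct, dotProduct_smul, smul_eq_mul, hn]
    ring

end ReflClosed

end IntRoots

section RealPoints

variable {l : ℕ}

/-- The real vector with the given integer coordinates. -/
def realVec (l : ℕ) : (Fin l → ℤ) →+ (Fin l → ℝ) := (Int.castAddHom ℝ).compLeft (Fin l)

/-- The point of `Space l` with the given integer coordinates. -/
def realPt (l : ℕ) : (Fin l → ℤ) × (ℤ × ℤ) →+ Space l :=
  (realVec l).prodMap ((Int.castAddHom ℝ).prodMap (Int.castAddHom ℝ))

theorem realVec_apply (n : Fin l → ℤ) (i : Fin l) : realVec l n i = n i := rfl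

theorem realPt_apply (x : (Fin l → ℤ) × (ℤ × ℤ)) :
    realPt l x = (realVec l x.1, ((x.2.1 : ℝ), (x.2.2 : ℝ))) := rfl

theorem realVec_single (i : Fin l) (c : ℤ) : realVec l (Pi.single i c) = Pi.single i (c : ℝ) :=
  funext fun j => (Pi.apply_single (fun _ => ((↑) : ℤ → ℝ)) (fun _ => Int.cast_zero) i c j)

theorem realVec_dotProduct (n m : Fin l → ℤ) :
    realVec l n ⬝ᵥ realVec l m = ((n ⬝ᵥ m : ℤ) : ℝ) := by
  simp [realVec_apply, dotProduct]

theorem realVec_injective : Function.Injective (realVec l) :=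
  Int.cast_injective.comp_left

theorem realPt_injective : Function.Injective (realPt l) :=
  realVec_injective.prodMap (Int.cast_injective.prodMap Int.cast_injective)

theorem form_realPt (x y : (Fin l → ℤ) × (ℤ × ℤ)) :
    form l (realPt l x) (realPt l y) = ((x.1 ⬝ᵥ y.1 : ℤ) : ℝ) := realVec_dotProduct x.1 y.1

theorem shortBC_eq : shortBC l = realVec l '' {n | n ⬝ᵥ n = 1} := by
  ext v
  constructor
  · rintro ⟨i, rfl | rfl⟩
    · exact ⟨Pi.single i 1, by simp, by simp [realVec_single]⟩
    · exact ⟨-Pi.single i 1, by simp, by simp [realVec_single]⟩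
  · rintro ⟨n, hn, rfl⟩
    obtain ⟨i, rfl | rfl⟩ := exists_eq_single_of_dotProduct_self_eq_one hn
    · exact ⟨i, by simp [realVec_single]⟩
    · exact ⟨i, by simp [realVec_single]⟩

theorem middleBC_eq : middleBC l = realVec l '' {n | n ⬝ᵥ n = 2} := by
  ext v
  constructor
  · rintro ⟨i, j, hij, rfl | rfl | rfl | rfl⟩
    · exact ⟨Pi.single i 1 + Pi.single j 1, by simp [hij.ne, hij.ne'], by simp [realVec_single]⟩
    · exact ⟨-(Pi.single i 1 + Pi.single j 1), by simp [hij.ne, hij.ne'],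
        by simp [realVec_single]⟩
    · exact ⟨Pi.single i 1 - Pi.single j 1, by simp [hij.ne, hij.ne'], by simp [realVec_single]⟩
    · exact ⟨-(Pi.single i 1 - Pi.single j 1), by simp [hij.ne, hij.ne'],
        by simp [realVec_single]⟩
  · rintro ⟨n, hn, rfl⟩
    obtain ⟨i, j, hij, rfl | rfl | rfl | rfl⟩ :=
      exists_eq_add_single_of_dotProduct_self_eq_two hn <;>
    exact ⟨i, j, hij, by simp [realVec_single]⟩

theorem longBC_eq : longBC l = (fun n => realVec l ((2 : ℤ) • n)) '' {n | n ⬝ᵥ n = 1} := by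
  ext v
  constructor
  · rintro ⟨i, rfl | rfl⟩
    · exact ⟨Pi.single i 1, by simp, by simp [realVec_single, ← Pi.single_smul]⟩
    · exact ⟨-Pi.single i 1, by simp, by simp [realVec_single, ← Pi.single_smul]⟩
  · rintro ⟨n, hn, rfl⟩
    obtain ⟨i, rfl | rfl⟩ := exists_eq_single_of_dotProduct_self_eq_one hn
    · exact ⟨i, by simp [realVec_single, ← Pi.single_smul]⟩
    · exact ⟨i, by simp [realVec_single, ← Pi.single_smul]⟩

theorem rootsOf_eq (S M E : Set (ℤ × ℤ)) : rootsOf l S M E = realPt l '' intRoots l S M E := by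
  ext v
  constructor
  · rintro ((⟨hv, p, hp, h⟩ | ⟨hv, p, hp, h⟩) | ⟨hv, p, hp, h⟩)
    · obtain ⟨n, hn, hnv⟩ := shortBC_eq ▸ hv
      exact ⟨(n, p), Or.inl ⟨hn, hp⟩, Prod.ext hnv h.symm⟩
    · obtain ⟨n, hn, hnv⟩ := middleBC_eq ▸ hv
      exact ⟨(n, p), Or.inr (Or.inl ⟨hn, hp⟩), Prod.ext hnv h.symm⟩
    · obtain ⟨n, hn, hnv⟩ := longBC_eq ▸ hv
      exact ⟨((2 : ℤ) • n, p), Or.inr (Or.inr ⟨n, rfl, hn, hp⟩), Prod.ext hnv h.symm⟩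
  · rintro ⟨⟨n, p⟩, ⟨hn, hp⟩ | ⟨hn, hp⟩ | ⟨m, rfl, hm, hp⟩, rfl⟩
    · exact Or.inl (Or.inl ⟨shortBC_eq ▸ ⟨n, hn, rfl⟩, p, hp, rfl⟩)
    · exact Or.inl (Or.inr ⟨middleBC_eq ▸ ⟨n, hn, rfl⟩, p, hp, rfl⟩)
    · exact Or.inr ⟨longBC_eq ▸ ⟨m, hm, rfl⟩, p, hp, rfl⟩

theorem realPt_mem_rootsOf {S M E : Set (ℤ × ℤ)} {x : (Fin l → ℤ) × (ℤ × ℤ)} :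
    realPt l x ∈ rootsOf l S M E ↔ x ∈ intRoots l S M E := by
  rw [rootsOf_eq, realPt_injective.mem_set_image]

end RealPoints

section Reflections

variable {F : Type*} [NormedAddCommGroup F] [NormedSpace ℝ F] {I : LinearMap.BilinForm ℝ F}

theorem coroot_apply (α β : F) : I (coroot I α) β = 2 / I α α * I α β := by
  rw [coroot, map_smul, LinearMap.smul_apply, smul_eq_mul]

theorem coroot_apply_eq_iff {α β : F} (h : I α α ≠ 0) (k : ℝ) :
    I (coroot I α) β = k ↔ 2 * I α β = k * I α α := by
  rw [coroot_apply, div_mul_eq_mul_div, div_eq_iff h]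

theorem refl_eq (hI : ∀ x y, I x y = I y x) {α β : F} (h : I α α ≠ 0) {k : ℝ}
    (hk : 2 * I α β = k * I α α) : refl I α β = β - k • α := by
  rw [refl, hI, (coroot_apply_eq_iff h k).2 hk]

theorem refl_refl (hI : ∀ x y, I x y = I y x) {α : F} (h : I α α ≠ 0) (β : F) :
    refl I α (refl I α β) = β := by
  obtain ⟨k, hk⟩ : ∃ k, 2 * I α β = k * I α α := ⟨_, (coroot_apply_eq_iff h _).1 rfl⟩
  rw [refl_eq hI h hk, refl_eq hI h (k := -k)]
  · rw [neg_smul, sub_neg_eq_add, sub_add_cancel]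
  · simp only [map_sub, map_smul, smul_eq_mul]
    linear_combination hk

theorem refl_image_eq {R : Set F} (hI : ∀ x y, I x y = I y x) {α : F} (h : I α α ≠ 0)
    (hR : Set.MapsTo (refl I α) R R) : refl I α '' R = R :=
  hR.image_subset.antisymm fun β hβ => ⟨_, hR hβ, refl_refl hI h β⟩

end Reflections

section StandardModels

variable {l : ℕ} {S M E : Set (ℤ × ℤ)}

theorem form_apply (x y : Space l) : form l x y = x.1 ⬝ᵥ y.1 := rfl

theorem form_comm (x y : Space l) : form l x y = form l y x := by
  rw [form_apply, form_apply, dotProduct_comm]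

/-- The basis `ε_1, …, ε_l, a, b` of `Space l`. -/
noncomputable def spaceBasis (l : ℕ) : Module.Basis (Fin l ⊕ Fin 2) ℝ (Space l) :=
  (Pi.basisFun ℝ (Fin l)).prod (Module.Basis.finTwoProd ℝ)

theorem spaceBasis_inl (i : Fin l) :
    spaceBasis l (Sum.inl i) = realPt l (Pi.single i 1, 0) := by
  simp [spaceBasis, realPt_apply, realVec_single, Prod.ext_iff]

theorem spaceBasis_inr_zero : spaceBasis l (Sum.inr 0) = realPt l (0, (1, 0)) := by
  simp [spaceBasis, realPt_apply]

theorem spaceBasis_inr_one : spaceBasis l (Sum.inr 1) = realPt l (0, (0, 1)) := by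
  simp [spaceBasis, realPt_apply]

theorem vecA_eq : vecA l = realPt l (0, (1, 0)) := by simp [vecA, realPt_apply]

theorem hasSignature_form (l : ℕ) : HasSignature (form l) l 2 0 := by
  refine ⟨(spaceBasis l).reindex (Equiv.sumCongr (Equiv.refl _) (Equiv.sumEmpty _ _).symm),
    ?_, fun i => by simp [spaceBasis, form_apply], fun i => by simp [spaceBasis, form_apply],
    fun i => i.elim0⟩
  rintro (i | i | i) (j | j | j) hij
  · simpa [spaceBasis, form_apply, Pi.single_apply] using fun h : j = i => hij (by rw [h])
  all_goals first | exact i.elim0 | exact j.elim0 | simp [spaceBasis, form_apply]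

theorem coe_span_spaceBasis :
    (Submodule.span ℤ (Set.range (spaceBasis l)) : Set (Space l)) = Set.range (realPt l) := by
  refine Set.Subset.antisymm (show Submodule.span ℤ _ ≤ (realPt l).range.toIntSubmodule from
    Submodule.span_le.2 ?_) ?_
  · rintro _ ⟨i | i, rfl⟩
    · exact ⟨_, (spaceBasis_inl i).symm⟩
    · fin_cases i
      · exact ⟨_, spaceBasis_inr_zero.symm⟩
      · exact ⟨_, spaceBasis_inr_one.symm⟩
  · rintro _ ⟨⟨n, p⟩, rfl⟩
    rw [SetLike.mem_coe, Module.Basis.mem_span_iff_repr_mem]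
    rintro (i | i)
    · exact ⟨n i, by simp [spaceBasis, realPt_apply, realVec_apply]⟩
    · fin_cases i
      · exact ⟨p.1, by simp [spaceBasis, realPt_apply]⟩
      · exact ⟨p.2, by simp [spaceBasis, realPt_apply]⟩

theorem realPt_single_mem_rootsOf (i : Fin l) {p : ℤ × ℤ} (hp : p ∈ S) :
    realPt l (Pi.single i 1, p) ∈ rootsOf l S M E :=
  realPt_mem_rootsOf.2 (Or.inl ⟨by simp, hp⟩)

theorem rootLattice_rootsOf (hl : 1 ≤ l) (ha : ∃ p ∈ S, p + (1, 0) ∈ S)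
    (hb : ∃ p ∈ S, p + (0, 1) ∈ S) :
    rootLattice (rootsOf l S M E) = Submodule.span ℤ (Set.range (spaceBasis l)) := by
  have short_mem (i : Fin l) {p : ℤ × ℤ} (hp : p ∈ S) :
      realPt l (Pi.single i 1, p) ∈ rootLattice (rootsOf l S M E) :=
    Submodule.subset_span (realPt_single_mem_rootsOf i hp)
  have diff_mem {z : ℤ × ℤ} : (∃ p ∈ S, p + z ∈ S) →
      realPt l (0, z) ∈ rootLattice (rootsOf l S M E) := by
    rintro ⟨p, hp, hpz⟩
    have hz : ((0, z) : (Fin l → ℤ) × (ℤ × ℤ)) =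
        (Pi.single ⟨0, hl⟩ 1, p + z) - (Pi.single ⟨0, hl⟩ 1, p) := by simp
    rw [hz, map_sub]
    exact sub_mem (short_mem _ hpz) (short_mem _ hp)
  refine le_antisymm (Submodule.span_le.2 ?_) (Submodule.span_le.2 ?_)
  · rw [coe_span_spaceBasis, rootsOf_eq]
    exact Set.image_subset_range _ _
  · rintro _ ⟨i | i, rfl⟩
    · obtain ⟨p, hp, -⟩ := id ha
      have hi : ((Pi.single i 1, 0) : (Fin l → ℤ) × (ℤ × ℤ)) =
          (Pi.single i 1, p) - (p.1 • (0, (1, 0)) + p.2 • (0, (0, 1))) := by simp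
      rw [spaceBasis_inl, hi, map_sub, map_add, map_zsmul, map_zsmul]
      exact sub_mem (short_mem i hp)
        (add_mem (zsmul_mem (diff_mem ha) _) (zsmul_mem (diff_mem hb) _))
    · fin_cases i
      · exact spaceBasis_inr_zero (l := l) ▸ diff_mem ha
      · exact spaceBasis_inr_one (l := l) ▸ diff_mem hb

theorem ReflClosed.exists_refl_mem_rootsOf (h : ReflClosed l S M E) {α β : Space l}
    (hα : α ∈ rootsOf l S M E) (hβ : β ∈ rootsOf l S M E) :
    ∃ k : ℤ, 2 * form l α β = k * form l α α ∧ β - (k : ℝ) • α ∈ rootsOf l S M E := by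
  rw [rootsOf_eq] at hα hβ
  obtain ⟨x, hx, rfl⟩ := hα
  obtain ⟨y, hy, rfl⟩ := hβ
  obtain ⟨k, hk, hmem⟩ := h.exists_sub_smul_mem_intRoots hx hy
  refine ⟨k, by simp only [form_realPt]; exact_mod_cast hk, ?_⟩
  rw [Int.cast_smul_eq_zsmul, ← map_zsmul, ← map_sub, realPt_mem_rootsOf]
  exact hmem

theorem form_self_ne_zero_of_mem_rootsOf {α : Space l} (hα : α ∈ rootsOf l S M E) :
    form l α α ≠ 0 := by
  rw [rootsOf_eq] at hα
  obtain ⟨x, hx, rfl⟩ := hα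
  rw [form_realPt]
  exact_mod_cast (dotProduct_self_pos_of_mem_intRoots hx).ne'

theorem eq_empty_of_orthogonal_of_single_mem (hM : M.Nonempty) {R₁ R₂ : Set (Space l)}
    (hR : R₁ ∪ R₂ = rootsOf l S M E) (horth : ∀ α ∈ R₁, ∀ β ∈ R₂, form l α β = 0)
    {i : Fin l} {p : ℤ × ℤ} (hp : realPt l (Pi.single i 1, p) ∈ R₁) : R₂ = ∅ := by
  refine Set.eq_empty_of_forall_notMem fun β hβ => ?_
  obtain ⟨⟨n, q⟩, hx, rfl⟩ := rootsOf_eq S M E ▸ hR.subset (Or.inr hβ)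
  have hni : n i = 0 := by simpa [form_realPt] using horth _ hp _ hβ
  have hn : n ≠ 0 := fun hn => by
    simpa [hn] using dotProduct_self_pos_of_mem_intRoots hx
  obtain ⟨j, hj⟩ := Function.ne_iff.1 hn
  have hij : i ≠ j := fun hij => hj (hij ▸ hni)
  obtain ⟨m, hm⟩ := hM
  -- this middle root is orthogonal neither to `ε_i + p` nor to `β`
  have hmid : realPt l (Pi.single i 1 + Pi.single j 1, m) ∈ R₁ ∪ R₂ := by
    rw [hR, realPt_mem_rootsOf]
    exact Or.inr (Or.inl ⟨by simp [hij, hij.symm], hm⟩)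
  rcases hmid with hmid | hmid
  · have := horth _ hmid _ hβ
    simp only [form_realPt, add_dotProduct, single_dotProduct, hni, one_mul, zero_add,
      Int.cast_eq_zero] at this
    exact hj this
  · have := horth _ hp _ hmid
    simp [form_realPt, hij] at this

theorem isGeneralizedRootSystem_rootsOf (hl : 1 ≤ l) (h : ReflClosed l S M E)
    (ha : ∃ p ∈ S, p + (1, 0) ∈ S) (hb : ∃ p ∈ S, p + (0, 1) ∈ S) (hM : M.Nonempty) :
    IsGeneralizedRootSystem (form l) (rootsOf l S M E) := by
  have hlat := rootLattice_rootsOf (M := M) (E := E) hl ha hb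
  have hdisc : DiscreteTopology (rootLattice (rootsOf l S M E)) := by rw [hlat]; infer_instance
  obtain ⟨p, hp, -⟩ := ha
  have hε := realPt_single_mem_rootsOf (M := M) (E := E) ⟨0, hl⟩ hp
  refine ⟨⟨_, hε⟩, DiscreteTopology.of_subset hdisc Submodule.subset_span, hdisc, ?_,
    fun α => form_self_ne_zero_of_mem_rootsOf, fun α hα β hβ => ?_, fun α hα => ?_, ?_⟩
  · rw [hlat, Submodule.span_span_of_tower, (spaceBasis l).span_eq]
  · obtain ⟨k, hk, -⟩ := h.exists_refl_mem_rootsOf hα hβ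
    exact ⟨k, (coroot_apply_eq_iff (form_self_ne_zero_of_mem_rootsOf hα) _).2 hk⟩
  · have hα0 := form_self_ne_zero_of_mem_rootsOf hα
    refine refl_image_eq form_comm hα0 fun β hβ => ?_
    obtain ⟨k, hk, hmem⟩ := h.exists_refl_mem_rootsOf hα hβ
    rwa [refl_eq form_comm hα0 hk]
  · intro R₁ R₂ hR horth
    rcases hR.superset hε with hε | hε
    · exact Or.inr (eq_empty_of_orthogonal_of_single_mem hM hR horth hε)
    · exact Or.inl (eq_empty_of_orthogonal_of_single_mem hM ((Set.union_comm _ _).trans hR)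
        (fun α hα β hβ => (form_comm _ _).trans (horth β hβ α hα)) hε)

theorem isMarking_lineA (hl : 1 ≤ l) (ha : ∃ p ∈ S, p + (1, 0) ∈ S)
    (hb : ∃ p ∈ S, p + (0, 1) ∈ S) : IsMarking (form l) (rootsOf l S M E) (lineA l) where
  le_rad := by
    rw [lineA, Submodule.span_singleton_le_iff_mem, LinearMap.mem_ker]
    exact LinearMap.ext fun x => zero_dotProduct x.1
  finrank_eq := finrank_span_singleton (by simp [vecA])
  full := by
    refine le_antisymm (Submodule.span_le.2 fun x hx => hx.1) ?_
    rw [lineA, Submodule.span_singleton_le_iff_mem]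
    refine Submodule.subset_span ⟨Submodule.mem_span_singleton_self _, ?_⟩
    rw [rootLattice_rootsOf hl ha hb, coe_span_spaceBasis]
    exact ⟨_, vecA_eq.symm⟩

/-- The projection `ℝ^l ⊕ ℝ a ⊕ ℝ b → ℝ^l ⊕ ℝ b` along `a`. -/
def forgetA (l : ℕ) : Space l →ₗ[ℝ] (Fin l → ℝ) × ℝ :=
  (LinearMap.id).prodMap (LinearMap.snd ℝ ℝ ℝ)

theorem forgetA_surjective (l : ℕ) : Function.Surjective (forgetA l) :=
  fun v => ⟨(v.1, (0, v.2)), rfl⟩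

theorem ker_forgetA (l : ℕ) : LinearMap.ker (forgetA l) = lineA l := by
  ext ⟨v, x, y⟩
  simp [forgetA, lineA, vecA, Submodule.mem_span_singleton, eq_comm]

/-- The identification of the quotient by `ℝ a` with `ℝ^l ⊕ ℝ b`. -/
noncomputable def quotientEquiv (l : ℕ) : (Space l ⧸ lineA l) ≃ₗ[ℝ] (Fin l → ℝ) × ℝ :=
  (Submodule.quotEquivOfEq _ _ (ker_forgetA l).symm).trans
    ((forgetA l).quotKerEquivOfSurjective (forgetA_surjective l))

theorem quotientEquiv_mkQ (v : Space l) : quotientEquiv l ((lineA l).mkQ v) = forgetA l v := rfl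

end StandardModels

namespace EllipticType

variable {l : ℕ}

theorem rootLattice_roots (t : EllipticType) (hl : 1 ≤ l) :
    rootLattice (t.roots l) = Submodule.span ℤ (Set.range (spaceBasis l)) :=
  rootLattice_rootsOf hl t.exists_short_add_a_and_add_b.1 t.exists_short_add_a_and_add_b.2

theorem isMarkedElliptic_roots {t : EllipticType} (ht : t.Admissible l) :
    IsMarkedElliptic l (form l) (t.roots l) (lineA l) where
  symm := form_comm
  signature := hasSignature_form l
  rootSystem := isGeneralizedRootSystem_rootsOf ht.one_le ht.reflClosed
    t.exists_short_add_a_and_add_b.1 t.exists_short_add_a_and_add_b.2 t.middleSet_nonempty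
  marking := isMarking_lineA ht.one_le t.exists_short_add_a_and_add_b.1
    t.exists_short_add_a_and_add_b.2

theorem not_isReduced_roots (t : EllipticType) (hl : 1 ≤ l) : ¬ IsReduced (t.roots l) := by
  intro h
  obtain ⟨p, hp, hp2⟩ := t.exists_two_smul_mem_longSet
  refine (h _ (realPt_single_mem_rootsOf ⟨0, hl⟩ hp)).1 ?_
  rw [← Int.cast_ofNat, Int.cast_smul_eq_zsmul, ← map_zsmul]
  exact realPt_mem_rootsOf.2 (Or.inr (Or.inr ⟨_, rfl, by simp, hp2⟩))

theorem quotientEquiv_image (t : EllipticType) (l : ℕ) :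
    quotientEquiv l '' quotientRoots (t.roots l) (lineA l) = t.quotient.roots l := by
  rw [quotientRoots, Set.image_image]
  simp only [quotientEquiv_mkQ]
  ext ⟨v, y⟩
  constructor
  · rintro ⟨⟨w, x, z⟩, ((⟨hw, p, -, h⟩ | ⟨hw, p, hp, h⟩) | ⟨hw, p, hp, h⟩), he⟩
    all_goals
      obtain ⟨rfl, rfl⟩ : w = v ∧ z = y := Prod.mk.injEq .. ▸ he
      obtain ⟨-, h⟩ := Prod.mk.injEq .. ▸ h
    · exact Or.inl (Or.inl ⟨hw, p.2, h⟩)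
    · exact Or.inl (Or.inr ⟨hw, p.2, (t.exists_fst_mem_middleSet_iff _).1 ⟨p.1, hp⟩, h⟩)
    · exact Or.inr ⟨hw, p.2, (t.exists_fst_mem_longSet_iff _).1 ⟨p.1, hp⟩, h⟩
  · rintro ((⟨hv, n, h⟩ | ⟨hv, n, hn, h⟩) | ⟨hv, n, hn, h⟩)
    · obtain ⟨m, hm⟩ := t.exists_fst_mem_shortSet n
      exact ⟨(v, (m, n)), Or.inl (Or.inl ⟨hv, _, hm, rfl⟩), Prod.ext rfl h.symm⟩
    · obtain ⟨m, hm⟩ := (t.exists_fst_mem_middleSet_iff n).2 hn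
      exact ⟨(v, (m, n)), Or.inl (Or.inr ⟨hv, _, hm, rfl⟩), Prod.ext rfl h.symm⟩
    · obtain ⟨m, hm⟩ := (t.exists_fst_mem_longSet_iff n).2 hn
      exact ⟨(v, (m, n)), Or.inr ⟨hv, _, hm, rfl⟩, Prod.ext rfl h.symm⟩

end EllipticType

section FrameChanges

variable {l : ℕ} {k : ℤ} {ξ : Fin l → ℤ × ℤ} {S M E S' M' E' : Set (ℤ × ℤ)}

theorem mem_iff_shear_neg_mem {X X' : Set (ℤ × ℤ)} (hX : ∀ x ∈ X, -x ∈ X)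
    (hX' : ∀ x ∈ X', -x ∈ X') {η : ℤ × ℤ} (h : ∀ p, p ∈ X ↔ shear k p + η ∈ X') (p : ℤ × ℤ) :
    p ∈ X ↔ shear k p + -η ∈ X' := by
  have neg_mem_iff {Y : Set (ℤ × ℤ)} (hY : ∀ x ∈ Y, -x ∈ Y) (q : ℤ × ℤ) : q ∈ Y ↔ -q ∈ Y :=
    ⟨hY q, fun hq => neg_neg q ▸ hY _ hq⟩
  rw [neg_mem_iff hX, h, neg_mem_iff hX', map_neg]
  congr! 1
  abel

theorem FrameChange.mem_intRoots_iff (hξ : FrameChange l k ξ S M E S' M' E')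
    (h : ReflClosed l S M E) (h' : ReflClosed l S' M' E') (n : Fin l → ℤ) (p : ℤ × ℤ) :
    (n, p) ∈ intRoots l S M E ↔
      (n, shear k p + Fintype.linearCombination ℤ ξ n) ∈ intRoots l S' M' E' := by
  have combo_single (i : Fin l) : Fintype.linearCombination ℤ ξ (Pi.single i 1) = ξ i :=
    (Fintype.linearCombination_apply_single ℤ ξ i 1).trans (one_smul ℤ (ξ i))
  refine or_congr (and_congr_right fun hn => ?_) (or_congr (and_congr_right fun hn => ?_)
    (exists_congr fun m => and_congr_right fun hm => and_congr_right fun hm1 => ?_))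
  · obtain ⟨i, rfl | rfl⟩ := exists_eq_single_of_dotProduct_self_eq_one hn
    · rw [combo_single]
      exact hξ.short i p
    · rw [map_neg, combo_single]
      exact mem_iff_shear_neg_mem h.neg_short h'.neg_short (hξ.short i) p
  · obtain ⟨i, j, hij, rfl | rfl | rfl | rfl⟩ := exists_eq_add_single_of_dotProduct_self_eq_two hn
    · rw [map_add, combo_single, combo_single]
      exact hξ.middle_add i j hij.ne p
    · rw [map_neg, map_add, combo_single, combo_single]
      exact mem_iff_shear_neg_mem h.neg_middle h'.neg_middle (hξ.middle_add i j hij.ne) p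
    · rw [map_sub, combo_single, combo_single]
      exact hξ.middle_sub i j hij.ne p
    · rw [map_neg, map_sub, combo_single, combo_single]
      exact mem_iff_shear_neg_mem h.neg_middle h'.neg_middle (hξ.middle_sub i j hij.ne) p
  · obtain rfl : n = (2 : ℤ) • m := hm
    rw [map_smul]
    obtain ⟨i, rfl | rfl⟩ := exists_eq_single_of_dotProduct_self_eq_one hm1
    · rw [combo_single]
      exact hξ.long i p
    · rw [map_neg, combo_single, smul_neg (2 : ℤ) (ξ i)]
      exact mem_iff_shear_neg_mem h.neg_long h'.neg_long (hξ.long i) p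

/-- The real extension of `shear`. -/
def realShear (k : ℝ) : (ℝ × ℝ) ≃ₗ[ℝ] ℝ × ℝ where
  toFun p := (p.1 + k * p.2, p.2)
  invFun p := (p.1 - k * p.2, p.2)
  left_inv p := by simp
  right_inv p := by simp
  map_add' p q := by ext <;> simp only [Prod.fst_add, Prod.snd_add]; ring
  map_smul' c p := by
    ext <;> simp only [Prod.smul_fst, Prod.smul_snd, smul_eq_mul, RingHom.id_apply]; ring

/-- The linear automorphism `ε_i ↦ ε_i + ξ_i`, `a ↦ a`, `b ↦ k a + b` underlying a change of
frame. -/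
def frameEquiv (k : ℤ) (ξ : Fin l → ℤ × ℤ) : Space l ≃ₗ[ℝ] Space l :=
  (LinearEquiv.refl ℝ (Fin l → ℝ)).skewProd (realShear k)
    (Fintype.linearCombination ℝ fun i => (((ξ i).1 : ℝ), ((ξ i).2 : ℝ)))

theorem frameEquiv_realPt (k : ℤ) (ξ : Fin l → ℤ × ℤ) (n : Fin l → ℤ) (p : ℤ × ℤ) :
    frameEquiv k ξ (realPt l (n, p)) =
      realPt l (n, shear k p + Fintype.linearCombination ℤ ξ n) := by
  ext <;> simp [frameEquiv, realShear, realPt_apply, realVec_apply, shear_apply,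
    Fintype.linearCombination_apply, Prod.fst_sum, Prod.snd_sum]

theorem image_lineA {e : Space l ≃ₗ[ℝ] Space l} (h : e (vecA l) = vecA l) :
    e '' (lineA l : Set (Space l)) = lineA l := by
  have : (lineA l).map e.toLinearMap = lineA l := by
    rw [lineA, Submodule.map_span, Set.image_singleton, LinearEquiv.coe_coe, h]
  exact congrArg SetLike.coe this

theorem FrameChange.markedSimilar (hξ : FrameChange l k ξ S M E S' M' E')
    (h : ReflClosed l S M E) (h' : ReflClosed l S' M' E') :
    MarkedSimilar (form l) (rootsOf l S M E) (lineA l)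
      (form l) (rootsOf l S' M' E') (lineA l) := by
  refine ⟨frameEquiv k ξ, Set.Subset.antisymm ?_ ?_, image_lineA ?_, 1, one_pos,
    fun x y => (one_mul _).symm⟩
  · rintro _ ⟨v, hv, rfl⟩
    obtain ⟨⟨n, p⟩, hx, rfl⟩ := rootsOf_eq S M E ▸ hv
    rw [frameEquiv_realPt, realPt_mem_rootsOf]
    exact (hξ.mem_intRoots_iff h h' n p).1 hx
  · intro v hv
    obtain ⟨⟨n, q⟩, hx, rfl⟩ := rootsOf_eq S' M' E' ▸ hv
    obtain ⟨p, rfl⟩ : ∃ p, shear k p + Fintype.linearCombination ℤ ξ n = q :=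
      ⟨(shear k).symm (q - Fintype.linearCombination ℤ ξ n), by simp⟩
    exact ⟨_, realPt_mem_rootsOf.2 ((hξ.mem_intRoots_iff h h' n p).2 hx),
      frameEquiv_realPt k ξ n p⟩
  · rw [vecA_eq, frameEquiv_realPt]
    simp [shear_apply]

end FrameChanges

section IntegerPoints

variable {A : Type*} {l : ℕ} {S M E : Set A} {n : Fin l → ℤ} {p : A}

theorem four_dvd_of_eq_two_smul {m : Fin l → ℤ} (h : n = (2 : ℤ) • m) : 4 ∣ n ⬝ᵥ n :=
  ⟨m ⬝ᵥ m, by rw [h, smul_dotProduct, dotProduct_smul, smul_eq_mul, smul_eq_mul]; ring⟩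

theorem mem_intRoots_iff_mem_short (hn : n ⬝ᵥ n = 1) : (n, p) ∈ intRoots l S M E ↔ p ∈ S := by
  refine ⟨?_, fun hp => Or.inl ⟨hn, hp⟩⟩
  rintro (⟨-, hp⟩ | ⟨h, -⟩ | ⟨m, h, -⟩)
  · exact hp
  · cases hn.symm.trans h
  · exact absurd (hn ▸ four_dvd_of_eq_two_smul h) (by decide)

theorem mem_intRoots_iff_mem_middle (hn : n ⬝ᵥ n = 2) : (n, p) ∈ intRoots l S M E ↔ p ∈ M := by
  refine ⟨?_, fun hp => Or.inr (Or.inl ⟨hn, hp⟩)⟩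
  rintro (⟨h, -⟩ | ⟨-, hp⟩ | ⟨m, h, -⟩)
  · cases hn.symm.trans h
  · exact hp
  · exact absurd (hn ▸ four_dvd_of_eq_two_smul h) (by decide)

theorem mem_intRoots_iff_mem_long (hn : n ⬝ᵥ n = 1) :
    ((2 : ℤ) • n, p) ∈ intRoots l S M E ↔ p ∈ E := by
  have hnorm : ((2 : ℤ) • n) ⬝ᵥ ((2 : ℤ) • n) = 4 := by
    rw [smul_dotProduct, dotProduct_smul, hn]; rfl
  refine ⟨?_, fun hp => Or.inr (Or.inr ⟨n, rfl, hn, hp⟩)⟩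
  rintro (⟨h, -⟩ | ⟨h, -⟩ | ⟨m, -, -, hp⟩)
  · cases hnorm.symm.trans h
  · cases hnorm.symm.trans h
  · exact hp

theorem abs_apply_le_two_of_mem_intRoots {x : (Fin l → ℤ) × A} (hx : x ∈ intRoots l S M E)
    (i : Fin l) : |x.1 i| ≤ 2 := by
  have hle : x.1 i * x.1 i ≤ x.1 ⬝ᵥ x.1 :=
    Finset.single_le_sum (f := fun j => x.1 j * x.1 j) (fun j _ => mul_self_nonneg _)
      (Finset.mem_univ i)
  refine abs_le_of_sq_le_sq ?_ two_pos.le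
  rcases dotProduct_self_mem_of_mem_intRoots hx with h | h | h <;> rw [h] at hle <;> linarith

end IntegerPoints

section Uniqueness

variable {l : ℕ} {t t' : EllipticType}

namespace EllipticType

/-- The root system of type `t` in integral coordinates. -/
def intRoots (t : EllipticType) (l : ℕ) : Set ((Fin l → ℤ) × (ℤ × ℤ)) :=
  MERS.intRoots l t.shortSet t.middleSet t.longSet

theorem add_four_smul_mem_intRoots {x : (Fin l → ℤ) × (ℤ × ℤ)} (hx : x ∈ t.intRoots l)
    (z : ℤ × ℤ) : x + (4 : ℤ) • (0, z) ∈ t.intRoots l := by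
  have hadd : x + (4 : ℤ) • (0, z) = (x.1, x.2 + (4 : ℤ) • z) := by ext <;> simp
  rw [hadd]
  exact hx.imp (And.imp_right fun h => t.isFourPeriodic_shortSet _ h z)
    (Or.imp (And.imp_right fun h => t.isFourPeriodic_middleSet _ h z)
      fun ⟨m, hm, hm1, h⟩ => ⟨m, hm, hm1, t.isFourPeriodic_longSet _ h z⟩)

end EllipticType

variable {φ : (Fin l → ℤ) × (ℤ × ℤ) ≃+ (Fin l → ℤ) × (ℤ × ℤ)}

/-- The roots are bounded modulo the radical, but invariant under translation by `4 z`. -/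
theorem fst_apply_zero_eq_zero (hl : 1 ≤ l) (hφ : ∀ x, x ∈ t.intRoots l ↔ φ x ∈ t'.intRoots l)
    (z : ℤ × ℤ) : (φ (0, z)).1 = 0 := by
  obtain ⟨⟨p, hp, -⟩, -⟩ := t.exists_short_add_a_and_add_b
  have root_mem (j : ℤ) :
      φ (Pi.single ⟨0, hl⟩ 1, p) + (4 * j) • φ (0, z) ∈ t'.intRoots l := by
    have hz : (4 * j) • ((0, z) : (Fin l → ℤ) × (ℤ × ℤ)) = (4 : ℤ) • (0, j • z) := by
      rw [mul_smul, Prod.smul_mk j, smul_zero]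
    rw [← map_zsmul, hz, ← map_add, ← hφ]
    exact EllipticType.add_four_smul_mem_intRoots
      ((mem_intRoots_iff_mem_short (by simp)).2 hp) (j • z)
  funext i
  have bound (j : ℤ) : |(φ (Pi.single ⟨0, hl⟩ 1, p)).1 i + 4 * j * (φ (0, z)).1 i| ≤ 2 := by
    simpa using abs_apply_le_two_of_mem_intRoots (root_mem j) i
  have h₀ := abs_le.1 (bound 0)
  have h₁ := abs_le.1 (bound 1)
  have h₂ := abs_le.1 (bound (-1))
  change _ = (0 : ℤ)
  omega

theorem exists_units_apply_zero (hrad : ∀ z, (φ (0, z)).1 = 0)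
    (hrad' : ∀ z, (φ.symm (0, z)).1 = 0) (ha : (φ (0, (1, 0))).2.2 = 0)
    (ha' : (φ.symm (0, (1, 0))).2.2 = 0) :
    ∃ (c d : ℤˣ) (k : ℤ), ∀ p, φ (0, p) = (0, affinePerm c d k 0 p) := by
  have triangular (ψ : (Fin l → ℤ) × (ℤ × ℤ) ≃+ (Fin l → ℤ) × (ℤ × ℤ))
      (hψ : ∀ z, (ψ (0, z)).1 = 0) (hψa : (ψ (0, (1, 0))).2.2 = 0) :
      ∃ c d k : ℤ, ∀ p, ψ (0, p) = (0, (c * p.1 + k * p.2, d * p.2)) := by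
    refine ⟨(ψ (0, (1, 0))).2.1, (ψ (0, (0, 1))).2.2, (ψ (0, (0, 1))).2.1, fun p => ?_⟩
    have hp : ((0, p) : (Fin l → ℤ) × (ℤ × ℤ)) = p.1 • (0, (1, 0)) + p.2 • (0, (0, 1)) := by
      simp
    refine Prod.ext (hψ p) ?_
    rw [hp, map_add, map_zsmul, map_zsmul]
    ext <;> simp only [Prod.snd_add, Prod.fst_add, Prod.smul_snd, Prod.smul_fst, smul_eq_mul, hψa]
      <;> ring
  obtain ⟨c, d, k, h⟩ := triangular φ hrad ha
  obtain ⟨c', d', k', h'⟩ := triangular φ.symm hrad' ha'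
  have comp (p : ℤ × ℤ) := (h' p ▸ φ.apply_symm_apply (0, p) :)
  simp only [h, true_and, Prod.ext_iff] at comp
  have hc : c * c' = 1 := by simpa using (comp (1, 0)).1
  have hd : d * d' = 1 := by simpa using (comp (0, 1)).2
  exact ⟨Units.mkOfMulEqOne c c' hc, Units.mkOfMulEqOne d d' hd, k, fun p => by
    rw [h, affinePerm_apply, add_zero]; rfl⟩

theorem apply_eq_affinePerm {c d : ℤˣ} {k : ℤ}
    (hφ : ∀ p, φ (0, p) = (0, affinePerm c d k 0 p)) (n : Fin l → ℤ) (p : ℤ × ℤ) :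
    φ (n, p) = ((φ (n, 0)).1, affinePerm c d k (φ (n, 0)).2 p) := by
  have hnp : ((n, p) : (Fin l → ℤ) × (ℤ × ℤ)) = (n, 0) + (0, p) := by simp
  rw [hnp, map_add, hφ]
  ext <;> simp [affinePerm_apply, add_comm]

/-- The double of `ε_i` is a root modulo the radical, so the square length `N` of the image and
`4 N` both lie in `{1, 2, 4}`. -/
theorem dotProduct_self_fst_single_eq_one (hφ : ∀ x, x ∈ t.intRoots l ↔ φ x ∈ t'.intRoots l)
    (hrad : ∀ n p, (φ (n, p)).1 = (φ (n, 0)).1) (i : Fin l) :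
    (φ (Pi.single i 1, 0)).1 ⬝ᵥ (φ (Pi.single i 1, 0)).1 = 1 := by
  obtain ⟨p, hp, hp2⟩ := t.exists_two_smul_mem_longSet
  have hshort := (hφ _).1 ((mem_intRoots_iff_mem_short (n := Pi.single i 1) (by simp)).2 hp)
  have hlong := (hφ _).1 ((mem_intRoots_iff_mem_long (n := Pi.single i 1) (by simp)).2 hp2)
  have h₁ := dotProduct_self_mem_of_mem_intRoots hshort
  have h₂ := dotProduct_self_mem_of_mem_intRoots hlong
  rw [← Prod.smul_mk, map_zsmul, Prod.smul_fst, smul_dotProduct, dotProduct_smul, hrad,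
    smul_eq_mul, smul_eq_mul] at h₂
  rw [hrad] at h₁
  simp only [Set.mem_insert_iff, Set.mem_singleton_iff] at h₁ h₂
  omega

/-- The square lengths `2 ± 2x` of the images of `ε_i ± ε_j` both lie in `{1, 2, 4}`. -/
theorem dotProduct_fst_single_eq_zero (hφ : ∀ x, x ∈ t.intRoots l ↔ φ x ∈ t'.intRoots l)
    (hrad : ∀ n p, (φ (n, p)).1 = (φ (n, 0)).1) {i j : Fin l} (hij : i ≠ j) :
    (φ (Pi.single i 1, 0)).1 ⬝ᵥ (φ (Pi.single j 1, 0)).1 = 0 := by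
  obtain ⟨p, hp⟩ := t.middleSet_nonempty
  have hi := dotProduct_self_fst_single_eq_one hφ hrad i
  have hj := dotProduct_self_fst_single_eq_one hφ hrad j
  have hadd := dotProduct_self_mem_of_mem_intRoots ((hφ _).1 ((mem_intRoots_iff_mem_middle
    (n := Pi.single i 1 + Pi.single j 1) (by simp [hij, hij.symm])).2 hp))
  have hsub := dotProduct_self_mem_of_mem_intRoots ((hφ _).1 ((mem_intRoots_iff_mem_middle
    (n := Pi.single i 1 - Pi.single j 1) (by simp [hij, hij.symm])).2 hp))
  rw [hrad, ← add_zero (0 : ℤ × ℤ), ← Prod.mk_add_mk, map_add] at hadd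
  rw [hrad, ← sub_zero (0 : ℤ × ℤ), ← Prod.mk_sub_mk, map_sub] at hsub
  simp only [Prod.fst_add, Prod.fst_sub, add_dotProduct, dotProduct_add, sub_dotProduct,
    dotProduct_sub, hi, hj, dotProduct_comm (φ (Pi.single j 1, 0)).1,
    Set.mem_insert_iff, Set.mem_singleton_iff] at hadd hsub
  omega

theorem EllipticType.eq_of_addEquiv (ht : t.Admissible l) (ht' : t'.Admissible l)
    (hφ : ∀ x, x ∈ t.intRoots l ↔ φ x ∈ t'.intRoots l)
    (ha : (φ (0, (1, 0))).2.2 = 0) (ha' : (φ.symm (0, (1, 0))).2.2 = 0) : t = t' := by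
  have hφ' (x) : x ∈ t'.intRoots l ↔ φ.symm x ∈ t.intRoots l := by rw [hφ, φ.apply_symm_apply]
  obtain ⟨c, d, k, hzero⟩ := exists_units_apply_zero (fst_apply_zero_eq_zero ht.one_le hφ)
    (fst_apply_zero_eq_zero ht.one_le hφ') ha ha'
  have happly := apply_eq_affinePerm hzero
  have hrad (n p) : (φ (n, p)).1 = (φ (n, 0)).1 := by rw [happly]
  have hnorm := dotProduct_self_fst_single_eq_one hφ hrad
  let i₀ : Fin l := ⟨0, ht.one_le⟩
  obtain ⟨η, hη⟩ : ∃ η, 2 ≤ l → ∀ p, p ∈ t.middleSet ↔ affinePerm c d k η p ∈ t'.middleSet := by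
    rcases lt_or_ge l 2 with hl | hl
    · exact ⟨0, fun h => absurd h hl.not_ge⟩
    · let i₁ : Fin l := ⟨1, hl⟩
      have h01 : i₀ ≠ i₁ := by simp [i₀, i₁]
      have horth := dotProduct_fst_single_eq_zero hφ hrad h01
      refine ⟨(φ (Pi.single i₀ 1 + Pi.single i₁ 1, 0)).2, fun _ p => ?_⟩
      refine (mem_intRoots_iff_mem_middle (n := Pi.single i₀ 1 + Pi.single i₁ 1)
        (by simp [h01, h01.symm])).symm.trans ((hφ _).trans ?_)
      rw [happly]
      refine mem_intRoots_iff_mem_middle ?_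
      rw [← add_zero (0 : ℤ × ℤ), ← Prod.mk_add_mk, map_add, Prod.fst_add, add_dotProduct,
        dotProduct_add, dotProduct_add, hnorm, hnorm,
        dotProduct_comm (φ (Pi.single i₁ 1, 0)).1, horth]
      norm_num
  refine eq_of_affinePerm ht ht' c d k (φ (Pi.single i₀ 1, 0)).2 η (fun p => ?_) hη fun p => ?_
  · refine (mem_intRoots_iff_mem_short (n := Pi.single i₀ 1) (by simp)).symm.trans
      ((hφ _).trans ?_)
    rw [happly]
    exact mem_intRoots_iff_mem_short (hnorm i₀)
  · refine (mem_intRoots_iff_mem_long (n := Pi.single i₀ 1) (by simp)).symm.trans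
      ((hφ _).trans ?_)
    rw [happly, ← smul_zero (2 : ℤ), ← Prod.smul_mk, map_zsmul, Prod.smul_fst, Prod.smul_snd,
      two_zsmul (φ _).2]
    exact mem_intRoots_iff_mem_long (hnorm i₀)

end Uniqueness

section MarkedIso

variable {l : ℕ}

theorem exists_addEquiv_realPt {e : Space l ≃ₗ[ℝ] Space l}
    (he : e '' Set.range (realPt l) = Set.range (realPt l)) :
    ∃ φ : (Fin l → ℤ) × (ℤ × ℤ) ≃+ (Fin l → ℤ) × (ℤ × ℤ), ∀ x, e (realPt l x) = realPt l (φ x) := by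
  let ι := AddMonoidHom.ofInjective (realPt_injective (l := l))
  have hmap : (realPt l).range.map e.toAddEquiv.toAddMonoidHom = (realPt l).range :=
    SetLike.coe_injective he
  let φ := (ι.trans (e.toAddEquiv.addSubgroupMap _)).trans
    ((AddEquiv.addSubgroupCongr hmap).trans ι.symm)
  refine ⟨φ, fun x => ?_⟩
  have hι (y) : realPt l y = (ι y : Space l) := rfl
  have hφ : ι (φ x) = AddEquiv.addSubgroupCongr hmap (e.toAddEquiv.addSubgroupMap _ (ι x)) :=
    ι.apply_symm_apply _
  rw [hι (φ x), hφ]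
  rfl

theorem EllipticType.eq_of_markedIso {t t' : EllipticType} (ht : t.Admissible l)
    (ht' : t'.Admissible l) (h : MarkedIso (t.roots l) (lineA l) (t'.roots l) (lineA l)) :
    t = t' := by
  obtain ⟨e, hR, hG⟩ := h
  have hrange : e '' Set.range (realPt l) = Set.range (realPt l) := by
    have hmap := Submodule.map_span (e.toLinearMap.restrictScalars ℤ) (t.roots l)
    have hR' : e.toLinearMap.restrictScalars ℤ '' t.roots l = t'.roots l := hR
    rw [hR', ← rootLattice, ← rootLattice, rootLattice_roots t ht.one_le,
      rootLattice_roots t' ht.one_le] at hmap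
    rw [← coe_span_spaceBasis]
    exact congrArg SetLike.coe hmap
  obtain ⟨φ, hφ⟩ := exists_addEquiv_realPt hrange
  have snd_eq_zero {x : (Fin l → ℤ) × (ℤ × ℤ)} (hx : realPt l x ∈ lineA l) : x.2.2 = 0 := by
    obtain ⟨r, hr⟩ := Submodule.mem_span_singleton.1 hx
    have := congrArg (fun v : Space l => v.2.2) hr
    simpa [vecA, realPt_apply, eq_comm] using this
  have hA : vecA l ∈ lineA l := Submodule.mem_span_singleton_self _
  refine eq_of_addEquiv ht ht' (φ := φ) (fun x => ?_) (snd_eq_zero ?_) (snd_eq_zero ?_)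
  · rw [intRoots, intRoots, ← realPt_mem_rootsOf, ← realPt_mem_rootsOf, ← hφ]
    change _ ↔ _ ∈ t'.roots l
    rw [← hR, e.injective.mem_set_image]
    rfl
  · rw [← hφ, ← vecA_eq]
    exact hG.subset (Set.mem_image_of_mem e hA)
  · obtain ⟨v, hv, hva⟩ := hG.superset hA
    have hv' : realPt l (φ.symm (0, (1, 0))) = v :=
      e.injective (by rw [hva, hφ, φ.apply_symm_apply, vecA_eq])
    rwa [hv']

end MarkedIso

/-! ### Finite crystallographic sets and half roots -/

section Crystallographic

open scoped InnerProductSpace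

variable {V : Type*} [NormedAddCommGroup V] [InnerProductSpace ℝ V] {Δ : Set V} {α β γ δ : V}

/-- A possibly non-reduced root system in a Euclidean space, without finiteness or spanning: `Δ` is
closed under the reflections in its elements, and the Cartan pairings are integers. -/
structure IsCrystallographic (Δ : Set V) : Prop where
  ne_zero : ∀ α ∈ Δ, α ≠ 0
  exists_sub_smul_mem : ∀ α ∈ Δ, ∀ β ∈ Δ,
    ∃ k : ℤ, 2 * ⟪α, β⟫_ℝ = k * ⟪α, α⟫_ℝ ∧ β - (k : ℝ) • α ∈ Δ

/-- The roots whose double is a root. -/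
def halfRoots (Δ : Set V) : Set V := {α | α ∈ Δ ∧ (2 : ℝ) • α ∈ Δ}

/-- The half roots of the same length as `α₀` that are equal to `α₀` or differ from it by a root;
they are the vectors `±ε_i` of a system of type `BC`. -/
def linkedHalfRoots (Δ : Set V) (α₀ : V) : Set V :=
  {δ | δ ∈ halfRoots Δ ∧ ⟪δ, δ⟫_ℝ = ⟪α₀, α₀⟫_ℝ ∧ (δ = α₀ ∨ α₀ - δ ∈ Δ)}

namespace IsCrystallographic

theorem inner_self_pos (h : IsCrystallographic Δ) (hα : α ∈ Δ) : 0 < ⟪α, α⟫_ℝ :=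
  real_inner_self_pos.2 (h.ne_zero α hα)

theorem sub_smul_mem (h : IsCrystallographic Δ) (hα : α ∈ Δ) (hβ : β ∈ Δ) {k : ℝ}
    (hk : 2 * ⟪α, β⟫_ℝ = k * ⟪α, α⟫_ℝ) : β - k • α ∈ Δ := by
  obtain ⟨k', hk', hmem⟩ := h.exists_sub_smul_mem α hα β hβ
  rwa [mul_right_cancel₀ (h.inner_self_pos hα).ne' (hk.symm.trans hk')]

theorem neg_mem (h : IsCrystallographic Δ) (hα : α ∈ Δ) : -α ∈ Δ := by
  simpa [two_smul] using h.sub_smul_mem hα hα (k := 2) rfl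

theorem exists_inner_eq_of_mem_halfRoots (h : IsCrystallographic Δ) (hα : α ∈ halfRoots Δ)
    (hγ : γ ∈ Δ) : ∃ j : ℤ, ⟪α, γ⟫_ℝ = j * ⟪α, α⟫_ℝ := by
  obtain ⟨j, hj, -⟩ := h.exists_sub_smul_mem _ hα.2 γ hγ
  refine ⟨j, ?_⟩
  simp only [inner_smul_left, inner_smul_right, RCLike.conj_to_real] at hj
  linarith

theorem sub_smul_mem_halfRoots (h : IsCrystallographic Δ) (hα : α ∈ halfRoots Δ) (hγ : γ ∈ Δ)
    {k : ℝ} (hk : 2 * ⟪γ, α⟫_ℝ = k * ⟪γ, γ⟫_ℝ) : α - k • γ ∈ halfRoots Δ := by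
  refine ⟨h.sub_smul_mem hγ hα.1 hk, ?_⟩
  rw [smul_sub, smul_smul]
  refine h.sub_smul_mem hγ hα.2 ?_
  rw [inner_smul_right]
  linarith

theorem inner_eq_zero_or_eq_or_eq_neg (h : IsCrystallographic Δ) (hα : α ∈ halfRoots Δ)
    (hβ : β ∈ halfRoots Δ) : ⟪α, β⟫_ℝ = 0 ∨ β = α ∨ β = -α := by
  refine or_iff_not_imp_left.2 fun h0 => ?_
  obtain ⟨j, hj⟩ := h.exists_inner_eq_of_mem_halfRoots hα hβ.1
  obtain ⟨i, hi⟩ := h.exists_inner_eq_of_mem_halfRoots hβ hα.1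
  rw [real_inner_comm] at hi
  have hαβ := mul_pos (h.inner_self_pos hα.1) (h.inner_self_pos hβ.1)
  have hsq : ⟪α, β⟫_ℝ ^ 2 = ((j * i : ℤ) : ℝ) * (⟪α, α⟫_ℝ * ⟪β, β⟫_ℝ) := by
    push_cast
    linear_combination ⟪α, β⟫_ℝ * hj + j * ⟪α, α⟫_ℝ * hi
  have hpos : 0 < j * i := by
    have : 0 < ⟪α, β⟫_ℝ ^ 2 := by positivity
    rw [hsq] at this
    exact_mod_cast pos_of_mul_pos_left this hαβ.le
  have hle : j * i ≤ 1 := by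
    have := real_inner_mul_inner_self_le α β
    rw [← pow_two, hsq] at this
    exact_mod_cast (mul_le_iff_le_one_left hαβ).1 this
  have hji : j * i = 1 := by omega
  have hβα : β = (j : ℝ) • α := by
    have hji' : (j : ℝ) * i = 1 := by exact_mod_cast hji
    rw [← sub_eq_zero, ← inner_self_eq_zero (𝕜 := ℝ)]
    simp only [inner_sub_left, inner_sub_right, inner_smul_left, inner_smul_right,
      RCLike.conj_to_real, real_inner_comm α β]
    linear_combination (-j : ℝ) * hj - j * hi - ⟪β, β⟫_ℝ * hji'
  rcases Int.eq_one_or_neg_one_of_mul_eq_one hji with rfl | rfl <;> simp [hβα]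

theorem mem_linkedHalfRoots_self (hα : α ∈ halfRoots Δ) : α ∈ linkedHalfRoots Δ α :=
  ⟨hα, rfl, Or.inl rfl⟩

theorem mem_linkedHalfRoots_of_sub_mem (h : IsCrystallographic Δ) (hα : α ∈ halfRoots Δ)
    (hβ : β ∈ linkedHalfRoots Δ α) (hγ : γ ∈ halfRoots Δ) (hβγ : ⟪β, γ⟫_ℝ = 0)
    (hnorm : ⟪γ, γ⟫_ℝ = ⟪β, β⟫_ℝ) (hmem : β - γ ∈ Δ) : γ ∈ linkedHalfRoots Δ α := by
  obtain ⟨hβhalf, hβnorm, hβα⟩ := hβ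
  refine ⟨hγ, hnorm.trans hβnorm, ?_⟩
  rcases h.inner_eq_zero_or_eq_or_eq_neg hα hγ with hαγ | rfl | rfl
  · right
    rcases hβα with rfl | hαβ
    · exact hmem
    rcases h.inner_eq_zero_or_eq_or_eq_neg hα hβhalf with hαβ0 | rfl | rfl
    · have := h.sub_smul_mem hmem hαβ (k := -1) (by
        simp only [inner_sub_left, inner_sub_right, real_inner_comm α β, real_inner_comm α γ,
          real_inner_comm β γ, hαγ, hαβ0, hβγ, hnorm]
        ring)
      simpa using this
    · exact hmem
    · have := h.neg_mem (h.sub_smul_mem hγ.1 hmem (k := -2) (by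
        rw [inner_sub_right, real_inner_comm, hβγ]
        ring))
      convert this using 1
      module
  · exact Or.inl rfl
  · right
    simpa [two_smul] using hα.2

/-- The reflection of `β` in `γ` is again a half root, so it is orthogonal to `β` or equal to
`-β`. -/
theorem mem_span_linkedHalfRoots_of_inner_ne_zero (h : IsCrystallographic Δ)
    (hα : α ∈ halfRoots Δ) (hβ : β ∈ linkedHalfRoots Δ α) (hγ : γ ∈ Δ) (h0 : ⟪β, γ⟫_ℝ ≠ 0) :
    γ ∈ Submodule.span ℝ (linkedHalfRoots Δ α) := by
  obtain ⟨j, hj⟩ := h.exists_inner_eq_of_mem_halfRoots hβ.1 hγ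
  obtain ⟨k, hk, -⟩ := h.exists_sub_smul_mem γ hγ β hβ.1.1
  have hk0 : (k : ℝ) ≠ 0 := fun hk0 => h0 (by rw [real_inner_comm]; simpa [hk0] using hk)
  have hmem : (k : ℝ) • γ ∈ Submodule.span ℝ (linkedHalfRoots Δ α) → γ ∈ _ :=
    (Submodule.smul_mem_iff _ hk0).1
  have hspan := Submodule.subset_span (R := ℝ) hβ
  have hβ' := h.sub_smul_mem_halfRoots hβ.1 hγ hk
  rcases h.inner_eq_zero_or_eq_or_eq_neg hβ.1 hβ' with horth | heq | heq
  · have hkj : k * j = 1 := by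
      rw [inner_sub_right, inner_smul_right, hj] at horth
      have : ((k * j : ℤ) : ℝ) = 1 := by
        push_cast
        exact mul_right_cancel₀ (h.inner_self_pos hβ.1.1).ne' (by linarith)
      exact_mod_cast this
    have hnorm : ⟪β - (k : ℝ) • γ, β - (k : ℝ) • γ⟫_ℝ = ⟪β, β⟫_ℝ := by
      simp only [inner_sub_left, inner_sub_right, inner_smul_left, inner_smul_right,
        RCLike.conj_to_real, real_inner_comm γ β] at hk ⊢
      linear_combination -k * hk
    have hkγ : β - (β - (k : ℝ) • γ) ∈ Δ := by
      rw [sub_sub_cancel]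
      rcases Int.eq_one_or_neg_one_of_mul_eq_one hkj with rfl | rfl
      · simpa using hγ
      · simpa using h.neg_mem hγ
    have hlinked := h.mem_linkedHalfRoots_of_sub_mem hα hβ hβ' horth hnorm hkγ
    refine hmem ?_
    simpa using Submodule.sub_mem _ hspan (Submodule.subset_span (R := ℝ) hlinked)
  · rw [sub_eq_self] at heq
    exact hmem (heq ▸ Submodule.zero_mem _)
  · refine hmem ?_
    rw [show (k : ℝ) • γ = (2 : ℝ) • β by rw [two_smul, ← sub_neg_eq_add, ← heq, sub_sub_cancel]]
    exact Submodule.smul_mem _ _ hspan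

theorem span_linkedHalfRoots_eq_top (h : IsCrystallographic Δ)
    (hirr : ∀ Δ' ⊆ Δ, (∀ α ∈ Δ', ∀ β ∈ Δ \ Δ', ⟪α, β⟫_ℝ = 0) → Δ' = ∅ ∨ Δ' = Δ)
    (hspan : Submodule.span ℝ Δ = ⊤) (hα : α ∈ halfRoots Δ) :
    Submodule.span ℝ (linkedHalfRoots Δ α) = ⊤ := by
  set U := Submodule.span ℝ (linkedHalfRoots Δ α)
  have hUperp : ∀ β ∈ U, ∀ γ ∈ Δ, γ ∉ U → ⟪β, γ⟫_ℝ = 0 := by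
    intro β hβ γ hγ hγU
    suffices U ≤ LinearMap.ker (innerₗ V γ) by
      rw [real_inner_comm]
      exact this hβ
    refine Submodule.span_le.2 fun δ hδ => ?_
    by_contra h0
    exact hγU (h.mem_span_linkedHalfRoots_of_inner_ne_zero hα hδ hγ fun h' =>
      h0 ((real_inner_comm _ _).trans h'))
  rcases hirr (Δ ∩ U) Set.inter_subset_left fun β hβ γ hγ =>
    hUperp β hβ.2 γ hγ.1 fun hγU => hγ.2 ⟨hγ.1, hγU⟩ with hempty | hall
  · exact absurd ⟨hα.1, Submodule.subset_span (mem_linkedHalfRoots_self hα)⟩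
      (Set.eq_empty_iff_forall_notMem.1 hempty α)
  · rw [eq_top_iff, ← hspan, Submodule.span_le]
    exact Set.inter_eq_left.1 hall

end IsCrystallographic

end Crystallographic

/-- The integer vectors of the roots of `BC_l`. -/
def IsBCVec {l : ℕ} (n : Fin l → ℤ) : Prop :=
  n ⬝ᵥ n = 1 ∨ n ⬝ᵥ n = 2 ∨ ∃ m, n = (2 : ℤ) • m ∧ m ⬝ᵥ m = 1

theorem isBCVec_of_forall_dvd {l : ℕ} {n : Fin l → ℤ} (hn : n ≠ 0)
    (h : ∀ i, n ⬝ᵥ n ∣ 2 * n i) : IsBCVec n := by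
  obtain ⟨i, hi⟩ : ∃ i, n i ≠ 0 := Function.ne_iff.1 hn
  have hle : n i * n i ≤ n ⬝ᵥ n :=
    Finset.single_le_sum (f := fun j => n j * n j) (fun j _ => mul_self_nonneg _)
      (Finset.mem_univ i)
  have hpos : 0 < n ⬝ᵥ n := (mul_self_pos.2 hi).trans_le hle
  have hdvd : n ⬝ᵥ n ≤ 2 * |n i| := by
    refine Int.le_of_dvd (mul_pos two_pos (abs_pos.2 hi)) ?_
    simpa [abs_mul] using (dvd_abs _ _).2 (h i)
  have habs : |n i| ≤ 2 := by nlinarith [abs_mul_abs_self (n i), abs_pos.2 hi]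
  obtain h1 | h2 | h3 | h4 : n ⬝ᵥ n = 1 ∨ n ⬝ᵥ n = 2 ∨ n ⬝ᵥ n = 3 ∨ n ⬝ᵥ n = 4 := by
    omega
  · exact Or.inl h1
  · exact Or.inr (Or.inl h2)
  · have := h3 ▸ h i
    rw [abs_le] at habs
    omega
  · have heven : ∀ j, (2 : ℤ) ∣ n j := fun j => by
      have := h4 ▸ h j
      omega
    choose m hm using heven
    obtain rfl : n = (2 : ℤ) • m := funext hm
    refine Or.inr (Or.inr ⟨m, rfl, ?_⟩)
    rw [smul_dotProduct, dotProduct_smul, smul_eq_mul, smul_eq_mul] at h4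
    omega

theorem exists_basis_forall_mem {K V ι : Type*} [DivisionRing K] [AddCommGroup V] [Module K V]
    (e₀ : Module.Basis ι K V) {s : Set V} (hs : Submodule.span K s = ⊤) {α : V} (hα : α ∈ s)
    (hα0 : α ≠ 0) : ∃ (e : Module.Basis ι K V) (i₀ : ι), e i₀ = α ∧ ∀ i, e i ∈ s := by
  have hind : LinearIndepOn K id {α} := LinearIndepOn.singleton hα0
  let b := Module.Basis.extendLe hind (Set.singleton_subset_iff.2 hα) hs.ge
  obtain ⟨j, hj⟩ := Module.Basis.subset_extendLe hind _ hs.ge rfl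
  refine ⟨b.reindex (b.indexEquiv e₀), b.indexEquiv e₀ j, ?_, fun i => ?_⟩
  · simpa only [Module.Basis.reindex_apply, Equiv.symm_apply_apply] using hj
  · rw [Module.Basis.reindex_apply]
    exact Module.Basis.extendLe_subset hind _ hs.ge ⟨_, rfl⟩

section Frame

open scoped InnerProductSpace

variable {V : Type*} [NormedAddCommGroup V] [InnerProductSpace ℝ V] {Δ : Set V} {l : ℕ}
  {e : Module.Basis (Fin l) ℝ V} {i₀ : Fin l}

/-- Coordinates identifying `Δ` with a set of integer vectors of `BC_l`: up to a common factor the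
basis `e` is orthonormal, and the differences `e i₀ - e i` are roots. -/
structure IsFrame (Δ : Set V) (e : Module.Basis (Fin l) ℝ V) (i₀ : Fin l) : Prop where
  inner_apply : ∀ i j, ⟪e i, e j⟫_ℝ = if i = j then ⟪e i₀, e i₀⟫_ℝ else 0
  sub_mem : ∀ i, i ≠ i₀ → e i₀ - e i ∈ Δ
  exists_isBCVec : ∀ γ ∈ Δ, ∃ n : Fin l → ℤ, γ = ∑ i, (n i : ℝ) • e i ∧ IsBCVec n

theorem inner_sum_smul_sum_smul {ι : Type*} [Fintype ι] [DecidableEq ι] {e : ι → V} {N : ℝ}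
    (he : ∀ i j, ⟪e i, e j⟫_ℝ = if i = j then N else 0) (x y : ι → ℝ) :
    ⟪∑ i, x i • e i, ∑ i, y i • e i⟫_ℝ = N * (x ⬝ᵥ y) := by
  simp only [sum_inner, inner_sum, inner_smul_left, inner_smul_right, RCLike.conj_to_real, he,
    mul_ite, mul_zero, Finset.sum_ite_eq', Finset.mem_univ, if_true, dotProduct, Finset.mul_sum]
  exact Finset.sum_congr rfl fun i _ => by ring

/-- If `γ = ∑ n i • e i`, then the Cartan pairing of `e i` with `γ` is `2 * n i / (n ⬝ᵥ n)`. -/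
theorem IsCrystallographic.exists_isBCVec (h : IsCrystallographic Δ) {N : ℝ}
    (he : ∀ i j, ⟪e i, e j⟫_ℝ = if i = j then N else 0) (hmem : ∀ i, e i ∈ halfRoots Δ)
    {γ : V} (hγ : γ ∈ Δ) : ∃ n : Fin l → ℤ, γ = ∑ i, (n i : ℝ) • e i ∧ IsBCVec n := by
  have hinner : ∀ i, ⟪e i, γ⟫_ℝ = e.repr γ i * ⟪e i, e i⟫_ℝ := fun i => by
    conv_lhs => rw [← e.sum_repr γ]
    simp only [inner_sum, inner_smul_right, he, mul_ite, mul_zero, Finset.sum_ite_eq,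
      Finset.mem_univ, if_true]
  have hcoord : ∀ i, ∃ j : ℤ, e.repr γ i = j := fun i => by
    obtain ⟨j, hj⟩ := h.exists_inner_eq_of_mem_halfRoots (hmem i) hγ
    exact ⟨j, mul_right_cancel₀ (h.inner_self_pos (hmem i).1).ne' ((hinner i).symm.trans hj)⟩
  choose n hn using hcoord
  have hsum : γ = ∑ i, (n i : ℝ) • e i := by simp only [← hn, e.sum_repr]
  refine ⟨n, hsum, isBCVec_of_forall_dvd ?_ fun i => ?_⟩
  · rintro rfl
    exact h.ne_zero γ hγ (by simpa using hsum)
  · obtain ⟨k, hk, -⟩ := h.exists_sub_smul_mem γ hγ (e i) (hmem i).1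
    have hN : N ≠ 0 := by simpa only [he, if_true] using (h.inner_self_pos (hmem i).1).ne'
    have hself := inner_sum_smul_sum_smul he (fun i => (n i : ℝ)) fun i => (n i : ℝ)
    rw [← hsum] at hself
    rw [real_inner_comm, hinner, hself, hn, he, if_pos rfl] at hk
    refine ⟨k, ?_⟩
    have : (2 * n i : ℝ) = ((n ⬝ᵥ n : ℤ) : ℝ) * k := by
      rw [← mul_left_inj' hN]
      simp only [dotProduct, Int.cast_sum, Int.cast_mul] at hk ⊢
      linarith
    exact_mod_cast this

theorem IsCrystallographic.exists_isFrame (h : IsCrystallographic Δ)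
    (hirr : ∀ Δ' ⊆ Δ, (∀ α ∈ Δ', ∀ β ∈ Δ \ Δ', ⟪α, β⟫_ℝ = 0) → Δ' = ∅ ∨ Δ' = Δ)
    (hspan : Submodule.span ℝ Δ = ⊤) (e₀ : Module.Basis (Fin l) ℝ V) {α : V}
    (hα : α ∈ halfRoots Δ) :
    ∃ (e : Module.Basis (Fin l) ℝ V) (i₀ : Fin l), e i₀ = α ∧ IsFrame Δ e i₀ := by
  obtain ⟨e, i₀, rfl, he⟩ := exists_basis_forall_mem e₀
    (h.span_linkedHalfRoots_eq_top hirr hspan hα) (mem_linkedHalfRoots_self hα)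
    (h.ne_zero _ hα.1)
  have hinner : ∀ i j, ⟪e i, e j⟫_ℝ = if i = j then ⟪e i₀, e i₀⟫_ℝ else 0 := by
    intro i j
    split_ifs with hij
    · exact hij ▸ (he i).2.1
    rcases h.inner_eq_zero_or_eq_or_eq_neg (he i).1 (he j).1 with h0 | heq | heq
    · exact h0
    · exact absurd (e.injective heq).symm hij
    · have := congrArg (fun v => e.repr v j) heq
      simp [hij] at this
  refine ⟨e, i₀, rfl, hinner, fun i hi => ?_,
    fun γ hγ => h.exists_isBCVec hinner (fun i => (he i).1) hγ⟩
  exact (he i).2.2.resolve_left fun heq => hi (e.injective heq)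

end Frame

/-! ### Translation sets of a root system that contains a frame -/

/-- A root system of type `BC` in integer coordinates, with translations in `A`, that contains the
vectors `ε_{i₀}`, `2 ε_{i₀}` and `ε_{i₀} - ε_i` with translation `0`. -/
structure IsFramed {A : Type*} [AddCommGroup A] {l : ℕ} (D : Set ((Fin l → ℤ) × A))
    (i₀ : Fin l) : Prop where
  isBCVec : ∀ x ∈ D, IsBCVec x.1
  exists_sub_smul_mem : ∀ x ∈ D, ∀ y ∈ D,
    ∃ k : ℤ, 2 * (x.1 ⬝ᵥ y.1) = k * (x.1 ⬝ᵥ x.1) ∧ y - k • x ∈ D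
  short_mem : (Pi.single i₀ 1, 0) ∈ D
  long_mem : ((2 : ℤ) • Pi.single i₀ 1, 0) ∈ D
  middle_mem : ∀ i, i ≠ i₀ → (Pi.single i₀ 1 - Pi.single i 1, 0) ∈ D

theorem IsBCVec.dotProduct_self_pos {l : ℕ} {n : Fin l → ℤ} (h : IsBCVec n) : 0 < n ⬝ᵥ n := by
  rcases h with h | h | ⟨m, rfl, h⟩
  · omega
  · omega
  · simp [h, -zsmul_eq_mul]

theorem dotProduct_single_self {l : ℕ} (i : Fin l) :
    (Pi.single i 1 : Fin l → ℤ) ⬝ᵥ Pi.single i 1 = 1 := by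
  simp

theorem dotProduct_two_smul_self {l : ℕ} {n : Fin l → ℤ} (hn : n ⬝ᵥ n = 1) :
    ((2 : ℤ) • n) ⬝ᵥ ((2 : ℤ) • n) = 4 := by
  simp [hn, -zsmul_eq_mul]

theorem dotProduct_single_sub_single_self {l : ℕ} {i j : Fin l} (hij : i ≠ j) :
    (Pi.single i 1 - Pi.single j 1 : Fin l → ℤ) ⬝ᵥ (Pi.single i 1 - Pi.single j 1) = 2 := by
  simp [hij, hij.symm]

theorem isBCVec_single {l : ℕ} (i : Fin l) : IsBCVec (Pi.single i 1) :=
  Or.inl (dotProduct_single_self i)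

theorem isBCVec_two_smul_single {l : ℕ} (i : Fin l) : IsBCVec ((2 : ℤ) • Pi.single i 1) :=
  Or.inr (Or.inr ⟨_, rfl, dotProduct_single_self i⟩)

theorem isBCVec_single_sub_single {l : ℕ} {i j : Fin l} (hij : i ≠ j) :
    IsBCVec (Pi.single i 1 - Pi.single j 1) :=
  Or.inr (Or.inl (dotProduct_single_sub_single_self hij))

/-- The translations of the roots over `n`. -/
def fiber {A : Type*} {l : ℕ} (D : Set ((Fin l → ℤ) × A)) (n : Fin l → ℤ) : Set A :=
  {q | (n, q) ∈ D}

/-- The translations of the roots of square length `N`. -/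
def translations {A : Type*} {l : ℕ} (D : Set ((Fin l → ℤ) × A)) (N : ℤ) : Set A :=
  {q | ∃ n, n ⬝ᵥ n = N ∧ (n, q) ∈ D}

theorem exists_ne_of_mem_translations_two {A : Type*} {l : ℕ} {D : Set ((Fin l → ℤ) × A)} {q : A}
    (hq : q ∈ translations D 2) : ∃ i j : Fin l, i ≠ j :=
  let ⟨_, hn, _⟩ := hq
  let ⟨i, j, hij, _⟩ := exists_eq_add_single_of_dotProduct_self_eq_two hn
  ⟨i, j, hij.ne⟩

namespace IsFramed

variable {A : Type*} [AddCommGroup A] {l : ℕ} {D : Set ((Fin l → ℤ) × A)} {i₀ : Fin l}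

theorem sub_smul_mem (h : IsFramed D i₀) {n m : Fin l → ℤ} {p q : A} (hn : (n, p) ∈ D)
    (hm : (m, q) ∈ D) {k : ℤ} (hk : 2 * (n ⬝ᵥ m) = k * (n ⬝ᵥ n)) :
    (m - k • n, q - k • p) ∈ D := by
  obtain ⟨k', hk', hD⟩ := h.exists_sub_smul_mem _ hn _ hm
  rwa [mul_right_cancel₀ (h.isBCVec _ hn).dotProduct_self_pos.ne' (hk.symm.trans hk')]

theorem neg_mem (h : IsFramed D i₀) {n : Fin l → ℤ} {p : A} (hn : (n, p) ∈ D) :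
    (-n, -p) ∈ D := by
  simpa only [two_smul, sub_add_cancel_left] using h.sub_smul_mem hn hn (k := 2) rfl

theorem fiber_sub_smul (h : IsFramed D i₀) {r n : Fin l → ℤ} (hr : (r, 0) ∈ D) {k : ℤ}
    (hk : 2 * (r ⬝ᵥ n) = k * (r ⬝ᵥ r)) : fiber D (n - k • r) = fiber D n := by
  ext q
  constructor <;> intro hq
  · have := h.sub_smul_mem hr hq (k := -k) (by
      rw [dotProduct_sub, dotProduct_smul, smul_eq_mul]
      linear_combination hk)
    rwa [neg_smul, sub_neg_eq_add, sub_add_cancel, smul_zero, sub_zero] at this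
  · have := h.sub_smul_mem hr hq hk
    rwa [smul_zero, sub_zero] at this

theorem single_sub_single_mem (h : IsFramed D i₀) {i j : Fin l} (hij : i ≠ j) :
    (Pi.single i 1 - Pi.single j 1, 0) ∈ D := by
  rcases eq_or_ne i i₀ with rfl | hi
  · exact h.middle_mem j hij.symm
  rcases eq_or_ne j i₀ with rfl | hj
  · simpa using h.neg_mem (h.middle_mem i hij)
  · simpa using h.sub_smul_mem (h.middle_mem i hi) (h.middle_mem j hj) (k := 1)
      (by simp [hi, hj, hi.symm, hij.symm])

theorem fiber_comp_perm (h : IsFramed D i₀) (n : Fin l → ℤ) (σ : Equiv.Perm (Fin l)) :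
    fiber D (n ∘ σ) = fiber D n := by
  induction σ using Equiv.Perm.swap_induction_on' with
  | one => rfl
  | mul_swap σ i j hij ih =>
    rw [← ih, ← h.fiber_sub_smul (n := n ∘ σ) (h.single_sub_single_mem hij)
      (k := n (σ i) - n (σ j)) (by simp [hij, hij.symm, mul_comm])]
    congr 1
    ext a
    rcases eq_or_ne a i with rfl | hai
    · simp [hij]
    rcases eq_or_ne a j with rfl | haj
    · simp [hij.symm]
    · simp [hai, haj, Equiv.swap_apply_of_ne_of_ne]

theorem fiber_single (h : IsFramed D i₀) (i j : Fin l) (c : ℤ) :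
    fiber D (Pi.single i c) = fiber D (Pi.single j c) := by
  rw [← h.fiber_comp_perm _ (Equiv.swap i j)]
  congr 1
  ext a
  simp [Pi.single_apply, Equiv.swap_apply_eq_iff]

theorem fiber_sub_two_mul_smul_single (h : IsFramed D i₀) (n : Fin l → ℤ) (i : Fin l) :
    fiber D (n - (2 * n i) • Pi.single i 1) = fiber D n := by
  have hi : (Pi.single i 1, (0 : A)) ∈ D := (h.fiber_single i₀ i 1).subset h.short_mem
  exact h.fiber_sub_smul hi (by simp)

theorem fiber_smul_of_dotProduct_self_eq_one (h : IsFramed D i₀) (c : ℤ) {n : Fin l → ℤ}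
    (hn : n ⬝ᵥ n = 1) : fiber D (c • n) = fiber D (Pi.single i₀ c) := by
  obtain ⟨i, rfl | rfl⟩ := exists_eq_single_of_dotProduct_self_eq_one hn
  · rw [← h.fiber_single i, ← Pi.single_smul', smul_eq_mul, mul_one]
  · rw [← h.fiber_single i, ← h.fiber_sub_two_mul_smul_single (Pi.single i c) i]
    congr 1
    rw [Pi.single_eq_same, ← Pi.single_smul', ← Pi.single_sub, ← Pi.single_neg, ← Pi.single_smul']
    congr 1
    simp only [smul_eq_mul]
    ring

theorem exists_fiber_eq_of_dotProduct_self_eq_two (h : IsFramed D i₀) {n : Fin l → ℤ}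
    (hn : n ⬝ᵥ n = 2) :
    ∃ i j, i ≠ j ∧ fiber D n = fiber D (Pi.single i 1 + Pi.single j 1) := by
  have hflip : ∀ (i : Fin l) (v : Fin l → ℤ), v i = 0 →
      fiber D (v - Pi.single i 1) = fiber D (v + Pi.single i 1) := by
    intro i v hv
    rw [← h.fiber_sub_two_mul_smul_single _ i, Pi.sub_apply, hv, Pi.single_eq_same]
    congr 1
    module
  obtain ⟨i, j, hij, rfl | rfl | rfl | rfl⟩ := exists_eq_add_single_of_dotProduct_self_eq_two hn
  all_goals refine ⟨i, j, hij.ne, ?_⟩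
  · rfl
  · rw [neg_add', hflip j _ (by simp [hij.ne']), neg_add_eq_sub, hflip i _ (by simp [hij.ne]),
      add_comm]
  · rw [hflip j _ (by simp [hij.ne'])]
  · rw [neg_sub, hflip i _ (by simp [hij.ne]), add_comm]

theorem fiber_eq_of_dotProduct_self_eq_two (h : IsFramed D i₀) {n m : Fin l → ℤ}
    (hn : n ⬝ᵥ n = 2) (hm : m ⬝ᵥ m = 2) : fiber D n = fiber D m := by
  obtain ⟨i, j, hij, hni⟩ := h.exists_fiber_eq_of_dotProduct_self_eq_two hn
  obtain ⟨i', j', hij', hmi⟩ := h.exists_fiber_eq_of_dotProduct_self_eq_two hm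
  obtain ⟨σ, rfl, rfl⟩ := MulAction.is_two_pretransitive_iff.1
    (Equiv.Perm.isMultiplyPretransitive (Fin l) 2) hij' hij
  rw [hni, hmi, ← h.fiber_comp_perm _ σ]
  congr 1
  ext a
  simp [Pi.single_apply]

theorem fiber_eq (h : IsFramed D i₀) {n m : Fin l → ℤ} (hn : IsBCVec n) (hm : IsBCVec m)
    (hnm : n ⬝ᵥ n = m ⬝ᵥ m) : fiber D n = fiber D m := by
  have hone : ∀ n : Fin l → ℤ, n ⬝ᵥ n = 1 → fiber D n = fiber D (Pi.single i₀ 1) :=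
    fun n hn => by simpa only [one_smul] using h.fiber_smul_of_dotProduct_self_eq_one 1 hn
  rcases hn with hn | hn | ⟨n, rfl, hn⟩ <;> rcases hm with hm | hm | ⟨m, rfl, hm⟩ <;>
    simp only [smul_dotProduct, dotProduct_smul, hn, hm] at hnm <;> norm_num at hnm
  · rw [hone n hn, hone m hm]
  · exact h.fiber_eq_of_dotProduct_self_eq_two hn hm
  · rw [h.fiber_smul_of_dotProduct_self_eq_one 2 hn, h.fiber_smul_of_dotProduct_self_eq_one 2 hm]

theorem translations_eq_fiber (h : IsFramed D i₀) {n : Fin l → ℤ} (hn : IsBCVec n) :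
    translations D (n ⬝ᵥ n) = fiber D n := by
  ext q
  exact ⟨fun ⟨m, hm, hq⟩ => (h.fiber_eq (h.isBCVec _ hq) hn hm).subset hq, fun hq => ⟨n, rfl, hq⟩⟩

theorem sub_smul_mem_translations (h : IsFramed D i₀) {n m : Fin l → ℤ} {N M : ℤ}
    (hn : IsBCVec n) (hm : IsBCVec m) (hnN : n ⬝ᵥ n = N) (hmM : m ⬝ᵥ m = M) {k : ℤ}
    (hk : 2 * (n ⬝ᵥ m) = k * N) :
    ∀ p ∈ translations D N, ∀ q ∈ translations D M, q - k • p ∈ translations D M := by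
  subst hnN hmM
  intro p hp q hq
  rw [h.translations_eq_fiber hn] at hp
  rw [h.translations_eq_fiber hm] at hq
  exact ⟨_, dotProduct_self_sub_smul hk, h.sub_smul_mem hp hq hk⟩

theorem neg_mem_translations (h : IsFramed D i₀) {N : ℤ} {q : A} (hq : q ∈ translations D N) :
    -q ∈ translations D N := by
  obtain ⟨n, hn, hq⟩ := hq
  exact ⟨-n, by simpa using hn, h.neg_mem hq⟩

theorem eq_intRoots (h : IsFramed D i₀) :
    D = intRoots l (translations D 1) (translations D 2) (translations D 4) := by
  ext ⟨n, q⟩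
  constructor
  · intro hq
    rcases h.isBCVec _ hq with hn | hn | ⟨m, rfl, hm⟩
    · exact Or.inl ⟨hn, n, hn, hq⟩
    · exact Or.inr (Or.inl ⟨hn, n, hn, hq⟩)
    · exact Or.inr (Or.inr ⟨m, rfl, hm, _, dotProduct_two_smul_self hm, hq⟩)
  · rintro (⟨hn, hq⟩ | ⟨hn, hq⟩ | ⟨m, rfl, hm, hq⟩)
    · rwa [← hn, h.translations_eq_fiber (Or.inl hn)] at hq
    · rwa [← hn, h.translations_eq_fiber (Or.inr (Or.inl hn))] at hq
    · rwa [← dotProduct_two_smul_self hm,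
        h.translations_eq_fiber (Or.inr (Or.inr ⟨m, rfl, hm⟩))] at hq

theorem reflClosed (h : IsFramed D i₀) :
    ReflClosed l (translations D 1) (translations D 2) (translations D 4) := by
  have norm1 := @dotProduct_single_self l
  have norm4 := fun i => dotProduct_two_smul_self (norm1 i)
  have norm2 := @dotProduct_single_sub_single_self l
  have short := @isBCVec_single l
  have long := @isBCVec_two_smul_single l
  have middle := @isBCVec_single_sub_single l
  exact
    { neg_short := fun _ => h.neg_mem_translations
      neg_middle := fun _ => h.neg_mem_translations
      neg_long := fun _ => h.neg_mem_translations
      short_short := h.sub_smul_mem_translations (short i₀) (short i₀) (norm1 _) (norm1 _) (by simp)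
      short_middle := fun x hx y hy => by
        obtain ⟨i, j, hij⟩ := exists_ne_of_mem_translations_two hy
        exact h.sub_smul_mem_translations (short i) (middle hij) (norm1 _) (norm2 hij)
          (by simp [hij]) x hx y hy
      short_long := h.sub_smul_mem_translations (short i₀) (long i₀) (norm1 _) (norm4 _)
        (by simp [-zsmul_eq_mul])
      middle_short := fun x hx y hy => by
        obtain ⟨i, j, hij⟩ := exists_ne_of_mem_translations_two hx
        simpa only [one_smul] using h.sub_smul_mem_translations (middle hij) (short i) (norm2 hij)
          (norm1 _) (k := 1) (by simp [hij]) x hx y hy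
      middle_middle := fun x hx y hy => by
        obtain ⟨i, j, hij⟩ := exists_ne_of_mem_translations_two hx
        exact h.sub_smul_mem_translations (middle hij) (middle hij) (norm2 hij) (norm2 hij)
          (by rw [norm2 hij]) x hx y hy
      middle_middle_sub := fun hl x hx y hy => by
        obtain ⟨i, j, k, hij, hik, hjk⟩ : ∃ i j k : Fin l, i ≠ j ∧ i ≠ k ∧ j ≠ k :=
          ⟨⟨0, by omega⟩, ⟨1, by omega⟩, ⟨2, by omega⟩, by simp, by simp, by simp⟩
        simpa only [one_smul] using h.sub_smul_mem_translations (middle hij) (middle hik)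
          (norm2 hij) (norm2 hik) (k := 1) (by simp [hij, hik.symm, hjk.symm]) x hx y hy
      middle_long := fun x hx y hy => by
        obtain ⟨i, j, hij⟩ := exists_ne_of_mem_translations_two hx
        exact h.sub_smul_mem_translations (middle hij) (long i) (norm2 hij) (norm4 _)
          (by simp [hij, -zsmul_eq_mul]) x hx y hy
      long_short := by
        simpa only [one_smul] using h.sub_smul_mem_translations (long i₀) (short i₀) (norm4 _)
          (norm1 _) (k := 1) (by simp [-zsmul_eq_mul])
      long_middle := fun x hx y hy => by
        obtain ⟨i, j, hij⟩ := exists_ne_of_mem_translations_two hy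
        simpa only [one_smul] using h.sub_smul_mem_translations (long i) (middle hij) (norm4 _)
          (norm2 hij) (k := 1) (by simp [hij, -zsmul_eq_mul]) x hx y hy
      long_long := h.sub_smul_mem_translations (long i₀) (long i₀) (norm4 _) (norm4 _)
        (by simp [-zsmul_eq_mul]) }

theorem zero_mem_translations_one (h : IsFramed D i₀) : 0 ∈ translations D 1 :=
  ⟨_, by simp, h.short_mem⟩

theorem zero_mem_translations_four (h : IsFramed D i₀) : 0 ∈ translations D 4 :=
  ⟨_, by simp [-zsmul_eq_mul], h.long_mem⟩

theorem zero_mem_translations_two (h : IsFramed D i₀) (hl : 2 ≤ l) : 0 ∈ translations D 2 :=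
  have hij : (⟨0, by omega⟩ : Fin l) ≠ ⟨1, by omega⟩ := by simp
  ⟨_, dotProduct_single_sub_single_self hij, h.single_sub_single_mem hij⟩

theorem closure_translations_one (h : IsFramed D i₀) (hD : AddSubgroup.closure D = ⊤) :
    AddSubgroup.closure (translations D 1) = ⊤ := by
  have hr := h.reflClosed
  have h0 := h.zero_mem_translations_one
  have hle : AddSubgroup.closure D ≤
      (AddSubgroup.closure (translations D 1)).comap (AddMonoidHom.snd (Fin l → ℤ) A) := by
    rw [AddSubgroup.closure_le]
    intro x hx
    refine AddSubgroup.subset_closure (k := translations D 1) ?_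
    rw [h.eq_intRoots] at hx
    rcases hx with ⟨-, hq⟩ | ⟨-, hq⟩ | ⟨-, -, -, hq⟩
    · exact hq
    · simpa using hr.neg_short _ (hr.middle_short _ hq 0 h0)
    · simpa using hr.neg_short _ (hr.long_short _ hq 0 h0)
  exact eq_top_iff.2 fun z _ => hle (x := (0, z)) (hD ▸ AddSubgroup.mem_top _)

theorem exists_frameChange {D : Set ((Fin l → ℤ) × (ℤ × ℤ))} (h : IsFramed D i₀)
    (hD : AddSubgroup.closure D = ⊤) :
    ∃ (t : EllipticType) (k : ℤ) (ξ : Fin l → ℤ × ℤ), t.Admissible l ∧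
      FrameChange l k ξ (translations D 1) (translations D 2) (translations D 4)
        t.shortSet t.middleSet t.longSet := by
  have hgen := h.closure_translations_one hD
  rcases Nat.lt_or_ge l 2 with hl | hl
  · obtain rfl : l = 1 := by
      have := i₀.2
      omega
    exact exists_frameChange_one h.reflClosed h.zero_mem_translations_one
      h.zero_mem_translations_four hgen
  · exact MERS.exists_frameChange hl h.reflClosed h.zero_mem_translations_one
      (h.zero_mem_translations_two hl) h.zero_mem_translations_four hgen

theorem exists_type {D : Set ((Fin l → ℤ) × (ℤ × ℤ))} (h : IsFramed D i₀)
    (hD : AddSubgroup.closure D = ⊤) :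
    ∃ t : EllipticType, t.Admissible l ∧
      MarkedSimilar (form l) (realPt l '' D) (lineA l) (form l) (t.roots l) (lineA l) := by
  obtain ⟨t, k, ξ, ht, hξ⟩ := h.exists_frameChange hD
  refine ⟨t, ht, ?_⟩
  have := hξ.markedSimilar h.reflClosed ht.reflClosed
  rwa [rootsOf_eq, ← h.eq_intRoots] at this

end IsFramed

/-! ### Adapted bases -/

theorem exists_basis_smul_eq {A M ι : Type*} [CommRing A] [IsDomain A] [IsPrincipalIdealRing A]
    [AddCommGroup M] [Module A M] [Finite ι] (b : Module.Basis ι A M) {x : M} (hx : x ≠ 0)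
    (i : ι) : ∃ (b' : Module.Basis ι A M) (c : A), x = c • b' i := by
  classical
  have := b.isTorsionFree
  obtain ⟨n, snf⟩ := Submodule.smithNormalForm b (Submodule.span A {x})
  have hn : n = 1 := by
    rw [← Fintype.card_fin n, ← Module.finrank_eq_card_basis snf.bN,
      ← (LinearEquiv.toSpanNonzeroSingleton A M x hx).finrank_eq, Module.finrank_self]
  subst hn
  let y : Submodule.span A {x} := ⟨x, Submodule.mem_span_singleton_self x⟩
  have hy : snf.bN.repr y 0 • snf.a 0 • snf.bM (snf.f 0) = x := by
    rw [← snf.snf, ← Submodule.coe_smul]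
    simpa only [Fin.sum_univ_one] using congrArg Subtype.val (snf.bN.sum_repr y)
  refine ⟨snf.bM.reindex (Equiv.swap (snf.f 0) i), snf.bN.repr y 0 * snf.a 0, ?_⟩
  rw [Module.Basis.reindex_apply, Equiv.symm_swap, Equiv.swap_apply_right, mul_smul, hy]

section

variable {F : Type*} [NormedAddCommGroup F] [NormedSpace ℝ F]

theorem HasSignature.finiteDimensional {I : LinearMap.BilinForm ℝ F} {m z n : ℕ}
    (h : HasSignature I m z n) : FiniteDimensional ℝ F :=
  let ⟨b, _⟩ := h; b.finiteDimensional_of_finite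

theorem HasSignature.finrank_eq {I : LinearMap.BilinForm ℝ F} {m z n : ℕ}
    (h : HasSignature I m z n) : Module.finrank ℝ F = m + (z + n) := by
  obtain ⟨b, _⟩ := h
  simp [Module.finrank_eq_card_basis b]

theorem HasSignature.exists_projection {I : LinearMap.BilinForm ℝ F} {m z : ℕ}
    (h : HasSignature I m z 0) :
    ∃ p : F →ₗ[ℝ] EuclideanSpace ℝ (Fin m), Function.Surjective p ∧
      ∀ x y, I x y = inner ℝ (p x) (p y) := by
  classical
  obtain ⟨b, hoff, hone, hzero, -⟩ := h
  let v : Fin m ⊕ Fin z ⊕ Fin 0 → EuclideanSpace ℝ (Fin m) :=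
    Sum.elim (EuclideanSpace.basisFun (Fin m) ℝ) 0
  let p := b.constr ℝ v
  have hp : ∀ k, p (b k) = v k := b.constr_basis ℝ v
  refine ⟨p, ?_, fun x y => ?_⟩
  · rw [← LinearMap.range_eq_top, eq_top_iff,
      ← (EuclideanSpace.basisFun (Fin m) ℝ).toBasis.span_eq, Submodule.span_le]
    rintro _ ⟨i, rfl⟩
    exact ⟨b (.inl i), by simp [hp, v]⟩
  · suffices I = (innerₗ _).compl₁₂ p p from LinearMap.congr_fun₂ this x y
    refine LinearMap.BilinForm.ext_basis b fun j k => ?_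
    rw [LinearMap.compl₁₂_apply, hp, hp, innerₗ_apply_apply]
    rcases eq_or_ne j k with rfl | hjk
    · rcases j with i | i | i
      · simpa [v] using hone i
      · simpa [v] using hzero i
      · exact i.elim0
    · rw [hoff j k hjk]
      rcases j with i | i <;> rcases k with j | j
      · simpa [v, PiLp.inner_apply] using fun h => hjk (congrArg _ h)
      all_goals simp [v]

end

theorem span_range_sumElim_eq_top {A M V ι κ : Type*} [Ring A] [AddCommGroup M] [Module A M]
    [AddCommGroup V] [Module A V] (q : M →ₗ[A] V) {f : ι → M} {b : κ → LinearMap.ker q}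
    (hf : LinearMap.range q ≤ Submodule.span A (Set.range (q ∘ f)))
    (hb : Submodule.span A (Set.range b) = ⊤) :
    Submodule.span A (Set.range (Sum.elim f fun j => (b j : M))) = ⊤ := by
  have hker : Submodule.span A (Set.range fun j => (b j : M)) = LinearMap.ker q := by
    have := congrArg (Submodule.map (LinearMap.ker q).subtype) hb
    rwa [Submodule.map_subtype_top, Submodule.map_span, ← Set.range_comp] at this
  rw [Set.Sum.elim_range, Submodule.span_union, hker, ← Submodule.comap_map_eq,
    Submodule.map_span, ← Set.range_comp]
  exact eq_top_iff.2 fun x _ => hf (LinearMap.mem_range_self q x)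

theorem exists_basis_sum_fin {F V ι : Type*} [NormedAddCommGroup F] [NormedSpace ℝ F]
    [FiniteDimensional ℝ F] [AddCommGroup V] [Module ℝ V] [Fintype ι] {d : ℕ}
    (hd : Module.finrank ℝ F = Fintype.card ι + d) (Q : Submodule ℤ F) [DiscreteTopology Q]
    [IsZLattice ℝ Q] (p : F →ₗ[ℝ] V) (e : Module.Basis ι ℝ V)
    (hp : ∀ x ∈ Q, p x ∈ Submodule.span ℤ (Set.range e)) {f : ι → F} (hfQ : ∀ i, f i ∈ Q)
    (hf : ∀ i, p (f i) = e i) {x₀ : F} (hx₀Q : x₀ ∈ Q) (hx₀ : x₀ ≠ 0) (hpx₀ : p x₀ = 0)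
    (j₀ : Fin d) :
    ∃ B : Module.Basis (ι ⊕ Fin d) ℝ F, Submodule.span ℤ (Set.range B) = Q ∧
      (∀ i, B (.inl i) = f i) ∧ (∀ j, p (B (.inr j)) = 0) ∧ ∃ c : ℤ, x₀ = c • B (.inr j₀) := by
  let q : Q →ₗ[ℤ] V := p.restrictScalars ℤ ∘ₗ Q.subtype
  let f' : ι → Q := fun i => ⟨f i, hfQ i⟩
  have hqf : q ∘ f' = e := funext hf
  have hrange : LinearMap.range q = Submodule.span ℤ (Set.range e) := by
    refine le_antisymm ?_ (Submodule.span_le.2 ?_)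
    · rintro _ ⟨x, rfl⟩
      exact hp x x.2
    · rw [← hqf, Set.range_comp]
      exact Set.image_subset_range _ _
  have hker : Module.finrank ℤ (LinearMap.ker q) = d := by
    have := Submodule.finrank_quotient_add_finrank (LinearMap.ker q)
    rw [q.quotKerEquivRange.finrank_eq, hrange,
      finrank_span_eq_card (e.linearIndependent.restrict_scalars' ℤ), ZLattice.rank ℝ Q, hd] at this
    omega
  obtain ⟨b, c, hc⟩ := exists_basis_smul_eq (Module.finBasisOfFinrankEq ℤ _ hker)
    (x := ⟨⟨x₀, hx₀Q⟩, hpx₀⟩) (by simpa [← Subtype.coe_ne_coe] using hx₀) j₀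
  let g : ι ⊕ Fin d → F := Q.subtype ∘ Sum.elim f' fun j => (b j : Q)
  have hg : Submodule.span ℤ (Set.range g) = Q := by
    rw [Set.range_comp, ← Submodule.map_span,
      span_range_sumElim_eq_top q (by rw [hqf, hrange]) b.span_eq, Submodule.map_subtype_top]
  have hgF : Submodule.span ℝ (Set.range g) = ⊤ := by
    rw [← Submodule.span_span_of_tower ℤ ℝ (Set.range g), hg, IsZLattice.span_top]
  let B := basisOfTopLeSpanOfCardEqFinrank g hgF.ge (by simp [hd])
  have hB : ⇑B = g := coe_basisOfTopLeSpanOfCardEqFinrank ..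
  refine ⟨B, by rw [hB, hg], fun i => by rw [hB]; rfl, fun j => ?_, c, ?_⟩
  · rw [hB]
    exact (b j).2
  · rw [hB]
    simpa [g] using congrArg (fun x : LinearMap.ker q => ((x : Q) : F)) hc

/-! ### Coordinates on a non-reduced root system -/

section MarkedIso

variable {F F' F'' : Type*} [NormedAddCommGroup F] [NormedSpace ℝ F] [NormedAddCommGroup F']
  [NormedSpace ℝ F'] [NormedAddCommGroup F''] [NormedSpace ℝ F''] {I : LinearMap.BilinForm ℝ F}
  {R : Set F} {G : Submodule ℝ F} {I' : LinearMap.BilinForm ℝ F'} {R' : Set F'}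
  {G' : Submodule ℝ F'} {I'' : LinearMap.BilinForm ℝ F''} {R'' : Set F''} {G'' : Submodule ℝ F''}

theorem MarkedSimilar.trans (h : MarkedSimilar I R G I' R' G')
    (h' : MarkedSimilar I' R' G' I'' R'' G'') : MarkedSimilar I R G I'' R'' G'' := by
  obtain ⟨e, rfl, hG, c, hc, hI⟩ := h
  obtain ⟨e', rfl, hG', c', hc', hI'⟩ := h'
  refine ⟨e.trans e', Set.image_comp e' e R, ?_, c' * c, mul_pos hc' hc, fun x y => ?_⟩
  · rw [← hG', ← hG]
    exact Set.image_comp e' e G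
  · rw [LinearEquiv.trans_apply, LinearEquiv.trans_apply, hI', hI, mul_assoc]

theorem MarkedSimilar.symm (h : MarkedSimilar I R G I' R' G') : MarkedSimilar I' R' G' I R G := by
  obtain ⟨e, rfl, hG, c, hc, hI⟩ := h
  refine ⟨e.symm, e.symm_image_image R, ?_, c⁻¹, inv_pos.2 hc, fun x y => ?_⟩
  · rw [← hG]
    exact e.symm_image_image G
  · rw [eq_inv_mul_iff_mul_eq₀ hc.ne', ← hI, e.apply_symm_apply, e.apply_symm_apply]

theorem MarkedSimilar.markedIso (h : MarkedSimilar I R G I' R' G') : MarkedIso R G R' G' :=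
  let ⟨e, hR, hG, _⟩ := h; ⟨e, hR, hG⟩

theorem MarkedIso.symm (h : MarkedIso R G R' G') : MarkedIso R' G' R G := by
  obtain ⟨e, rfl, hG⟩ := h
  refine ⟨e.symm, e.symm_image_image R, ?_⟩
  rw [← hG]
  exact e.symm_image_image G

theorem MarkedIso.trans (h : MarkedIso R G R' G') (h' : MarkedIso R' G' R'' G'') :
    MarkedIso R G R'' G'' := by
  obtain ⟨e, rfl, hG⟩ := h
  obtain ⟨e', rfl, hG'⟩ := h'
  refine ⟨e.trans e', Set.image_comp e' e R, ?_⟩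
  rw [← hG', ← hG]
  exact Set.image_comp e' e G

theorem MarkedIso.exists_quotient (h : MarkedIso R G R' G') :
    ∃ e : (F ⧸ G) ≃ₗ[ℝ] (F' ⧸ G'), e '' quotientRoots R G = quotientRoots R' G' := by
  obtain ⟨e, rfl, hG⟩ := h
  have hG' : G.map (e : F →ₗ[ℝ] F') = G' := SetLike.coe_injective (by simpa using hG)
  refine ⟨Submodule.Quotient.equiv G G' e hG', ?_⟩
  rw [quotientRoots, quotientRoots, Set.image_image, Set.image_image]
  rfl

end MarkedIso

section

variable {F : Type*} [NormedAddCommGroup F] [NormedSpace ℝ F] {I : LinearMap.BilinForm ℝ F}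
  {R : Set F} {G : Submodule ℝ F}

theorem exists_two_smul_mem_of_not_isReduced (h : ¬ IsReduced R) : ∃ α ∈ R, (2 : ℝ) • α ∈ R := by
  simp only [IsReduced, not_forall, not_and_or, not_not] at h
  obtain ⟨α, hα, h | h⟩ := h
  · exact ⟨α, hα, h⟩
  · exact ⟨_, h, by simpa [smul_smul] using hα⟩

theorem IsMarking.exists_mem_rootLattice (h : IsMarking I R G) :
    ∃ x ∈ G, x ∈ rootLattice R ∧ x ≠ 0 := by
  by_contra! hcon
  have hbot : G = ⊥ := by
    rw [← h.full, Submodule.span_eq_bot]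
    exact fun x hx => hcon x hx.1 hx.2
  have := h.finrank_eq
  rw [hbot, finrank_bot] at this
  exact zero_ne_one this

namespace IsGeneralizedRootSystem

theorem exists_sub_smul_mem (h : IsGeneralizedRootSystem I R) (hI : ∀ x y, I x y = I y x) {α β : F}
    (hα : α ∈ R) (hβ : β ∈ R) : ∃ k : ℤ, 2 * I α β = k * I α α ∧ β - (k : ℝ) • α ∈ R := by
  obtain ⟨k, hk⟩ := h.integral α hα β hβ
  rw [coroot_apply_eq_iff (h.nonisotropic α hα)] at hk
  refine ⟨k, hk, ?_⟩
  rw [← refl_eq hI (h.nonisotropic α hα) hk, ← h.refl_image α hα]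
  exact Set.mem_image_of_mem _ hβ

theorem span_eq_top (h : IsGeneralizedRootSystem I R) : Submodule.span ℝ R = ⊤ := by
  rw [← h.lattice_full, rootLattice, Submodule.span_span_of_tower]

section Projection

open scoped InnerProductSpace

variable {V : Type*} [NormedAddCommGroup V] [InnerProductSpace ℝ V] {p : F →ₗ[ℝ] V}

theorem isCrystallographic_image (h : IsGeneralizedRootSystem I R)
    (hp : ∀ x y, I x y = ⟪p x, p y⟫_ℝ) : IsCrystallographic (p '' R) where
  ne_zero := by
    rintro _ ⟨x, hx, rfl⟩ h0
    exact h.nonisotropic x hx (by rw [hp, h0, inner_zero_left])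
  exists_sub_smul_mem := by
    rintro _ ⟨x, hx, rfl⟩ _ ⟨y, hy, rfl⟩
    obtain ⟨k, hk, hmem⟩ :=
      h.exists_sub_smul_mem (fun x y => by rw [hp, hp, real_inner_comm]) hx hy
    exact ⟨k, by rw [← hp, ← hp]; exact hk, _, hmem, by rw [map_sub, map_smul]⟩

theorem irreducible_image (h : IsGeneralizedRootSystem I R) (hp : ∀ x y, I x y = ⟪p x, p y⟫_ℝ) :
    ∀ Δ ⊆ p '' R, (∀ α ∈ Δ, ∀ β ∈ p '' R \ Δ, ⟪α, β⟫_ℝ = 0) → Δ = ∅ ∨ Δ = p '' R := by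
  intro Δ hΔ horth
  have hsplit := h.irreducible (R ∩ p ⁻¹' Δ) (R \ p ⁻¹' Δ) (Set.inter_union_sdiff _ _)
    fun α hα β hβ => by
      rw [hp]
      exact horth _ hα.2 _ ⟨Set.mem_image_of_mem p hβ.1, hβ.2⟩
  refine hsplit.imp (fun hempty => ?_) fun hempty => ?_
  · rw [← Set.inter_eq_right.2 hΔ, ← Set.image_inter_preimage, hempty, Set.image_empty]
  · exact hΔ.antisymm (Set.image_subset_iff.2 (Set.sdiff_eq_empty.1 hempty))

theorem exists_isFrame_image (h : IsGeneralizedRootSystem I R) (hp : ∀ x y, I x y = ⟪p x, p y⟫_ℝ)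
    (hsurj : Function.Surjective p) {l : ℕ} (e₀ : Module.Basis (Fin l) ℝ V)
    (hR : ¬ IsReduced R) :
    ∃ (e : Module.Basis (Fin l) ℝ V) (i₀ : Fin l) (f : Fin l → F),
      IsFrame (p '' R) e i₀ ∧ (∀ i, p (f i) = e i) ∧ f i₀ ∈ R ∧ (2 : ℝ) • f i₀ ∈ R ∧
        ∀ i, i ≠ i₀ → f i₀ - f i ∈ R := by
  obtain ⟨α, hα, hα2⟩ := exists_two_smul_mem_of_not_isReduced hR
  have hspan : Submodule.span ℝ (p '' R) = ⊤ := by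
    rw [Submodule.span_image, h.span_eq_top, Submodule.map_top, LinearMap.range_eq_top.2 hsurj]
  obtain ⟨e, i₀, he, hframe⟩ := (h.isCrystallographic_image hp).exists_isFrame
    (h.irreducible_image hp) hspan e₀ (α := p α)
    ⟨Set.mem_image_of_mem p hα, _, hα2, map_smul p _ _⟩
  have hlift : ∀ i, ∃ x, p x = e i ∧ (i = i₀ → x = α) ∧ (i ≠ i₀ → α - x ∈ R) := fun i => by
    rcases eq_or_ne i i₀ with rfl | hi
    · exact ⟨α, he.symm, fun _ => rfl, fun hne => absurd rfl hne⟩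
    · obtain ⟨β, hβ, hpβ⟩ := hframe.sub_mem i hi
      exact ⟨α - β, by rw [map_sub, hpβ, he, sub_sub_cancel], fun h => absurd h hi,
        fun _ => by rwa [sub_sub_cancel]⟩
  choose f hpf hf₀ hf using hlift
  obtain rfl := hf₀ i₀ rfl
  exact ⟨e, i₀, f, hframe, hpf, hα, hα2, hf⟩

end Projection

end IsGeneralizedRootSystem

/-- Linear coordinates on `F` in which the root lattice is the standard one, the marking is the line
of `a`, the form is standard up to the factor `N`, and the roots of `BC_l` occurring in `IsFramed`
are roots. -/
structure IsRootChart {l : ℕ} (I : LinearMap.BilinForm ℝ F) (R : Set F) (G : Submodule ℝ F)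
    (T : Space l ≃ₗ[ℝ] F) (N : ℝ) (i₀ : Fin l) : Prop where
  pos : 0 < N
  form_apply : ∀ v w, I (T v) (T w) = N * form l v w
  image_range_realPt : T '' Set.range (realPt l) = rootLattice R
  image_lineA : T '' lineA l = G
  isFramed : IsFramed {x | T (realPt l x) ∈ R} i₀

namespace IsRootChart

variable {l : ℕ} {T : Space l ≃ₗ[ℝ] F} {N : ℝ} {i₀ : Fin l}

theorem image_image_realPt (h : IsRootChart I R G T N i₀) :
    T '' (realPt l '' {x | T (realPt l x) ∈ R}) = R := by
  rw [Set.image_image]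
  refine Set.image_preimage_eq_of_subset (f := fun x => T (realPt l x)) fun x hx => ?_
  obtain ⟨_, ⟨n, rfl⟩, rfl⟩ := h.image_range_realPt.ge (Submodule.subset_span hx)
  exact ⟨n, rfl⟩

theorem closure_eq_top (h : IsRootChart I R G T N i₀) :
    AddSubgroup.closure {x | T (realPt l x) ∈ R} = ⊤ := by
  let φ : (Fin l → ℤ) × (ℤ × ℤ) →+ F := T.toLinearMap.toAddMonoidHom.comp (realPt l)
  have hφ : Function.Injective φ := T.injective.comp realPt_injective
  refine AddSubgroup.map_injective hφ (SetLike.coe_injective ?_)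
  have hφR : φ '' {x | T (realPt l x) ∈ R} = R :=
    (Set.image_image T (realPt l) _).symm.trans h.image_image_realPt
  rw [AddMonoidHom.map_closure, hφR, ← AddMonoidHom.range_eq_map, AddMonoidHom.coe_range,
    ← Submodule.span_int_eq_addSubgroupClosure]
  exact h.image_range_realPt.symm.trans (Set.range_comp T (realPt l)).symm

theorem exists_type (h : IsRootChart I R G T N i₀) :
    ∃ t : EllipticType, t.Admissible l ∧
      MarkedSimilar I R G (form l) (t.roots l) (lineA l) := by
  obtain ⟨t, ht, hsim⟩ := h.isFramed.exists_type h.closure_eq_top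
  have hT : MarkedSimilar (form l) (realPt l '' {x | T (realPt l x) ∈ R}) (lineA l) I R G :=
    ⟨T, h.image_image_realPt, h.image_lineA, N, h.pos, h.form_apply⟩
  exact ⟨t, ht, hT.symm.trans hsim⟩

end IsRootChart

section

open scoped InnerProductSpace

variable {V : Type*} [NormedAddCommGroup V] [InnerProductSpace ℝ V] {p : F →ₗ[ℝ] V} {l : ℕ}
  {e : Module.Basis (Fin l) ℝ V} {i₀ : Fin l} {T : Space l ≃ₗ[ℝ] F}

theorem IsFrame.form_apply (he : IsFrame (p '' R) e i₀) (hp : ∀ x y, I x y = ⟪p x, p y⟫_ℝ)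
    (hpT : ∀ v, p (T v) = ∑ i, v.1 i • e i) (v w : Space l) :
    I (T v) (T w) = ⟪e i₀, e i₀⟫_ℝ * form l v w := by
  rw [hp, hpT, hpT, inner_sum_smul_sum_smul he.inner_apply, MERS.form_apply]

theorem IsFrame.isBCVec (he : IsFrame (p '' R) e i₀) (hpT : ∀ v, p (T v) = ∑ i, v.1 i • e i)
    {x : (Fin l → ℤ) × (ℤ × ℤ)} (hx : T (realPt l x) ∈ R) : IsBCVec x.1 := by
  obtain ⟨n, hn, hBC⟩ := he.exists_isBCVec _ (Set.mem_image_of_mem p hx)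
  suffices x.1 = n by rwa [this]
  rw [hpT] at hn
  refine realVec_injective (e.equivFun.symm.injective ?_)
  rw [e.equivFun_symm_apply, e.equivFun_symm_apply]
  exact hn

theorem IsFrame.map_mem_span (he : IsFrame (p '' R) e i₀) :
    ∀ x ∈ rootLattice R, p x ∈ Submodule.span ℤ (Set.range e) := by
  suffices rootLattice R ≤ (Submodule.span ℤ (Set.range e)).comap (p.restrictScalars ℤ) from this
  refine Submodule.span_le.2 fun x hx => ?_
  obtain ⟨n, hn, -⟩ := he.exists_isBCVec _ (Set.mem_image_of_mem p hx)
  rw [SetLike.mem_coe, Submodule.mem_comap, LinearMap.restrictScalars_apply, hn]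
  refine Submodule.sum_mem _ fun i _ => ?_
  rw [Int.cast_smul_eq_zsmul]
  exact Submodule.smul_mem _ _ (Submodule.subset_span (Set.mem_range_self i))

theorem IsFrame.isFramed (he : IsFrame (p '' R) e i₀) (h : IsGeneralizedRootSystem I R)
    (hp : ∀ x y, I x y = ⟪p x, p y⟫_ℝ) (hpT : ∀ v, p (T v) = ∑ i, v.1 i • e i)
    (hshort : T (realPt l (Pi.single i₀ 1, 0)) ∈ R)
    (hlong : (2 : ℝ) • T (realPt l (Pi.single i₀ 1, 0)) ∈ R)
    (hmiddle : ∀ i, i ≠ i₀ →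
      T (realPt l (Pi.single i₀ 1, 0)) - T (realPt l (Pi.single i 1, 0)) ∈ R) :
    IsFramed {x | T (realPt l x) ∈ R} i₀ where
  isBCVec _ := he.isBCVec hpT
  exists_sub_smul_mem x hx y hy := by
    obtain ⟨k, hk, hmem⟩ :=
      h.exists_sub_smul_mem (fun x y => by rw [hp, hp, real_inner_comm]) hx hy
    have hN : ⟪e i₀, e i₀⟫_ℝ ≠ 0 := (real_inner_self_pos.2 (e.ne_zero i₀)).ne'
    refine ⟨k, ?_, ?_⟩
    · rw [he.form_apply hp hpT, he.form_apply hp hpT, form_realPt, form_realPt,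
        mul_left_comm, mul_left_comm (k : ℝ)] at hk
      exact_mod_cast mul_left_cancel₀ hN hk
    · rwa [Int.cast_smul_eq_zsmul, ← map_zsmul, ← map_sub, ← map_zsmul, ← map_sub] at hmem
  short_mem := hshort
  long_mem := by
    have hdouble : (((2 : ℤ) • Pi.single i₀ 1, 0) : (Fin l → ℤ) × (ℤ × ℤ)) =
        (2 : ℤ) • (Pi.single i₀ 1, 0) := by rw [Prod.smul_mk, smul_zero]
    rwa [Set.mem_ofPred_eq, hdouble, map_zsmul, map_zsmul, ← Int.cast_smul_eq_zsmul ℝ]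
  middle_mem i hi := by
    have hdiff : ((Pi.single i₀ 1 - Pi.single i 1, 0) : (Fin l → ℤ) × (ℤ × ℤ)) =
        (Pi.single i₀ 1, 0) - (Pi.single i 1, 0) := by rw [Prod.mk_sub_mk, sub_zero]
    rw [Set.mem_ofPred_eq, hdiff, map_sub, map_sub]
    exact hmiddle i hi

end

theorem exists_linearEquiv_space {V : Type*} [AddCommGroup V] [Module ℝ V]
    [FiniteDimensional ℝ F] {l : ℕ} (hd : Module.finrank ℝ F = l + 2) (Q : Submodule ℤ F)
    [DiscreteTopology Q] [IsZLattice ℝ Q] (p : F →ₗ[ℝ] V) (e : Module.Basis (Fin l) ℝ V)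
    (hp : ∀ x ∈ Q, p x ∈ Submodule.span ℤ (Set.range e)) {f : Fin l → F} (hfQ : ∀ i, f i ∈ Q)
    (hf : ∀ i, p (f i) = e i) {x₀ : F} (hx₀Q : x₀ ∈ Q) (hx₀ : x₀ ≠ 0) (hpx₀ : p x₀ = 0) :
    ∃ T : Space l ≃ₗ[ℝ] F, T '' Set.range (realPt l) = Q ∧
      (∀ i, T (realPt l (Pi.single i 1, 0)) = f i) ∧ (∀ v, p (T v) = ∑ i, v.1 i • e i) ∧
      ∃ c : ℤ, x₀ = c • T (vecA l) := by
  obtain ⟨B, hBQ, hBf, hpB, c, hc⟩ := exists_basis_sum_fin (by rw [hd, Fintype.card_fin]) Q p e hp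
    hfQ hf hx₀Q hx₀ hpx₀ (0 : Fin 2)
  let T : Space l ≃ₗ[ℝ] F := (spaceBasis l).equiv B (Equiv.refl _)
  have hT : ∀ k, T (spaceBasis l k) = B k := fun k => Module.Basis.equiv_apply ..
  refine ⟨T, ?_, fun i => ?_, fun v => ?_, c, ?_⟩
  · rw [← coe_span_spaceBasis, ← hBQ, ← funext hT, Set.range_comp' T]
    exact congrArg SetLike.coe (Submodule.map_span (T.toLinearMap.restrictScalars ℤ) _)
  · rw [← spaceBasis_inl, hT, hBf]
  · have hpT : p ∘ₗ T.toLinearMap = e.equivFun.symm.toLinearMap ∘ₗ LinearMap.fst ℝ _ _ := by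
      refine (spaceBasis l).ext fun k => ?_
      rw [LinearMap.comp_apply, LinearEquiv.coe_coe, hT]
      rcases k with i | j
      · simp [hBf, hf, spaceBasis]
      · simp [hpB, spaceBasis]
    exact (LinearMap.congr_fun hpT v).trans (e.equivFun_symm_apply v.1)
  · rw [vecA_eq, ← spaceBasis_inr_zero, hT, hc]

theorem image_lineA_eq {l : ℕ} (T : Space l ≃ₗ[ℝ] F) (hG : Module.finrank ℝ G = 1) {x : F}
    (hxG : x ∈ G) (hx : x ≠ 0) {c : ℤ} (hc : x = c • T (vecA l)) : T '' lineA l = G := by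
  rw [← Int.cast_smul_eq_zsmul ℝ] at hc
  have hc0 : (c : ℝ) ≠ 0 := fun h => hx (by rw [hc, h, zero_smul])
  have hmap : (lineA l).map T.toLinearMap = Submodule.span ℝ {x} := by
    rw [hc, Submodule.span_singleton_smul_eq hc0.isUnit, lineA, Submodule.map_span,
      Set.image_singleton, LinearEquiv.coe_coe]
  have hspan : Submodule.span ℝ {x} = G := by
    have : FiniteDimensional ℝ G := Module.finite_of_finrank_eq_succ hG
    exact Submodule.eq_of_le_of_finrank_eq ((Submodule.span_singleton_le_iff_mem _ _).2 hxG)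
      (by rw [hG, finrank_span_singleton hx])
  rw [← hspan, ← hmap, Submodule.map_coe, LinearEquiv.coe_coe]

theorem IsMarkedElliptic.exists_isRootChart {l : ℕ} (h : IsMarkedElliptic l I R G)
    (hR : ¬ IsReduced R) :
    ∃ (T : Space l ≃ₗ[ℝ] F) (N : ℝ) (i₀ : Fin l), IsRootChart I R G T N i₀ := by
  have := h.signature.finiteDimensional
  have := h.rootSystem.lattice_discrete
  have : IsZLattice ℝ (rootLattice R) := ⟨h.rootSystem.lattice_full⟩
  obtain ⟨p, hsurj, hp⟩ := h.signature.exists_projection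
  obtain ⟨e, i₀, f, he, hpf, hshort, hlong, hmiddle⟩ := h.rootSystem.exists_isFrame_image hp hsurj
    (EuclideanSpace.basisFun (Fin l) ℝ).toBasis hR
  obtain ⟨x₀, hx₀G, hx₀Q, hx₀⟩ := h.marking.exists_mem_rootLattice
  have hpx₀ : p x₀ = 0 := by
    rw [← inner_self_eq_zero (𝕜 := ℝ), ← hp, show I x₀ = 0 from h.marking.le_rad hx₀G,
      LinearMap.zero_apply]
  have hfQ : ∀ i, f i ∈ rootLattice R := fun i => by
    rcases eq_or_ne i i₀ with rfl | hi
    · exact Submodule.subset_span hshort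
    · rw [← sub_sub_cancel (f i₀) (f i)]
      exact sub_mem (Submodule.subset_span hshort) (Submodule.subset_span (hmiddle i hi))
  obtain ⟨T, hTQ, hTf, hpT, c, hc⟩ := exists_linearEquiv_space h.signature.finrank_eq _ p e
    he.map_mem_span hfQ hpf hx₀Q hx₀ hpx₀
  refine ⟨T, _, i₀, real_inner_self_pos.2 (e.ne_zero i₀), he.form_apply hp hpT, hTQ,
    image_lineA_eq T h.marking.finrank_eq hx₀G hx₀ hc, ?_⟩
  refine he.isFramed h.rootSystem hp hpT ?_ ?_ fun i hi => ?_
  · rwa [hTf]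
  · rwa [hTf]
  · rw [hTf, hTf]
    exact hmiddle i hi

theorem IsMarkedElliptic.exists_type {l : ℕ} (h : IsMarkedElliptic l I R G)
    (hR : ¬ IsReduced R) : ∃ t : EllipticType, t.Admissible l ∧
      MarkedSimilar I R G (form l) (t.roots l) (lineA l) :=
  let ⟨_, _, _, hT⟩ := h.exists_isRootChart hR; hT.exists_type

end

end MERS

theorem mainTheorem1 :
    Nat.card MERS.EllipticType = 35 ∧
    -- every entry of the list is a non-reduced marked elliptic root system with the stated quotient
    (∀ (l : ℕ) (t : MERS.EllipticType), t.Admissible l →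
      MERS.IsMarkedElliptic l (MERS.form l) (t.roots l) (MERS.lineA l) ∧
      ¬ MERS.IsReduced (t.roots l) ∧
      ∃ e : (MERS.Space l ⧸ MERS.lineA l) ≃ₗ[ℝ] (Fin l → ℝ) × ℝ,
        e '' MERS.quotientRoots (t.roots l) (MERS.lineA l) = t.quotient.roots l) ∧
    -- every non-reduced marked elliptic root system is isomorphic to exactly one entry
    (∀ (l : ℕ) (F : Type*) [NormedAddCommGroup F] [NormedSpace ℝ F]
      (I : LinearMap.BilinForm ℝ F) (R : Set F) (G : Submodule ℝ F),
      MERS.IsMarkedElliptic l I R G → ¬ MERS.IsReduced R →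
      ∃ t : MERS.EllipticType, t.Admissible l ∧
        MERS.MarkedSimilar I R G (MERS.form l) (t.roots l) (MERS.lineA l) ∧
        (∃ e : (F ⧸ G) ≃ₗ[ℝ] (Fin l → ℝ) × ℝ,
          e '' MERS.quotientRoots R G = t.quotient.roots l) ∧
        ∀ t' : MERS.EllipticType, t'.Admissible l →
          MERS.MarkedIso R G (t'.roots l) (MERS.lineA l) → t' = t) := by
  refine ⟨MERS.EllipticType.natCard_eq, fun l t ht => ⟨MERS.EllipticType.isMarkedElliptic_roots ht,
    MERS.EllipticType.not_isReduced_roots t ht.one_le, MERS.quotientEquiv l,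
    t.quotientEquiv_image l⟩, ?_⟩
  intro l F _ _ I R G h hR
  obtain ⟨t, ht, hsim⟩ := h.exists_type hR
  obtain ⟨e, he⟩ := hsim.markedIso.exists_quotient
  refine ⟨t, ht, hsim, ⟨e.trans (MERS.quotientEquiv l), ?_⟩, fun t' ht' hiso => ?_⟩
  · rw [← t.quotientEquiv_image l, ← he]
    exact Set.image_comp (MERS.quotientEquiv l) e _
  · exact MERS.EllipticType.eq_of_markedIso ht' ht (hiso.symm.trans hsim.markedIso)
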